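/- **Setting.** Let $\Omega\subset\{(r,z): r>0\}$ be a bounded Lipschitz domain, $\Gamma:=\partial\Omega\cap\{r>0\}$. For an integer $s$ let $L^2_s(\Omega)$ be the space with norm $\|q\|_{L^2_s}^2=\int_\Omega r^s|q|^2\,dr\,dz$ (index omitted for $s=0$), and let $H^1_1(\Omega)$ be the space of $q\in L^2_1(\Omega)$ with weak gradient in $L^2_1(\Omega)$. Put $$\boldsymbol V:=\{\boldsymbol v=(v_r,v_z)\in H^1_1(\Omega)^2:\ v_r\in L^2_{-1}(\Omega),\ \boldsymbol v=0\text{ on }\Gamma\},\qquad Q:=\{q\in L^2_1(\Omega):\textstyle\int_\Omega r q=0\},$$ $$a(\boldsymbol u,\boldsymbol v):=\int_\Omega r\,\nabla\boldsymbol u:\nabla\boldsymbol v+\int_\Omega r^{-1}u_rv_r,\qquad b(q,\boldsymbol v):=\int_\Omega \operatorname{div}_{(r,z)}(r\boldsymbol v)\,q,\qquad \|\boldsymbol v\|_{\boldsymbol V}:=a(\boldsymbol v,\boldsymbol v)^{1/2}.$$ Let $\nu>0$, $\boldsymbol f\in L^2_1(\Omega)^2$, and let $(\boldsymbol u,p)\in\boldsymbol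 V\times Q$ be the weak solution of the axisymmetric Stokes problem: $\nu a(\boldsymbol u,\boldsymbol v)+b(p,\boldsymbol v)=(\boldsymbol f,r\boldsymbol v)_{L^2}$ for all $\boldsymbol v\in\boldsymbol V$ and $b(q,\boldsymbol u)=0$ for all $q\in Q$. The Helmholtz projection of $\boldsymbol f$ is $\mathbb P\boldsymbol f:=\boldsymbol f-\nabla\alpha$, where $\alpha\in H^1_1(\Omega)$ satisfies $\int_\Omega r\nabla\alpha\cdot\nabla\beta=\int_\Omega r\boldsymbol f\cdot\nabla\beta$ for all $\beta\in H^1_1(\Omega)$. The Helmholtz projection $\mathbb P(\Delta_{\rm axi}\boldsymbol u)$ of the functional $\Delta_{\rm axi}\boldsymbol u:=-a(\boldsymbol u,\cdot)$ is identified with its representation $-\nu^{-1}\mathbb P\boldsymbol f\in L^2_1(\Omega)^2$. Let $\mathcal T$ be a conforming triangulation of $\Omega$ (which is therefore polygonal) that is shape regular with parameter $\sigma>0$, i.e. each triangle $T$ contains a disc of radius $h_T/\sigma$, $h_T:=\operatorname{diam}T$; let $h$ be the function with $h|_T=h_T$. Let $\boldsymbol V_h$ be the lowest-order Bernardi–Raugel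 space: all $\boldsymbol w\in\boldsymbol V$ that are the sum of a continuous piecewise affine field and a linear combination of the edge bubbles $\lambda_i\lambda_j\boldsymbol n_E$, $E=\operatorname{conv}\{N_i,N_j\}$ an edge with unit normal $\boldsymbol n_E$, where $\lambda_i,\lambda_j$ are the barycentric hat functions. Let $Q_h$ be the set of all piecewise constant $q\in Q$, and $\boldsymbol V_{h,0}:=\{\boldsymbol w\in\boldsymbol V_h: b(q,\boldsymbol w)=0\ \forall q\in Q_h\}$. Let $\mathrm{RT}_0(\mathcal T)$ and $\mathrm{BDM}_1(\mathcal T)$ be the spaces of fields that are on each triangle of the form $\boldsymbol x\mapsto \boldsymbol a+c\,\boldsymbol x$ ($\boldsymbol a\in\mathbb R^2$, $c\in\mathbb R$), respectively affine, and have continuous normal components across interior edges. For a continuous field $\boldsymbol F$, the standard interpolants $\Pi_{\mathrm{RT}0}\boldsymbol F\in\mathrm{RT}_0(\mathcal T)$ and $\Pi_{\mathrm{BDM}1}\boldsymbol F\in \mathrm{BDM}_1(\mathcal T)$ are given by $\int_E(\Pi_{\mathrm{RT}0}\boldsymbol F-\boldsymbol F)\cdot\boldsymbol n_E\,ds=0$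 for all edges $E$, respectively $\int_E(\Pi_{\mathrm{BDM}1}\boldsymbol F-\boldsymbol F)\cdot\boldsymbol n_E\,q\,ds=0$ for all edges $E$ and $q\in P_1(E)$. **Theorem 4.2.** There is a constant $C$ depending only on $\Omega$ and $\sigma$ such that for all $\mathcal T$, $\nu$, $\boldsymbol f$, $(\boldsymbol u,p)$ as above the following holds. 1. If $\boldsymbol f\in L^2(\Omega)$, then $\mathbb P(\Delta_{\rm axi}\boldsymbol u)\in L^2(\Omega)$. 2. If $\mathbb P(\Delta_{\rm axi}\boldsymbol u)\in L^2(\Omega)$, then for both $\Pi=\Pi_{\mathrm{RT}0}$ and $\Pi=\Pi_{\mathrm{BDM}1}$ $$\|\mathbb P(\Delta_{\rm axi}\boldsymbol u)\circ(\mathbb I-\Pi)\|_{\boldsymbol V_{h,0}^\star}:=\sup_{0\neq\boldsymbol w_h\in\boldsymbol V_{h,0}}\frac{\big(\mathbb P(\Delta_{\rm axi}\boldsymbol u),\,r\boldsymbol w_h-\Pi(r\boldsymbol w_h)\big)_{L^2}}{\|\boldsymbol w_h\|_{\boldsymbol V}}\ \le\ C\,\|h\,\mathbb P(\Delta_{\rm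 axi}\boldsymbol u)\|_{L^2}$$ (the supremum being $0$ if $\boldsymbol V_{h,0}=\{0\}$). -/

import Mathlib

open MeasureTheory
open scoped ContDiff NNReal ENNReal RealInnerProductSpace

noncomputable section

namespace AxiStokes

/-- The meridional `(r,z)`-plane with its Euclidean structure: `x 0 = r` and `x 1 = z`. -/
abbrev Plane := EuclideanSpace ℝ (Fin 2)

/-- Bounded Lipschitz domain: open, connected, nonempty, bounded, and near each boundary point it
is, after a rigid motion, the region strictly above the graph of a Lipschitz function. -/
def IsLipschitzDomain (Ω : Set Plane) : Prop :=
  IsOpen Ω ∧ IsConnected Ω ∧ Bornology.IsBounded Ω ∧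
    ∀ x ∈ frontier Ω, ∃ (e : Plane ≃ᵢ Plane) (U : Set Plane) (γ : ℝ → ℝ) (L : ℝ≥0),
      IsOpen U ∧ x ∈ U ∧ LipschitzWith L γ ∧ ∀ y ∈ U, (y ∈ Ω ↔ γ (e y 0) < e y 1)

/-- Membership in the weighted space `L²_s(Ω)`, whose squared norm is `∫_Ω r^s |v|²`. -/
def MemL2 {F : Type*} [NormedAddCommGroup F] (Ω : Set Plane) (s : ℤ) (v : Plane → F) : Prop :=
  AEStronglyMeasurable v (volume.restrict Ω) ∧
    IntegrableOn (fun x => (x 0) ^ s * ‖v x‖ ^ 2) Ω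

/-- Integration by parts `∫_Ω q ∂ᵢφ = - ∫_Ω gᵢ φ` for all smooth `φ` with compact support in `U`.
* For `U = Ω` it says that `g` is the weak gradient of `q` on `Ω`.
* For an open `U ⊇ Ω` it says that the extensions by zero of `q` and `g` are a function and its weak
  gradient on `U`, i.e. that moreover the trace of `q` vanishes on `∂Ω ∩ U`. -/
def IsWeakGrad (Ω U : Set Plane) (q : Plane → ℝ) (g : Plane → Plane) : Prop :=
  ∀ φ : Plane → ℝ, ContDiff ℝ ∞ φ → HasCompactSupport φ → tsupport φ ⊆ U →
    ∀ i : Fin 2, ∫ x in Ω, q x * fderiv ℝ φ x (EuclideanSpace.single i 1)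
      = - ∫ x in Ω, g x i * φ x

/-- The open half plane off the rotation axis. -/
def offAxis : Set Plane := {x | 0 < x 0}

/-- The scalar space `H¹_1(Ω)`: a function together with its weak gradient. -/
structure H1 (Ω : Set Plane) where
  val : Plane → ℝ
  grad : Plane → Plane
  val_mem : MemL2 Ω 1 val
  grad_mem : MemL2 Ω 1 grad
  weak : IsWeakGrad Ω Ω val grad

/-- The velocity space `V`: fields `v ∈ H¹_1(Ω)²` with `v_r ∈ L²_{-1}(Ω)` and zero trace on
`Γ = ∂Ω ∩ {r > 0}`, together with the weak gradients `grad i` of the components `v_i`. -/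
structure Vel (Ω : Set Plane) where
  val : Plane → Plane
  grad : Fin 2 → Plane → Plane
  val_mem : MemL2 Ω 1 val
  grad_mem : ∀ i, MemL2 Ω 1 (grad i)
  radial_mem : MemL2 Ω (-1) (fun x => val x 0)
  weak : ∀ i, IsWeakGrad Ω offAxis (fun x => val x i) (grad i)

/-- The pressure space `Q = {q ∈ L²_1(Ω) : ∫_Ω r q = 0}`. -/
def MemQ (Ω : Set Plane) (q : Plane → ℝ) : Prop :=
  MemL2 Ω 1 q ∧ ∫ x in Ω, x 0 * q x = 0

/-- `a(u,v) = (∇u, ∇v)_{L²_1} + (u_r, v_r)_{L²_{-1}}`. -/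
def formA {Ω : Set Plane} (u v : Vel Ω) : ℝ :=
  (∫ x in Ω, x 0 * ∑ i, ⟪u.grad i x, v.grad i x⟫) +
    ∫ x in Ω, (x 0)⁻¹ * (u.val x 0 * v.val x 0)

/-- The energy norm `‖v‖_V = a(v,v)^{1/2}`. -/
def Vel.energyNorm {Ω : Set Plane} (v : Vel Ω) : ℝ := Real.sqrt (formA v v)

/-- `div_{(r,z)}(r v) = r div_{(r,z)} v + v_r`. -/
def divR {Ω : Set Plane} (v : Vel Ω) (x : Plane) : ℝ :=
  x 0 * (v.grad 0 x 0 + v.grad 1 x 1) + v.val x 0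

/-- `b(q,v) = (div_{(r,z)}(r v), q)_{L²}`. -/
def formB {Ω : Set Plane} (q : Plane → ℝ) (v : Vel Ω) : ℝ :=
  ∫ x in Ω, divR v x * q x

/-- `(u,p) ∈ V × Q` is the weak solution of the axisymmetric Stokes problem with data `f`. -/
def IsStokesSolution {Ω : Set Plane} (ν : ℝ) (f : Plane → Plane) (u : Vel Ω) (p : Plane → ℝ) :
    Prop :=
  MemQ Ω p ∧
    (∀ v : Vel Ω, ν * formA u v + formB p v = ∫ x in Ω, ⟪f x, x 0 • v.val x⟫) ∧
    ∀ q, MemQ Ω q → formB q u = 0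

/-- `α = α_f ∈ H¹_1(Ω)` is the potential of the gradient part of `f`, i.e.
`(∇α, ∇β)_{L²_1} = (f, ∇β)_{L²_1}` for all `β ∈ H¹_1(Ω)`; it is unique up to constants. -/
def IsHelmholtzPotential {Ω : Set Plane} (f : Plane → Plane) (α : H1 Ω) : Prop :=
  ∀ β : H1 Ω, ∫ x in Ω, x 0 * ⟪α.grad x, β.grad x⟫ = ∫ x in Ω, x 0 * ⟪f x, β.grad x⟫

/-- The Helmholtz projection `ℙ f = f - ∇α_f`, where `α = α_f`. -/
def helmholtzProj {Ω : Set Plane} (f : Plane → Plane) (α : H1 Ω) : Plane → Plane :=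
  fun x => f x - α.grad x

/-- The `L²_1`-representation `-ν⁻¹ ℙ f` of `ℙ(Δ_axi u)`, where `u` is the Stokes velocity with
viscosity `ν` and data `f`, and `α = α_f`. -/
def projLaplacian {Ω : Set Plane} (ν : ℝ) (f : Plane → Plane) (α : H1 Ω) : Plane → Plane :=
  fun x => -(ν⁻¹ • helmholtzProj f α x)

/-- A regular (conforming) triangulation of `Ω`: a finite, purely two-dimensional simplicial
complex that fills the closure of `Ω`. Simplices are given by their vertex sets. -/
structure Triangulation (Ω : Set Plane) extends Geometry.SimplicialComplex ℝ Plane where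
  finite : faces.Finite
  pure : ∀ s ∈ faces, ∃ K ∈ faces, s ⊆ K ∧ K.card = 3
  space_eq : toSimplicialComplex.space = closure Ω

namespace Triangulation

variable {Ω : Set Plane} (T : Triangulation Ω)

/-- The triangles of the mesh. -/
def triangles : Finset (Finset Plane) := T.finite.toFinset.filter (fun s => s.card = 3)

/-- Shape regularity: every triangle `K` contains a disc of radius at least `h_K / σ`. -/
def ShapeRegular (σ : ℝ) : Prop :=
  ∀ K ∈ T.triangles, ∃ c : Plane,
    Metric.closedBall c (Metric.diam (convexHull ℝ (K : Set Plane)) / σ) ⊆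
      convexHull ℝ (K : Set Plane)

/-- The piecewise constant mesh size function, equal to `h_K = diam K` inside each triangle `K`. -/
def meshSize (x : Plane) : ℝ :=
  ∑ K ∈ T.triangles, (interior (convexHull ℝ (K : Set Plane))).indicator
    (fun _ => Metric.diam (convexHull ℝ (K : Set Plane))) x

/-- The Bernardi–Raugel velocity space `V_h`: the `w ∈ V` which on each closed triangle `K` are an
affine field plus a combination of the edge bubbles `λ_i λ_j n_E`, `E = {N_i, N_j} ⊆ K`. The
coefficient `c E` (a multiple of the normal `n_E`) is common to the triangles sharing `E`, and a
point of `K` is written through its barycentric coordinates `l N`, `N ∈ K`. -/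
def bernardiRaugel : Set (Vel Ω) :=
  {w | ∃ c : Finset Plane → Plane,
    (∀ E : Finset Plane, ∀ N ∈ E, ∀ M ∈ E, ⟪c E, M - N⟫ = 0) ∧
    ∀ K ∈ T.triangles, ∃ A : Plane →ᵃ[ℝ] Plane,
      ∀ l : Plane → ℝ, (∀ N ∈ K, 0 ≤ l N) → ∑ N ∈ K, l N = 1 →
        w.val (∑ N ∈ K, l N • N) =
          A (∑ N ∈ K, l N • N) + ∑ E ∈ K.powersetCard 2, (∏ N ∈ E, l N) • c E}

/-- The discrete pressure space `Q_h = P_0(T) ∩ Q`. -/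
def MemQh (q : Plane → ℝ) : Prop :=
  (∀ K ∈ T.triangles, ∃ c : ℝ, ∀ x ∈ interior (convexHull ℝ (K : Set Plane)), q x = c) ∧ MemQ Ω q

/-- The discretely divergence-free velocities `V_{h,0}`. -/
def discDivFree : Set (Vel Ω) :=
  {w | w ∈ T.bernardiRaugel ∧ ∀ q, T.MemQh q → formB q w = 0}

/-- `R` is given inside each triangle `K` by the field `P K`, which is of the local type `Loc`, and
`R` is `H(div)`-conforming: the normal components agree on edges shared by two triangles. -/
def IsHdivPiecewise (Loc : Set (Plane → Plane)) (R : Plane → Plane)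
    (P : Finset Plane → Plane → Plane) : Prop :=
  (∀ K ∈ T.triangles, P K ∈ Loc ∧
    Set.EqOn R (P K) (interior (convexHull ℝ (K : Set Plane)))) ∧
  ∀ K ∈ T.triangles, ∀ K' ∈ T.triangles, ∀ N M : Plane, N ≠ M → N ∈ K → M ∈ K → N ∈ K' → M ∈ K' →
    ∀ x ∈ segment ℝ N M, ∀ n : Plane, ⟪M - N, n⟫ = 0 → ⟪P K x, n⟫ = ⟪P K' x, n⟫

end Triangulation

/-- The line integral `∫_E g ds` over the edge `E` with endpoints `N` and `M`. -/
def edgeIntegral (N M : Plane) (g : Plane → ℝ) : ℝ :=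
  dist N M * ∫ t in (0 : ℝ)..1, g (AffineMap.lineMap N M t)

/-- The local Raviart–Thomas space: fields `x ↦ a + c x`. -/
def localRT0 : Set (Plane → Plane) := {P | ∃ (a : Plane) (c : ℝ), ∀ x, P x = a + c • x}

/-- The local Brezzi–Douglas–Marini space: all affine vector fields. -/
def localBDM1 : Set (Plane → Plane) := {P | ∃ A : Plane →ᵃ[ℝ] Plane, ∀ x, P x = A x}

namespace Triangulation

variable {Ω : Set Plane} (T : Triangulation Ω)

/-- `R ∈ RT_0(T)` satisfies `∫_E (R - F) · n ds = 0` for all edges `E`. -/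
def IsRT0Interp (F R : Plane → Plane) : Prop :=
  ∃ P, T.IsHdivPiecewise localRT0 R P ∧
    ∀ K ∈ T.triangles, ∀ N ∈ K, ∀ M ∈ K, ∀ n : Plane, ⟪M - N, n⟫ = 0 →
      edgeIntegral N M (fun x => ⟪P K x - F x, n⟫) = 0

/-- `R ∈ BDM_1(T)` satisfies `∫_E (R - F) · n q ds = 0` for all edges `E` and `q ∈ P_1(E)`
(here `q` is the restriction to `E` of an affine function on the plane). -/
def IsBDM1Interp (F R : Plane → Plane) : Prop :=
  ∃ P, T.IsHdivPiecewise localBDM1 R P ∧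
    ∀ K ∈ T.triangles, ∀ N ∈ K, ∀ M ∈ K, ∀ n : Plane, ⟪M - N, n⟫ = 0 →
      ∀ q : Plane →ᵃ[ℝ] ℝ, edgeIntegral N M (fun x => ⟪P K x - F x, n⟫ * q x) = 0

/-- The standard interpolation operator `Π_RT0`; the characterizing conditions determine the
interpolant of a continuous field inside all triangles. -/
def rt0Interp (F : Plane → Plane) : Plane → Plane :=
  Classical.epsilon (fun R => T.IsRT0Interp F R)

/-- The standard interpolation operator `Π_BDM1`. -/
def bdm1Interp (F : Plane → Plane) : Plane → Plane :=
  Classical.epsilon (fun R => T.IsBDM1Interp F R)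

/-- For `G` representing `ℙ(Δ_axi u)`, the consistency error
`‖ℙ(Δ_axi u) ∘ (I - Π)‖ = sup_{w ∈ V_{h,0}} (G, r w - Π(r w))_{L²} / ‖w‖_V`,
the dual norm over `V_{h,0}`, with values in `[0,∞]`. Since `V_{h,0}` is a vector space and `Π` is
linear, cutting off negative quotients does not change the supremum. -/
def consistencyError (interp : (Plane → Plane) → (Plane → Plane)) (G : Plane → Plane) : ℝ≥0∞ :=
  ⨆ w ∈ T.discDivFree, ENNReal.ofReal
    ((∫ x in Ω, ⟪G x, x 0 • w.val x - interp (fun y => y 0 • w.val y) x⟫) / w.energyNorm)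

end Triangulation

end AxiStokes

end

open AxiStokes

/-! The theorem consists of a regularity statement and a consistency estimate, with largely separate
proofs; Hardy inequalities near the axis enter both.

Regularity. Let `G = f - ∇α`, which is orthogonal in `L²_1` to all gradients. Away from the axis the
weight `r` is bounded below, so only boundary points on the axis matter. Near such a point test with
`β = ηα`, `η = θ(z)²/(r+ε)`, `θ` a cutoff. This gives `∫ θ² r/(r+ε) |G|² = ∫ rη f·G + ∫ rα G·∇η`, to
be bounded uniformly in `ε`. All terms are harmless, because `α ∈ L²` by a Hardy inequality
(`H1.memL2_zero`), except the one with `∂_r η = -θ²/(r+ε)²`, whose weight is too singular. Since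
`rG` is divergence free it has a stream function `ψ` with `∂_zψ = -rG_r` and `∂_rψ = rG_z`.
Integration by parts in `z` replaces `α rG_r` by `ψ ∂_zα`, where `∂_zα = f_z - G_z`, and `ψ` is
controlled by the weighted Hardy inequality `lintegral_bwd_weighted_le`. Its constant `1/2` is small
enough to absorb the critical product of `ψ` and `G_z` (`energy_pointwise`), which gives
`weighted_energy_le`; then `ε → 0`.

The difficulty is the boundary: `α` has no zero trace, so its extension by zero is not weakly
differentiable. But near an axis point a Lipschitz domain in the half plane is stable under
translation in some direction `(1,m)` (`IsLipschitzDomain.exists_push`), and testing only with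
functions translated in that direction is then legitimate (`TransGrad`). Line integrals of a cut-off
`α` in direction `(1,m)` are admissible potentials (`exists_H1_fwd`); orthogonality of `G` to their
gradients is the integration by parts against a stream function integrated along `(1,m)`
(`integral_flux_mul`). That stream function does not depend on `m` (`stream_ae_eq`), so the Hardy
inequality may be applied for `m = 0`, where `θ(z)` is constant along the lines.

Consistency. On a triangle a Bernardi–Raugel field `w` is quadratic, so `D(rw)` is quadratic too.
Both interpolants are affine fields whose vertex values have as normal components moments of `rw`
along the edges, with weight `1` for RT0 and `4 - 6t` for BDM1. These weights have mean one, so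
constants are reproduced, and the error is at most a multiple of the oscillation of `rw`, hence of
`h sup |D(rw)|`. An inverse estimate for quadratics (`exists_inverse_estimate`) replaces the
supremum by an `L²` mean over the triangle, and Cauchy–Schwarz sums over the mesh. The energy norm
suffices because `D(rw) = w ⊗ e_r + r Dw`, where the first part is bounded in `L²` by Hardy's
inequality (`Vel.integral_sq_le`). -/

namespace AxiStokes

/-! ### Directional averages in the half plane -/

/-- The direction `(1, m)`, along which the distance to the axis grows with unit speed. -/
def dir (m : ℝ) : Plane := !₂[1, m]

@[simp] lemma dir_zero (m : ℝ) : dir m 0 = 1 := rfl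

@[simp] lemma dir_one (m : ℝ) : dir m 1 = m := rfl

lemma isOpen_offAxis : IsOpen offAxis :=
  isOpen_lt continuous_const (by fun_prop : Continuous fun x : Plane => x 0)

lemma measurableSet_offAxis : MeasurableSet offAxis := isOpen_offAxis.measurableSet

/-- A function on the plane that vanishes off the right half plane and belongs to `L²_s`. -/
structure HalfL2 (s : ℤ) (k : Plane → ℝ) : Prop where
  meas : AEStronglyMeasurable k volume
  int : Integrable (fun x : Plane => (x 0) ^ s * k x ^ 2)
  supp : ∀ x : Plane, x 0 ≤ 0 → k x = 0

lemma MemL2.halfL2 {Ω : Set Plane} (hΩ : MeasurableSet Ω) (hr : Ω ⊆ offAxis) {s : ℤ}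
    {v : Plane → ℝ} (hv : MemL2 Ω s v) : HalfL2 s (Ω.indicator v) where
  meas := (aestronglyMeasurable_indicator_iff hΩ).2 hv.1
  int := by
    have := (integrable_indicator_iff hΩ).2 hv.2
    refine this.congr (Filter.Eventually.of_forall fun x => ?_)
    by_cases hx : x ∈ Ω <;> simp [hx]
  supp x hx := Set.indicator_of_notMem (fun h => absurd (hr h) (not_lt.2 hx)) _

/-- Opposite weights are dual to each other: Young's inequality with `r⁻¹` on one factor and `r` on
the other. -/
lemma HalfL2.integrable_mul {A k : Plane → ℝ} (hA : HalfL2 (-1) A) (hk : HalfL2 1 k) :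
    Integrable fun x => A x * k x := by
  refine (hA.int.add hk.int).mono' (hA.meas.mul hk.meas) (Filter.Eventually.of_forall fun x => ?_)
  rcases le_or_gt (x 0) 0 with hx | hx
  · simp [hA.supp x hx, hk.supp x hx]
  · simp only [Pi.add_apply, zpow_neg, zpow_one, Real.norm_eq_abs, abs_mul]
    have h1 : 2 * (|A x| * |k x|) ≤ (x 0)⁻¹ * A x ^ 2 + x 0 * k x ^ 2 := by
      have := sq_nonneg (|A x| - x 0 * |k x|)
      rw [← sq_abs (A x), ← sq_abs (k x)]
      have e : (x 0)⁻¹ * |A x| ^ 2 + x 0 * |k x| ^ 2 - 2 * (|A x| * |k x|)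
          = (x 0)⁻¹ * (|A x| - x 0 * |k x|) ^ 2 := by field_simp; ring
      have : 0 ≤ (x 0)⁻¹ * (|A x| - x 0 * |k x|) ^ 2 := by positivity
      linarith
    have : 0 ≤ |A x| * |k x| := by positivity
    linarith

/-- Joint change of variables in the translation length and the point, so that Fubini can be applied
to integrals along lines. -/
lemma measurePreserving_shear (v : Plane) (μ : Measure ℝ) [SFinite μ] :
    MeasurePreserving (fun p : ℝ × Plane => (p.1, p.2 + p.1 • v)) (μ.prod volume)
      (μ.prod volume) := by
  refine MeasurePreserving.skew_product (g := fun t x => x + t • v) (MeasurePreserving.id μ)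
    (by fun_prop) (Filter.Eventually.of_forall fun t => ?_)
  exact (measurePreserving_add_right volume (t • v)).map_eq

lemma quasiMeasurePreserving_add_smul (v : Plane) (μ : Measure ℝ) [SFinite μ] :
    Measure.QuasiMeasurePreserving (fun p : ℝ × Plane => p.2 + p.1 • v) (μ.prod volume)
      volume :=
  Measure.quasiMeasurePreserving_snd.comp (measurePreserving_shear v μ).quasiMeasurePreserving

lemma aestronglyMeasurable_shear {k : Plane → ℝ} (hk : AEStronglyMeasurable k volume) (v : Plane)
    (μ : Measure ℝ) [SFinite μ] :
    AEStronglyMeasurable (fun p : ℝ × Plane => k (p.2 + p.1 • v)) (μ.prod volume) :=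
  hk.comp_quasiMeasurePreserving (quasiMeasurePreserving_add_smul v μ)

lemma integrable_shear {k : Plane → ℝ} (hk : Integrable k) (v : Plane) (μ : Measure ℝ)
    [IsFiniteMeasure μ] :
    Integrable (fun p : ℝ × Plane => k (p.2 + p.1 • v)) (μ.prod volume) := by
  have h : Integrable (fun p : ℝ × Plane => k p.2) (μ.prod volume) := by
    simpa using Integrable.mul_prod (f := fun _ : ℝ => (1 : ℝ)) (integrable_const 1) hk
  exact (measurePreserving_shear v μ).integrable_comp_of_integrable h

/-- The average of `k` over forward translates. -/
noncomputable def fwd (m τ : ℝ) (k : Plane → ℝ) (x : Plane) : ℝ := ∫ t in Set.Ioc 0 τ, k (x + t • dir m)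

/-- The average of `k` over backward translates. -/
noncomputable def bwd (m τ : ℝ) (k : Plane → ℝ) (x : Plane) : ℝ := ∫ t in Set.Ioc 0 τ, k (x - t • dir m)

/-- Moving along `dir m` increases `r`, so the weight at the base point is at most the weight at the
shifted point, and Young's inequality closes as without translation. -/
lemma integrable_mul_shear {A k : Plane → ℝ} (hA : HalfL2 (-1) A) (hk : HalfL2 1 k) (m τ : ℝ) :
    Integrable (fun p : ℝ × Plane => A p.2 * k (p.2 + p.1 • dir m))
      ((volume.restrict (Set.Ioc 0 τ)).prod volume) := by
  set μ : Measure ℝ := volume.restrict (Set.Ioc 0 τ)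
  have h1 : Integrable (fun p : ℝ × Plane => (p.2 0) ^ (-1 : ℤ) * A p.2 ^ 2) (μ.prod volume) := by
    simpa using Integrable.mul_prod (f := fun _ : ℝ => (1 : ℝ)) (integrable_const 1) hA.int
  have h2 := integrable_shear hk.int (dir m) μ
  have hμ : ∀ᵐ p : ℝ × Plane ∂(μ.prod volume), 0 < p.1 := by
    have : ∀ᵐ t ∂μ, 0 < t := by
      filter_upwards [ae_restrict_mem measurableSet_Ioc] with t ht using ht.1
    exact Measure.quasiMeasurePreserving_fst.ae this
  have hA' : AEStronglyMeasurable (fun p : ℝ × Plane => A p.2) (μ.prod volume) :=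
    hA.meas.comp_quasiMeasurePreserving Measure.quasiMeasurePreserving_snd
  refine (h1.add h2).mono' (hA'.mul (aestronglyMeasurable_shear hk.meas _ _)) ?_
  filter_upwards [hμ] with p hp
  rcases le_or_gt (p.2 0) 0 with hx | hx
  · simp only [hA.supp _ hx, zero_mul, norm_zero, Pi.add_apply]
    rcases le_or_gt ((p.2 + p.1 • dir m) 0) 0 with hy | hy
    · simp [hk.supp _ hy]
    · have := mul_nonneg hy.le (sq_nonneg (k (p.2 + p.1 • dir m)))
      simpa using this
  · simp only [Pi.add_apply, zpow_neg, zpow_one, Real.norm_eq_abs, abs_mul]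
    set y := p.2 + p.1 • dir m
    have hy : p.2 0 ≤ y 0 := by simp [y, hp.le]
    have h1 : 2 * (|A p.2| * |k y|) ≤ (p.2 0)⁻¹ * A p.2 ^ 2 + p.2 0 * k y ^ 2 := by
      rw [← sq_abs (A p.2), ← sq_abs (k y)]
      have e : (p.2 0)⁻¹ * |A p.2| ^ 2 + p.2 0 * |k y| ^ 2 - 2 * (|A p.2| * |k y|)
          = (p.2 0)⁻¹ * (|A p.2| - p.2 0 * |k y|) ^ 2 := by field_simp; ring
      have : 0 ≤ (p.2 0)⁻¹ * (|A p.2| - p.2 0 * |k y|) ^ 2 := by positivity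
      linarith
    have h3 : p.2 0 * k y ^ 2 ≤ y 0 * k y ^ 2 := by gcongr
    have : 0 ≤ |A p.2| * |k y| := by positivity
    linarith

lemma integral_mul_fwd {A k : Plane → ℝ} (hA : HalfL2 (-1) A) (hk : HalfL2 1 k) (m τ : ℝ) :
    ∫ x, A x * fwd m τ k x
      = ∫ t in Set.Ioc 0 τ, ∫ y, A (y - t • dir m) * k y := by
  have h := integrable_mul_shear hA hk m τ
  calc ∫ x, A x * fwd m τ k x
      = ∫ x, ∫ t in Set.Ioc 0 τ, A x * k (x + t • dir m) := by
        simp only [fwd, integral_const_mul]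
    _ = ∫ t in Set.Ioc 0 τ, ∫ x, A x * k (x + t • dir m) :=
        (integral_integral_swap (f := fun t x => A x * k (x + t • dir m)) h).symm
    _ = _ := by
        congr 1; ext t
        rw [← integral_sub_right_eq_self (fun x => A x * k (x + t • dir m)) (t • dir m)]
        simp

lemma integrable_mul_shear_back {A k : Plane → ℝ} (hA : HalfL2 (-1) A) (hk : HalfL2 1 k)
    (m τ : ℝ) :
    Integrable (fun p : ℝ × Plane => A (p.2 - p.1 • dir m) * k p.2)
      ((volume.restrict (Set.Ioc 0 τ)).prod volume) := by
  have h := (measurePreserving_shear (-dir m) (volume.restrict (Set.Ioc 0 τ))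
    ).integrable_comp_of_integrable (integrable_mul_shear hA hk m τ)
  refine h.congr (Filter.Eventually.of_forall fun p => ?_)
  simp [sub_eq_add_neg]

/-- Forward and backward line integrals are adjoint, by Fubini and translation invariance. This
transfers the line integral from a weakly differentiable function to a test function or a flux. -/
lemma integral_bwd_mul {A k : Plane → ℝ} (hA : HalfL2 (-1) A) (hk : HalfL2 1 k) (m τ : ℝ) :
    ∫ x, A x * fwd m τ k x = ∫ y, bwd m τ A y * k y := by
  rw [integral_mul_fwd hA hk]
  simp only [bwd, ← integral_mul_const]
  exact integral_integral_swap (f := fun t y => A (y - t • dir m) * k y)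
    (integrable_mul_shear_back hA hk m τ)

lemma integrable_bwd_mul {A k : Plane → ℝ} (hA : HalfL2 (-1) A) (hk : HalfL2 1 k) (m τ : ℝ) :
    Integrable fun y => bwd m τ A y * k y := by
  have := (integrable_mul_shear_back hA hk m τ).integral_prod_right
  refine this.congr (Filter.Eventually.of_forall fun p => ?_)
  simp only [bwd, integral_mul_const]

lemma integrable_mul_fwd {A k : Plane → ℝ} (hA : HalfL2 (-1) A) (hk : HalfL2 1 k) (m τ : ℝ) :
    Integrable fun y => A y * fwd m τ k y := by
  have := (integrable_mul_shear hA hk m τ).integral_prod_right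
  refine this.congr (Filter.Eventually.of_forall fun p => ?_)
  simp only [fwd, integral_const_mul]

lemma aestronglyMeasurable_fwd {k : Plane → ℝ} (hk : AEStronglyMeasurable k volume) (m τ : ℝ) :
    AEStronglyMeasurable (fwd m τ k) volume := by
  have := aestronglyMeasurable_shear hk (dir m) (volume.restrict (Set.Ioc 0 τ))
  exact this.prod_swap.integral_prod_right'

lemma aestronglyMeasurable_bwd {k : Plane → ℝ} (hk : AEStronglyMeasurable k volume) (m τ : ℝ) :
    AEStronglyMeasurable (bwd m τ k) volume := by
  have := aestronglyMeasurable_shear hk (-dir m) (volume.restrict (Set.Ioc 0 τ))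
  have := this.prod_swap.integral_prod_right'
  refine this.congr (Filter.Eventually.of_forall fun x => ?_)
  simp [bwd, sub_eq_add_neg]

/-- Weighted Cauchy-Schwarz inequality for set integrals. -/
lemma enorm_integral_sq_le {μ : Measure ℝ} {a : ℝ → ℝ} (ha : AEStronglyMeasurable a μ)
    {p : ℝ → ℝ} (hp : Measurable p) (hp0 : ∀ᵐ t ∂μ, 0 < p t) :
    ‖∫ t, a t ∂μ‖ₑ ^ 2 ≤ (∫⁻ t, ‖a t‖ₑ ^ 2 * ENNReal.ofReal (p t)⁻¹ ∂μ)
      * ∫⁻ t, ENNReal.ofReal (p t) ∂μ := by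
  have h1 : ‖∫ t, a t ∂μ‖ₑ ≤ ∫⁻ t, ‖a t‖ₑ ∂μ := enorm_integral_le_lintegral_enorm _
  set s : ℝ → ℝ≥0∞ := fun t => ENNReal.ofReal (Real.sqrt (p t))
  set s' : ℝ → ℝ≥0∞ := fun t => ENNReal.ofReal (Real.sqrt (p t)⁻¹)
  have hs : Measurable s := hp.sqrt.ennreal_ofReal
  have hs' : Measurable s' := hp.inv.sqrt.ennreal_ofReal
  have h2 : ∫⁻ t, ‖a t‖ₑ ∂μ = ∫⁻ t, ((fun t => ‖a t‖ₑ * s' t) * s) t ∂μ := by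
    refine lintegral_congr_ae ?_
    filter_upwards [hp0] with t ht
    simp only [Pi.mul_apply, s, s']
    rw [mul_assoc, ← ENNReal.ofReal_mul (by positivity), ← Real.sqrt_mul (by positivity),
      inv_mul_cancel₀ ht.ne']
    simp
  have h3 := ENNReal.lintegral_mul_le_Lp_mul_Lq μ (p := 2) (q := 2)
    (by constructor <;> norm_num) (ha.enorm.mul hs'.aemeasurable) hs.aemeasurable
  have h4 : ‖∫ t, a t ∂μ‖ₑ ≤ (∫⁻ t, (‖a t‖ₑ * s' t) ^ (2 : ℝ) ∂μ) ^ (1 / 2 : ℝ)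
      * (∫⁻ t, s t ^ (2 : ℝ) ∂μ) ^ (1 / 2 : ℝ) := h1.trans (h2.le.trans h3)
  have h5 := pow_le_pow_left₀ (zero_le) h4 2
  refine h5.trans (le_of_eq ?_)
  rw [mul_pow]
  have e : ∀ b : ℝ≥0∞, (b ^ (1 / 2 : ℝ)) ^ 2 = b := fun b => by
    rw [← ENNReal.rpow_natCast, ← ENNReal.rpow_mul]; norm_num
  rw [e, e]
  congr 1
  · refine lintegral_congr_ae ?_
    filter_upwards [hp0] with t ht
    rw [ENNReal.rpow_two, mul_pow]
    congr 1
    simp only [s']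
    rw [← ENNReal.ofReal_pow (by positivity), Real.sq_sqrt (by positivity)]
  · refine lintegral_congr_ae ?_
    filter_upwards [hp0] with t ht
    simp only [s]
    rw [ENNReal.rpow_two, ← ENNReal.ofReal_pow (by positivity), Real.sq_sqrt ht.le]

lemma lintegral_shear {μ : Measure ℝ} [SFinite μ] (f : ℝ → Plane → ℝ≥0∞)
    (hf : AEMeasurable (Function.uncurry f) (μ.prod volume)) (v : Plane) :
    ∫⁻ x, ∫⁻ t, f t x ∂μ = ∫⁻ y, ∫⁻ t, f t (y + t • v) ∂μ := by
  have h2 : AEMeasurable (Function.uncurry fun t y => f t (y + t • v)) (μ.prod volume) :=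
    hf.comp_quasiMeasurePreserving (measurePreserving_shear v μ).quasiMeasurePreserving
  rw [← lintegral_lintegral_swap hf, ← lintegral_lintegral_swap h2]
  congr 1; ext t
  exact (lintegral_add_right_eq_self (fun x => f t x) (t • v)).symm

/-- Averages over forward translates gain one power of the distance to the axis. -/
lemma lintegral_fwd_sq_le {k : Plane → ℝ} (hk : HalfL2 1 k) (m : ℝ) {τ : ℝ} :
    ∫⁻ x in offAxis, ‖fwd m τ k x‖ₑ ^ 2
      ≤ ENNReal.ofReal τ * ENNReal.ofReal (∫ y, y 0 * k y ^ 2) := by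
  set μ : Measure ℝ := volume.restrict (Set.Ioc 0 τ)
  have hsh : ∀ᵐ x : Plane, AEStronglyMeasurable (fun t => k (x + t • dir m)) μ := by
    have := (aestronglyMeasurable_shear hk.meas (dir m) μ).prod_swap
    exact this.prodMk_left
  have hks : AEMeasurable (fun p : ℝ × Plane => ‖k (p.2 + p.1 • dir m)‖ₑ ^ 2) (μ.prod volume) :=
    (aestronglyMeasurable_shear hk.meas (dir m) μ).enorm.pow_const 2
  have hind : Measurable (fun p : ℝ × Plane => offAxis.indicator (1 : Plane → ℝ≥0∞) p.2) :=
    (measurable_one.indicator measurableSet_offAxis).comp measurable_snd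
  have hprod : AEMeasurable (fun p : ℝ × Plane => offAxis.indicator (1 : Plane → ℝ≥0∞) p.2
      * ‖k (p.2 + p.1 • dir m)‖ₑ ^ 2) (μ.prod volume) := hind.aemeasurable.mul hks
  have hpt : ∀ᵐ x : Plane, ‖fwd m τ k x‖ₑ ^ 2
      ≤ ENNReal.ofReal τ * ∫⁻ t, ‖k (x + t • dir m)‖ₑ ^ 2 ∂μ := by
    filter_upwards [hsh] with x hx
    have := enorm_integral_sq_le hx (p := fun _ => 1) measurable_const (by simp)
    simpa [fwd, μ, mul_comm] using this
  calc ∫⁻ x in offAxis, ‖fwd m τ k x‖ₑ ^ 2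
      ≤ ∫⁻ x in offAxis, ENNReal.ofReal τ * ∫⁻ t, ‖k (x + t • dir m)‖ₑ ^ 2 ∂μ :=
        lintegral_mono_ae (ae_restrict_of_ae hpt)
    _ = ENNReal.ofReal τ * ∫⁻ x in offAxis, ∫⁻ t, ‖k (x + t • dir m)‖ₑ ^ 2 ∂μ :=
        lintegral_const_mul' _ _ ENNReal.ofReal_ne_top
    _ = ENNReal.ofReal τ * ∫⁻ x, ∫⁻ t, offAxis.indicator 1 x * ‖k (x + t • dir m)‖ₑ ^ 2 ∂μ := by
        rw [← lintegral_indicator measurableSet_offAxis]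
        congr 2; ext x
        by_cases hx : x ∈ offAxis <;> simp [hx]
    _ = ENNReal.ofReal τ * ∫⁻ y, ∫⁻ t, offAxis.indicator 1 (y - t • dir m) * ‖k y‖ₑ ^ 2 ∂μ := by
        rw [lintegral_shear (fun t x => offAxis.indicator 1 x * ‖k (x + t • dir m)‖ₑ ^ 2)
          hprod (-dir m)]
        simp [sub_eq_add_neg]
    _ ≤ ENNReal.ofReal τ * ∫⁻ y, ENNReal.ofReal (y 0 * k y ^ 2) := by
        gcongr with y
        rw [lintegral_mul_const _ (by
          refine (measurable_one.indicator measurableSet_offAxis).comp (by fun_prop))]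
        rcases le_or_gt (y 0) 0 with hy | hy
        · simp [hk.supp y hy]
        · rw [ENNReal.ofReal_mul hy.le, ← enorm_pow, Real.enorm_of_nonneg (by positivity)]
          gcongr
          -- The point `y - t • dir m` is off the axis only for `t < y 0`, so the admissible lengths
          -- have measure at most `y 0`. This is the weight of `k` on the right-hand side.
          calc ∫⁻ t, offAxis.indicator 1 (y - t • dir m) ∂μ
              ≤ ∫⁻ t in Set.Ioc 0 τ, (Set.Ioc 0 (y 0)).indicator 1 t := by
                refine setLIntegral_mono (measurable_one.indicator measurableSet_Ioc)
                  fun t ht => ?_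
                by_cases h : y - t • dir m ∈ offAxis
                · have : t < y 0 := by simpa [offAxis] using h
                  simp [h, ht.1, this.le]
                · simp [h]
            _ ≤ ∫⁻ t, (Set.Ioc 0 (y 0)).indicator 1 t := setLIntegral_le_lintegral _ _
            _ = ENNReal.ofReal (y 0) := by
                rw [lintegral_indicator_one measurableSet_Ioc, Real.volume_Ioc, sub_zero]
    _ = _ := by
        rw [ofReal_integral_eq_lintegral_ofReal]
        · simpa using hk.int
        · refine Filter.Eventually.of_forall fun y => ?_
          rcases le_or_gt (y 0) 0 with hy | hy
          · simp [hk.supp y hy]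
          · simp only [Pi.zero_apply]; positivity

/-! ### Weighted spaces -/

lemma MemL2.mul_bdd {Ω : Set Plane} (hΩ : MeasurableSet Ω) (hr : Ω ⊆ offAxis) {s : ℤ}
    {q κ : Plane → ℝ} (hq : MemL2 Ω s q) (hκ : AEStronglyMeasurable κ (volume.restrict Ω))
    {C : ℝ} (hC : ∀ x ∈ Ω, |κ x| ≤ C) : MemL2 Ω s (fun x => κ x * q x) := by
  refine ⟨hκ.mul hq.1, (hq.2.const_mul (C ^ 2)).mono' ?_ ?_⟩
  · exact ((by fun_prop : Measurable fun x : Plane => (x 0) ^ s).aestronglyMeasurable).mul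
      ((hκ.mul hq.1).norm.pow 2)
  · filter_upwards [ae_restrict_mem hΩ] with x hx
    have hx0 : (0:ℝ) < x 0 := hr hx
    have : |κ x| ^ 2 ≤ C ^ 2 := pow_le_pow_left₀ (abs_nonneg _) (hC x hx) 2
    rw [Real.norm_eq_abs, abs_mul, abs_of_pos (zpow_pos hx0 s), norm_mul, mul_pow,
      abs_of_nonneg (by positivity), Real.norm_eq_abs]
    calc (x 0) ^ s * (|κ x| ^ 2 * ‖q x‖ ^ 2) ≤ (x 0) ^ s * (C ^ 2 * ‖q x‖ ^ 2) := by gcongr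
      _ = _ := by ring

lemma MemL2.add {F : Type*} [NormedAddCommGroup F] {Ω : Set Plane} (hΩ : MeasurableSet Ω)
    (hr : Ω ⊆ offAxis) {s : ℤ} {u v : Plane → F} (hu : MemL2 Ω s u) (hv : MemL2 Ω s v) :
    MemL2 Ω s (fun x => u x + v x) := by
  refine ⟨hu.1.add hv.1, ((hu.2.const_mul 2).add (hv.2.const_mul 2)).mono' ?_ ?_⟩
  · exact ((by fun_prop : Measurable fun x : Plane => (x 0) ^ s).aestronglyMeasurable).mul
      ((hu.1.add hv.1).norm.pow 2)
  · filter_upwards [ae_restrict_mem hΩ] with x hx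
    have hx0 : (0:ℝ) < x 0 := hr hx
    have hp := zpow_pos hx0 s
    rw [Real.norm_eq_abs, abs_of_nonneg (by positivity)]
    have h1 : ‖u x + v x‖ ^ 2 ≤ 2 * ‖u x‖ ^ 2 + 2 * ‖v x‖ ^ 2 := by
      have := norm_add_le (u x) (v x)
      nlinarith [sq_nonneg (‖u x‖ - ‖v x‖), norm_nonneg (u x + v x)]
    calc (x 0) ^ s * ‖u x + v x‖ ^ 2 ≤ (x 0) ^ s * (2 * ‖u x‖ ^ 2 + 2 * ‖v x‖ ^ 2) := by gcongr
      _ = _ := by simp; ring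

lemma MemL2.mono_norm {F G : Type*} [NormedAddCommGroup F] [NormedAddCommGroup G]
    {Ω : Set Plane} (hΩ : MeasurableSet Ω) (hr : Ω ⊆ offAxis) {s : ℤ} {u : Plane → F}
    {v : Plane → G} (hu : MemL2 Ω s u) (hv : AEStronglyMeasurable v (volume.restrict Ω))
    (h : ∀ x ∈ Ω, ‖v x‖ ≤ ‖u x‖) : MemL2 Ω s v := by
  refine ⟨hv, hu.2.mono' ?_ ?_⟩
  · exact ((by fun_prop : Measurable fun x : Plane => (x 0) ^ s).aestronglyMeasurable).mul
      (hv.norm.pow 2)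
  · filter_upwards [ae_restrict_mem hΩ] with x hx
    have hx0 : (0:ℝ) < x 0 := hr hx
    have hp := zpow_pos hx0 s
    rw [Real.norm_eq_abs, abs_of_nonneg (by positivity)]
    have := h x hx
    gcongr

lemma MemL2.comp {Ω : Set Plane} (hΩ : MeasurableSet Ω) (hr : Ω ⊆ offAxis) {s : ℤ}
    {v : Plane → Plane} (hv : MemL2 Ω s v) (i : Fin 2) : MemL2 Ω s (fun x => v x i) :=
  hv.mono_norm hΩ hr
    ((EuclideanSpace.proj (𝕜 := ℝ) i).continuous.comp_aestronglyMeasurable hv.1)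
    fun _ _ => PiLp.norm_apply_le _ _

lemma memL2_vec {Ω : Set Plane} (hΩ : MeasurableSet Ω) (hr : Ω ⊆ offAxis) {s : ℤ}
    {a b : Plane → ℝ} (ha : MemL2 Ω s a) (hb : MemL2 Ω s b) :
    MemL2 Ω s (fun x => (!₂[a x, b x] : Plane)) := by
  have e : (fun x => (!₂[a x, b x] : Plane))
      = fun x => a x • EuclideanSpace.single 0 1 + b x • EuclideanSpace.single 1 1 := by
    ext x i
    fin_cases i <;> simp
  rw [e]
  refine MemL2.add hΩ hr (ha.mono_norm hΩ hr (ha.1.smul_const _) fun x _ => ?_)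
    (hb.mono_norm hΩ hr (hb.1.smul_const _) fun x _ => ?_)
  · rw [norm_smul]; simp
  · rw [norm_smul]; simp

/-- `κ` may be singular at the axis; the support of `ψ` is compact in the open half plane, which
makes every weighted product continuous. -/
lemma halfL2_mul_compactSupport {κ ψ : Plane → ℝ} (hκ : ContinuousOn κ offAxis)
    (hψ : Continuous ψ) (hc : HasCompactSupport ψ) (hs : tsupport ψ ⊆ offAxis) (s : ℤ) :
    HalfL2 s (fun x => κ x * ψ x) := by
  have hz : ∀ x ∉ offAxis, ψ x = 0 := fun x hx =>
    image_eq_zero_of_notMem_tsupport fun h => hx (hs h)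
  have key : ∀ G : Plane → ℝ, ContinuousOn G offAxis → Continuous fun x => G x * ψ x := by
    intro G hG
    rw [continuous_iff_continuousAt]
    intro x
    by_cases hx : x ∈ tsupport ψ
    · exact (hG.continuousAt (isOpen_offAxis.mem_nhds (hs hx))).mul hψ.continuousAt
    · have : (fun x => G x * ψ x) =ᶠ[nhds x] fun _ => 0 := by
        filter_upwards [(isClosed_tsupport ψ).isOpen_compl.mem_nhds hx] with y hy
        simp [image_eq_zero_of_notMem_tsupport hy]
      exact continuousAt_const.congr this.symm
  refine ⟨(key κ hκ).aestronglyMeasurable, ?_, fun x hx => ?_⟩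
  · have h0 : ContinuousOn (fun x : Plane => (x 0) ^ s) offAxis :=
      (by fun_prop : ContinuousOn (fun x : Plane => x 0) offAxis).zpow₀ s
        fun x hx => Or.inl (ne_of_gt hx)
    have h1 := key (fun x => (x 0) ^ s * κ x ^ 2 * ψ x) (by fun_prop)
    refine (h1.integrable_of_hasCompactSupport hc.mul_left).congr
      (Filter.Eventually.of_forall fun x => ?_)
    ring
  · simp [hz x (by simpa [offAxis] using hx)]

lemma halfL2_of_compactSupport {ψ : Plane → ℝ} (hψ : Continuous ψ) (hc : HasCompactSupport ψ)
    (hs : tsupport ψ ⊆ offAxis) (s : ℤ) : HalfL2 s ψ := by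
  simpa using halfL2_mul_compactSupport (κ := fun _ => 1) continuousOn_const hψ hc hs s

lemma halfL2_indicator {K : Set Plane} (hK : IsCompact K) (hs : K ⊆ offAxis) (s : ℤ) :
    HalfL2 s (K.indicator fun _ => 1) := by
  refine MemL2.halfL2 hK.measurableSet hs ⟨aestronglyMeasurable_const, ?_⟩
  refine ContinuousOn.integrableOn_compact hK ?_
  have h0 : ContinuousOn (fun x : Plane => (x 0) ^ s) K :=
    (by fun_prop : ContinuousOn (fun x : Plane => x 0) K).zpow₀ s fun x hx => Or.inl (hs hx).ne'
  simpa using h0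

lemma locallyIntegrableOn_of_indicator {U : Set Plane} (hU : IsOpen U) {h : Plane → ℝ}
    (H : ∀ K ⊆ U, IsCompact K → Integrable fun x => K.indicator (fun _ => 1) x * h x) :
    LocallyIntegrableOn h U := by
  rw [locallyIntegrableOn_iff hU.isLocallyClosed]
  intro K hKU hK
  rw [← integrable_indicator_iff hK.measurableSet]
  refine (H K hKU hK).congr (Filter.Eventually.of_forall fun x => ?_)
  by_cases hx : x ∈ K <;> simp [hx]

/-! ### Translated test functions -/

lemma hasCompactSupport_fderiv_apply {φ : Plane → ℝ} (hc : HasCompactSupport φ) (e : Plane) :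
    HasCompactSupport fun x => fderiv ℝ φ x e :=
  hc.fderiv_apply (𝕜 := ℝ) e

lemma tsupport_fderiv_apply_subset' (φ : Plane → ℝ) (e : Plane) :
    tsupport (fun x => fderiv ℝ φ x e) ⊆ tsupport φ :=
  tsupport_fderiv_apply_subset ℝ e

lemma continuous_fderiv_apply' {φ : Plane → ℝ} (hφ : ContDiff ℝ ∞ φ) (e : Plane) :
    Continuous fun x => fderiv ℝ φ x e :=
  (hφ.continuous_fderiv (by simp)).clm_apply continuous_const

lemma hasCompactSupport_sub {φ : Plane → ℝ} (hc : HasCompactSupport φ) (v : Plane) :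
    HasCompactSupport fun x => φ (x - v) :=
  hc.comp_homeomorph (Homeomorph.subRight v)

lemma mem_tsupport_sub {φ : Plane → ℝ} {v x : Plane} (h : x ∈ tsupport fun x => φ (x - v)) :
    x - v ∈ tsupport φ := by
  have := tsupport_comp_eq_preimage φ (Homeomorph.subRight v)
  have h' : x ∈ tsupport (φ ∘ Homeomorph.subRight v) := h
  rw [this] at h'
  exact h'

lemma tsupport_sub_subset {φ : Plane → ℝ} (hs : tsupport φ ⊆ offAxis) {v : Plane} (hv : 0 ≤ v 0) :
    tsupport (fun x => φ (x - v)) ⊆ offAxis := by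
  intro x hx
  have : 0 < (x - v) 0 := hs (mem_tsupport_sub hx)
  simp only [PiLp.sub_apply] at this
  show 0 < x 0
  linarith

/-- Weak differentiation against translated test functions, localized by a cutoff `κ`: it is enough
that `U` is stable under the translation within the support of `κ`. -/
lemma IsWeakGrad.translate {Ω U : Set Plane} (hΩ : MeasurableSet Ω) (hr : Ω ⊆ offAxis)
    (hU : U ⊆ offAxis) {q : Plane → ℝ} {g : Plane → Plane} (h : IsWeakGrad Ω U q g)
    (hq : MemL2 Ω 1 q) (hg : MemL2 Ω 1 g) {κ : Plane → ℝ} (hκ : ContDiffOn ℝ ∞ κ offAxis)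
    {φ : Plane → ℝ} (hφ : ContDiff ℝ ∞ φ) (hc : HasCompactSupport φ) (hs : tsupport φ ⊆ U)
    {v : Plane} (hv : 0 ≤ v 0) (hpush : ∀ y ∈ tsupport κ, y - v ∈ U → y ∈ U) (i : Fin 2) :
    ∫ y, Ω.indicator (fun y => κ y * q y) y * fderiv ℝ φ (y - v) (EuclideanSpace.single i 1)
      = -∫ y, Ω.indicator (fun y => κ y * g y i
          + fderiv ℝ κ y (EuclideanSpace.single i 1) * q y) y * φ (y - v) := by
  set e : Plane := EuclideanSpace.single i 1
  have hκat : ∀ x ∈ offAxis, ContDiffAt ℝ ∞ κ x := fun x hx =>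
    hκ.contDiffAt (isOpen_offAxis.mem_nhds hx)
  have hφv : ContDiff ℝ ∞ fun x => φ (x - v) := hφ.comp (contDiff_id.sub contDiff_const)
  set φv : Plane → ℝ := fun x => φ (x - v)
  have hcv : HasCompactSupport φv := hasCompactSupport_sub hc v
  have hsv : tsupport φv ⊆ offAxis := tsupport_sub_subset (hs.trans hU) hv
  set ζ : Plane → ℝ := fun x => κ x * φv x
  have hζ : ContDiff ℝ ∞ ζ := by
    rw [contDiff_iff_contDiffAt]
    intro x
    by_cases hx : x ∈ tsupport φv
    · exact (hκat x (hsv hx)).mul hφv.contDiffAt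
    · have : ζ =ᶠ[nhds x] fun _ => 0 := by
        filter_upwards [(isClosed_tsupport φv).isOpen_compl.mem_nhds hx] with y hy
        simp [ζ, image_eq_zero_of_notMem_tsupport hy]
      exact contDiffAt_const.congr_of_eventuallyEq this
  have hζs : tsupport ζ ⊆ U := fun x hx => hpush x (tsupport_mul_subset_left hx)
    (hs (mem_tsupport_sub (tsupport_mul_subset_right hx)))
  have hw := h ζ hζ hcv.mul_left hζs i
  have hd : ∀ x, fderiv ℝ φv x e = fderiv ℝ φ (x - v) e := fun x => by
    simp only [φv]; rw [fderiv_comp_sub]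
  have hζd : ∀ x ∈ Ω, fderiv ℝ ζ x e = κ x * fderiv ℝ φ (x - v) e + φv x * fderiv ℝ κ x e := by
    intro x hx
    have h1 : DifferentiableAt ℝ κ x := (hκat x (hr hx)).differentiableAt (by simp)
    have h2 : DifferentiableAt ℝ φv x := hφv.contDiffAt.differentiableAt (by simp)
    simp only [ζ]
    rw [fderiv_fun_mul h1 h2, ← hd]
    simp
  have hq' := hq.halfL2 hΩ hr
  have hκ' : ContinuousOn (fun x => fderiv ℝ κ x e) offAxis :=
    (hκ.continuousOn_fderiv_of_isOpen isOpen_offAxis (by simp)).clm_apply continuousOn_const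
  have hdv : HalfL2 (-1) (fun x => κ x * fderiv ℝ φv x e) :=
    halfL2_mul_compactSupport hκ.continuousOn (continuous_fderiv_apply' hφv e)
      (hasCompactSupport_fderiv_apply hcv e) ((tsupport_fderiv_apply_subset' _ _).trans hsv) _
  have i1 : IntegrableOn (fun x => q x * (κ x * fderiv ℝ φ (x - v) e)) Ω := by
    rw [← integrable_indicator_iff hΩ]
    refine (hdv.integrable_mul hq').congr (Filter.Eventually.of_forall fun x => ?_)
    by_cases hx : x ∈ Ω <;> simp [hx, hd, mul_comm]
  have i2 : IntegrableOn (fun x => q x * (fderiv ℝ κ x e * φv x)) Ω := by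
    rw [← integrable_indicator_iff hΩ]
    refine ((halfL2_mul_compactSupport hκ' hφv.continuous hcv hsv _).integrable_mul hq').congr
      (Filter.Eventually.of_forall fun x => ?_)
    by_cases hx : x ∈ Ω <;> simp [hx, mul_comm]
  have i3 : IntegrableOn (fun x => g x i * ζ x) Ω := by
    rw [← integrable_indicator_iff hΩ]
    refine ((halfL2_mul_compactSupport hκ.continuousOn hφv.continuous hcv hsv _).integrable_mul
      ((hg.comp hΩ hr i).halfL2 hΩ hr)).congr (Filter.Eventually.of_forall fun x => ?_)
    by_cases hx : x ∈ Ω <;> simp [hx, ζ, mul_comm]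
  have e1 : ∫ y, Ω.indicator (fun y => κ y * q y) y * fderiv ℝ φ (y - v) e
      = ∫ x in Ω, q x * (κ x * fderiv ℝ φ (x - v) e) := by
    rw [← integral_indicator hΩ]
    congr 1; ext x
    by_cases hx : x ∈ Ω <;> simp [hx]; ring
  have e2 : ∫ y, Ω.indicator (fun y => κ y * g y i + fderiv ℝ κ y e * q y) y * φ (y - v)
      = ∫ x in Ω, (g x i * ζ x + q x * (fderiv ℝ κ x e * φv x)) := by
    rw [← integral_indicator hΩ]
    congr 1; ext x
    by_cases hx : x ∈ Ω <;> simp [hx, ζ, φv]; ring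
  have e3 : ∫ x in Ω, q x * fderiv ℝ ζ x e
      = ∫ x in Ω, (q x * (κ x * fderiv ℝ φ (x - v) e) + q x * (fderiv ℝ κ x e * φv x)) := by
    refine setIntegral_congr_fun hΩ fun x hx => ?_
    simp only [hζd x hx]; ring
  rw [e1, e2, integral_add i3 i2]
  rw [e3, integral_add i1 i2] at hw
  linarith

/-- `k'` is the derivative of `k` in direction `e` when tested with backward translates of test
functions on `U`. -/
def TransGrad (U : Set Plane) (m τ : ℝ) (e : Plane) (k k' : Plane → ℝ) : Prop :=
  ∀ φ : Plane → ℝ, ContDiff ℝ ∞ φ → HasCompactSupport φ → tsupport φ ⊆ U →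
    ∀ t ∈ Set.Ioc 0 τ, ∫ y, k y * fderiv ℝ φ (y - t • dir m) e
      = -∫ y, k' y * φ (y - t • dir m)

/-- Fundamental theorem of calculus along the line through `y`. In the applications the second term
drops out because the shift by `τ` leaves the half plane. -/
lemma bwd_fderiv_dir {φ : Plane → ℝ} (hφ : ContDiff ℝ ∞ φ) (e : Plane) {m τ : ℝ} (hτ : 0 ≤ τ)
    (he : e = dir m) (y : Plane) :
    bwd m τ (fun x => fderiv ℝ φ x e) y = φ y - φ (y - τ • dir m) := by
  subst he
  unfold bwd
  rw [← intervalIntegral.integral_of_le hτ]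
  have hd : ∀ t : ℝ, HasDerivAt (fun t : ℝ => -φ (y - t • dir m))
      (fderiv ℝ φ (y - t • dir m) (dir m)) t := by
    intro t
    have h1 : HasDerivAt (fun t : ℝ => y - t • dir m) (-dir m) t := by
      simpa using ((hasDerivAt_id t).smul_const (dir m)).const_sub y
    have h2 := ((hφ.differentiable (by simp)) (y - t • dir m)).hasFDerivAt.comp_hasDerivAt t h1
    exact h2.neg.congr_deriv (by simp)
  rw [intervalIntegral.integral_eq_sub_of_hasDerivAt (fun t _ => hd t)]
  · simp; ring
  · refine Continuous.intervalIntegrable ?_ _ _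
    exact (continuous_fderiv_apply' hφ (dir m)).comp (by fun_prop)

/-- A function vanishing far from the axis is the backward average of its directional derivative. -/
lemma TransGrad.ae_eq {U : Set Plane} (hU : IsOpen U) (hUo : U ⊆ offAxis) {m τ : ℝ} (hτ : 0 ≤ τ)
    {k k' : Plane → ℝ} (hk : HalfL2 1 k) (hk' : HalfL2 1 k') (h : TransGrad U m τ (dir m) k k')
    (hkτ : ∀ y : Plane, k y ≠ 0 → y 0 ≤ τ) :
    ∀ᵐ x, x ∈ U → k x + fwd m τ k' x = 0 := by
  have hint : ∀ A, HalfL2 (-1) A → Integrable fun x => A x * (k x + fwd m τ k' x) := by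
    intro A hA
    simp only [mul_add]
    exact (hA.integrable_mul hk).add (integrable_mul_fwd hA hk' m τ)
  refine hU.ae_eq_zero_of_integral_contDiff_smul_eq_zero
    (locallyIntegrableOn_of_indicator hU fun K hK hKc =>
      hint _ (halfL2_indicator hKc (hK.trans hUo) _)) fun φ hφ hc hs => ?_
  have hA := halfL2_of_compactSupport hφ.continuous hc (hs.trans hUo) (-1)
  have hA' := halfL2_of_compactSupport (continuous_fderiv_apply' hφ (dir m))
    (hasCompactSupport_fderiv_apply hc _) ((tsupport_fderiv_apply_subset' _ _).trans
      (hs.trans hUo)) (-1)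
  simp only [smul_eq_mul, mul_add]
  rw [integral_add (hA.integrable_mul hk) (integrable_mul_fwd hA hk' m τ)]
  -- Write `φ` as the backward integral of its own directional derivative. The boundary term `φ (y -
  -- τ • dir m)` vanishes where `k y ≠ 0`, since there `y 0 ≤ τ`.
  have e1 : ∫ x, φ x * k x = ∫ t in Set.Ioc 0 τ, ∫ y, fderiv ℝ φ (y - t • dir m) (dir m) * k y := by
    rw [← integral_mul_fwd hA' hk, integral_bwd_mul hA' hk]
    congr 1; ext y
    by_cases hy : k y = 0
    · simp [hy]
    · rw [bwd_fderiv_dir hφ _ hτ rfl, image_eq_zero_of_notMem_tsupport (f := φ)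
        (x := y - τ • dir m), sub_zero]
      intro hmem
      have h0 : 0 < (y - τ • dir m) 0 := hUo (hs hmem)
      have := hkτ y hy
      simp at h0
      linarith
  rw [e1, integral_mul_fwd hA hk', ← integral_add']
  · refine setIntegral_eq_zero_of_forall_eq_zero fun t ht => ?_
    have := h φ hφ hc hs t ht
    simp only [mul_comm] at this ⊢
    simp only [Pi.add_apply, this]
    ring
  · exact (integrable_mul_shear_back hA' hk m τ).integral_prod_left
  · exact (integrable_mul_shear_back hA hk' m τ).integral_prod_left

/-- Hardy-type inequality: the weight of `k` improves by one power over that of its derivative. -/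
lemma TransGrad.lintegral_sq_le {U : Set Plane} (hU : IsOpen U) (hUo : U ⊆ offAxis) {m τ : ℝ}
    (hτ : 0 ≤ τ) {k k' : Plane → ℝ} (hk : HalfL2 1 k) (hk' : HalfL2 1 k')
    (h : TransGrad U m τ (dir m) k k') (hkτ : ∀ y : Plane, k y ≠ 0 → y 0 ≤ τ) :
    ∫⁻ x in U, ‖k x‖ₑ ^ 2 ≤ ENNReal.ofReal τ * ENNReal.ofReal (∫ y, y 0 * k' y ^ 2) := by
  calc ∫⁻ x in U, ‖k x‖ₑ ^ 2 = ∫⁻ x in U, ‖fwd m τ k' x‖ₑ ^ 2 := by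
        refine setLIntegral_congr_fun_ae hU.measurableSet ?_
        filter_upwards [h.ae_eq hU hUo hτ hk hk' hkτ] with x hx hxU
        rw [eq_neg_of_add_eq_zero_left (hx hxU), enorm_neg]
    _ ≤ ∫⁻ x in offAxis, ‖fwd m τ k' x‖ₑ ^ 2 := lintegral_mono_set hUo
    _ ≤ _ := lintegral_fwd_sq_le hk' m

lemma memL2_fwd {Ω : Set Plane} (hΩ : MeasurableSet Ω) (hr : Ω ⊆ offAxis) {R : ℝ}
    (hR : ∀ x ∈ Ω, x 0 ≤ R) {k : Plane → ℝ} (hk : HalfL2 1 k) (m τ : ℝ) :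
    MemL2 Ω 1 (fwd m τ k) := by
  have hm : AEStronglyMeasurable (fwd m τ k) volume := aestronglyMeasurable_fwd hk.meas m τ
  have h1 : IntegrableOn (fun x => ‖fwd m τ k x‖ ^ 2) Ω := by
    refine ⟨(hm.norm.pow 2).restrict, ?_⟩
    have : ∫⁻ x in Ω, ‖fwd m τ k x‖ₑ ^ 2 < (⊤ : ℝ≥0∞) :=
      ((lintegral_mono_set hr).trans (lintegral_fwd_sq_le hk m)).trans_lt
        (ENNReal.mul_lt_top ENNReal.ofReal_lt_top ENNReal.ofReal_lt_top)
    simpa [HasFiniteIntegral] using this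
  refine ⟨hm.restrict, (h1.const_mul R).mono' ?_ ?_⟩
  · exact ((by fun_prop : Measurable fun x : Plane => (x 0) ^ (1:ℤ)).aestronglyMeasurable).mul
      ((hm.norm.pow 2).restrict)
  · filter_upwards [ae_restrict_mem hΩ] with x hx
    have hx0 : (0:ℝ) < x 0 := hr hx
    rw [Real.norm_eq_abs, zpow_one, abs_of_nonneg (by positivity)]
    have := hR x hx
    gcongr

/-- Forward averages of `k` belong to `H¹_1(Ω)`, with an explicit gradient. -/
lemma exists_H1_fwd {Ω : Set Plane} (hΩ : IsOpen Ω) (hr : Ω ⊆ offAxis) {τ : ℝ}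
    (hτ : 0 ≤ τ) (hR : ∀ x ∈ Ω, x 0 ≤ τ) {m : ℝ} {k k' : Plane → ℝ} (hk : HalfL2 1 k)
    (hk' : HalfL2 1 k') (h : TransGrad Ω m τ (EuclideanSpace.single 1 1) k k')
    (hkτ : ∀ y : Plane, k y ≠ 0 → y 0 ≤ τ) :
    ∃ β : H1 Ω, β.grad = fun x => !₂[-k x - m * fwd m τ k' x, fwd m τ k' x] := by
  have hm := hΩ.measurableSet
  have hkr : ∀ {k}, HalfL2 1 k → MemL2 Ω 1 k := fun {k} hk =>
    ⟨hk.meas.restrict, by simpa using hk.int.integrableOn⟩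
  have hB := memL2_fwd hm hr hR hk m τ
  have hZ := memL2_fwd hm hr hR hk' m τ
  refine ⟨⟨fwd m τ k, _, hB, ?_, ?_⟩, rfl⟩
  · have h0 : MemL2 Ω 1 (fun x => -k x - m * fwd m τ k' x) := by
      have := ((hkr hk).mul_bdd hm hr (κ := fun _ => -1) aestronglyMeasurable_const
        (C := 1) (by simp)).add hm hr (hZ.mul_bdd hm hr (κ := fun _ => -m)
          aestronglyMeasurable_const (C := |m|) (by simp))
      convert! this using 2
      ring
    exact memL2_vec hm hr h0 hZ
  · intro φ hφ hc hs i
    have hso := hs.trans hr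
    have out : ∀ x ∉ Ω, φ x = 0 := fun x hx =>
      image_eq_zero_of_notMem_tsupport fun h => hx (hs h)
    have out' : ∀ e x, x ∉ Ω → fderiv ℝ φ x e = 0 := fun e x hx =>
      image_eq_zero_of_notMem_tsupport (f := fun x => fderiv ℝ φ x e) fun h =>
        hx (hs (tsupport_fderiv_apply_subset' _ _ h))
    have hA := halfL2_of_compactSupport hφ.continuous hc hso (-1)
    have hA' := fun e => halfL2_of_compactSupport (continuous_fderiv_apply' hφ e)
      (hasCompactSupport_fderiv_apply hc _) ((tsupport_fderiv_apply_subset' _ _).trans hso) (-1)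
    have hz : ∫ x, fderiv ℝ φ x (EuclideanSpace.single 1 1) * fwd m τ k x
        = -∫ x, φ x * fwd m τ k' x := by
      rw [integral_mul_fwd (hA' _) hk, integral_mul_fwd hA hk', ← integral_neg]
      refine setIntegral_congr_fun measurableSet_Ioc fun t ht => ?_
      have := h φ hφ hc hs t ht
      simpa only [mul_comm] using this
    -- Differentiating the line integral along its own direction returns `-k`, so no derivative of
    -- `k` in direction `dir m` is needed; the `r`-derivative follows by subtracting `m` times the
    -- `z`-derivative.
    have hd : ∫ x, fderiv ℝ φ x (dir m) * fwd m τ k x = ∫ x, φ x * k x := by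
      rw [integral_bwd_mul (hA' _) hk]
      congr 1; ext y
      by_cases hy : k y = 0
      · simp [hy]
      · rw [bwd_fderiv_dir hφ _ hτ rfl, image_eq_zero_of_notMem_tsupport (f := φ)
          (x := y - τ • dir m), sub_zero]
        intro hmem
        have h0 : 0 < (y - τ • dir m) 0 := hso hmem
        have := hkτ y hy
        simp at h0
        linarith
    have full : ∀ e, ∫ x in Ω, fwd m τ k x * fderiv ℝ φ x e
        = ∫ x, fderiv ℝ φ x e * fwd m τ k x := by
      intro e
      rw [setIntegral_eq_integral_of_forall_compl_eq_zero fun x hx => by simp [out' e x hx]]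
      simp only [mul_comm]
    have full' : ∀ u : Plane → ℝ, ∫ x in Ω, u x * φ x = ∫ x, φ x * u x := by
      intro u
      rw [setIntegral_eq_integral_of_forall_compl_eq_zero fun x hx => by simp [out x hx]]
      simp only [mul_comm]
    have e0 : ∀ x, fderiv ℝ φ x (EuclideanSpace.single 0 1)
        = fderiv ℝ φ x (dir m) - m * fderiv ℝ φ x (EuclideanSpace.single 1 1) := by
      intro x
      have : (EuclideanSpace.single 0 1 : Plane) = dir m - m • EuclideanSpace.single 1 1 := by
        ext i; fin_cases i <;> simp
      rw [this]; simp
    fin_cases i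
    · show ∫ x in Ω, fwd m τ k x * fderiv ℝ φ x (EuclideanSpace.single 0 1)
        = -∫ x in Ω, (-k x - m * fwd m τ k' x) * φ x
      rw [full, full']
      simp only [e0, sub_mul, mul_assoc, mul_sub, mul_neg]
      rw [integral_sub (integrable_mul_fwd (hA' _) hk m τ)
        ((integrable_mul_fwd (hA' _) hk m τ).const_mul m), integral_const_mul, hz, hd]
      have e2 : ∀ x, φ x * (m * fwd m τ k' x) = m * (φ x * fwd m τ k' x) := fun x => by ring
      simp only [e2]
      have hneg : Integrable fun x => -(φ x * k x) := (hA.integrable_mul hk).neg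
      rw [integral_sub hneg
        ((integrable_mul_fwd hA hk' m τ).const_mul m), integral_neg, integral_const_mul]
      ring
    · show ∫ x in Ω, fwd m τ k x * fderiv ℝ φ x (EuclideanSpace.single 1 1)
        = -∫ x in Ω, fwd m τ k' x * φ x
      rw [full, full', hz]

/-! ### Stream functions of fields orthogonal to gradients -/

/-- The components of `r G`, extended by zero. -/
noncomputable def flux (Ω : Set Plane) (G : Plane → Plane) (i : Fin 2) : Plane → ℝ :=
  Ω.indicator fun x => x 0 * G x i

lemma halfL2_flux {Ω : Set Plane} (hm : MeasurableSet Ω) (hr : Ω ⊆ offAxis) {G : Plane → Plane}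
    (hG : MemL2 Ω 1 G) (i : Fin 2) : HalfL2 (-1) (flux Ω G i) := by
  refine MemL2.halfL2 hm hr ⟨?_, ?_⟩
  · exact (by fun_prop : Measurable fun x : Plane => x 0).aestronglyMeasurable.mul (hG.comp hm hr i).1
  · refine (hG.comp hm hr i).2.congr_fun (fun x hx => ?_) hm
    have : (x 0) ≠ 0 := (hr hx).ne'
    simp only [zpow_one, zpow_neg, norm_mul, Real.norm_eq_abs, mul_pow, sq_abs]
    field_simp

lemma HalfL2.add {s : ℤ} {A B : Plane → ℝ} (hA : HalfL2 s A) (hB : HalfL2 s B) :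
    HalfL2 s (fun x => A x + B x) := by
  have h : ∀ {A}, HalfL2 s A → MemL2 offAxis s A := fun {A} hA =>
    ⟨hA.meas.restrict, by simpa using hA.int.integrableOn⟩
  convert! ((h hA).add measurableSet_offAxis le_rfl (h hB)).halfL2 measurableSet_offAxis le_rfl
    using 1
  ext x
  by_cases hx : x ∈ offAxis
  · simp [hx]
  · have : x 0 ≤ 0 := by simpa [offAxis] using hx
    simp [hx, hA.supp x this, hB.supp x this]

lemma HalfL2.const_mul {s : ℤ} {A : Plane → ℝ} (hA : HalfL2 s A) (c : ℝ) :
    HalfL2 s (fun x => c * A x) where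
  meas := hA.meas.const_mul c
  int := by
    refine (hA.int.const_mul (c ^ 2)).congr (Filter.Eventually.of_forall fun x => ?_)
    ring_nf
  supp x hx := by simp [hA.supp x hx]

/-- The stream function of `r G`, obtained by integration along the direction `(1, m)`. -/
noncomputable def stream (Ω : Set Plane) (G : Plane → Plane) (m τ : ℝ) : Plane → ℝ :=
  bwd m τ fun x => flux Ω G 1 x + -m * flux Ω G 0 x

lemma halfL2_stream_aux {Ω : Set Plane} (hm : MeasurableSet Ω) (hr : Ω ⊆ offAxis)
    {G : Plane → Plane} (hG : MemL2 Ω 1 G) (m : ℝ) :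
    HalfL2 (-1) (fun x => flux Ω G 1 x + -m * flux Ω G 0 x) :=
  (halfL2_flux hm hr hG 1).add ((halfL2_flux hm hr hG 0).const_mul (-m))

/-- If `G` is orthogonal to gradients, then `∂_z` of the stream function is `- r G_r`. -/
lemma integral_flux_mul {Ω : Set Plane} (hΩ : IsOpen Ω) (hr : Ω ⊆ offAxis) {τ : ℝ}
    (hτ : 0 ≤ τ) (hR : ∀ x ∈ Ω, x 0 ≤ τ) {G : Plane → Plane} (hG : MemL2 Ω 1 G)
    (horth : ∀ β : H1 Ω, ∫ x in Ω, x 0 * ⟪G x, β.grad x⟫ = 0) {m : ℝ} {k k' : Plane → ℝ}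
    (hk : HalfL2 1 k) (hk' : HalfL2 1 k')
    (h : TransGrad Ω m τ (EuclideanSpace.single 1 1) k k')
    (hkτ : ∀ y : Plane, k y ≠ 0 → y 0 ≤ τ) :
    ∫ x, flux Ω G 0 x * k x = ∫ x, stream Ω G m τ x * k' x := by
  have hm := hΩ.measurableSet
  obtain ⟨β, hβ⟩ := exists_H1_fwd hΩ hr hτ hR hk hk' h hkτ
  have h0 := horth β
  have hA := halfL2_stream_aux hm hr hG m
  have hF := halfL2_flux hm hr hG 0
  have e : ∫ x in Ω, x 0 * ⟪G x, β.grad x⟫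
      = ∫ x, ((flux Ω G 1 x + -m * flux Ω G 0 x) * fwd m τ k' x - flux Ω G 0 x * k x) := by
    rw [← integral_indicator hm]
    congr 1; ext x
    by_cases hx : x ∈ Ω
    · simp only [hx, Set.indicator_of_mem, flux, hβ, PiLp.inner_apply, Fin.sum_univ_two]
      simp
      ring
    · simp [hx, flux]
  -- Adjointness turns the pairing of the flux with the forward integral of `k'` into the pairing of
  -- the stream function with `k'`.
  rw [e, integral_sub (integrable_mul_fwd hA hk' m τ) (hF.integrable_mul hk),
    integral_bwd_mul hA hk'] at h0
  rw [stream]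
  linarith

/-- A smooth compactly supported function on the whole plane can be integrated by parts against any
translate, so every `m` is allowed. This is what makes stream functions for different `m`
comparable. -/
lemma transGrad_of_contDiff {U : Set Plane} {m τ : ℝ} (e : Plane) {k : Plane → ℝ}
    (hk : ContDiff ℝ ∞ k) (hkc : HasCompactSupport k) :
    TransGrad U m τ e k (fun x => fderiv ℝ k x e) := by
  intro φ hφ hc _ t _
  have hφv : ContDiff ℝ ∞ fun x => φ (x - t • dir m) := hφ.comp (contDiff_id.sub contDiff_const)
  have hd : ∀ x, fderiv ℝ φ (x - t • dir m) e = fderiv ℝ (fun x => φ (x - t • dir m)) x e :=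
    fun x => by rw [fderiv_comp_sub]
  simp only [hd]
  refine integral_mul_fderiv_eq_neg_fderiv_mul_of_integrable ?_ ?_ ?_
    (fun x _ => hk.differentiable (by simp) x) (fun x _ => hφv.differentiable (by simp) x)
  · exact ((continuous_fderiv_apply' hk e).mul hφv.continuous).integrable_of_hasCompactSupport
      (hasCompactSupport_fderiv_apply hkc e).mul_right
  · exact (hk.continuous.mul (continuous_fderiv_apply' hφv e)).integrable_of_hasCompactSupport
      hkc.mul_right
  · exact (hk.continuous.mul hφv.continuous).integrable_of_hasCompactSupport hkc.mul_right

lemma bwd_eq_zero_of_large {Ω : Set Plane} {Z : ℝ} (hZ : ∀ x ∈ Ω, |x 1| ≤ Z) {A : Plane → ℝ}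
    (hA : ∀ x ∉ Ω, A x = 0) {m τ : ℝ} {x : Plane} (hx : Z + τ * |m| < |x 1|) :
    bwd m τ A x = 0 := by
  refine setIntegral_eq_zero_of_forall_eq_zero fun t ht => hA _ fun hmem => ?_
  have h1 := hZ _ hmem
  simp only [PiLp.sub_apply, PiLp.smul_apply, dir_one, smul_eq_mul] at h1
  have h2 : |x 1| ≤ |x 1 - t * m| + |t * m| := by
    have := abs_add_le (x 1 - t * m) (t * m); simpa using this
  have h3 : |t * m| ≤ τ * |m| := by
    rw [abs_mul, abs_of_pos ht.1]; gcongr; exact ht.2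
  linarith

/-- A function with bounded `z`-support whose distributional `z`-derivative vanishes on a strip
is zero there. -/
lemma ae_eq_zero_of_integral_mul_fderiv {τ L : ℝ} (D : Plane → ℝ)
    (hD : ∀ K ⊆ {x : Plane | 0 < x 0 ∧ x 0 < τ}, IsCompact K →
      Integrable fun x => K.indicator (fun _ => 1) x * D x)
    (hL : ∀ x, L < |x 1| → D x = 0)
    (h : ∀ k : Plane → ℝ, ContDiff ℝ ∞ k → HasCompactSupport k →
      tsupport k ⊆ {x : Plane | 0 < x 0 ∧ x 0 < τ} →
      ∫ x, D x * fderiv ℝ k x (EuclideanSpace.single 1 1) = 0) :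
    ∀ᵐ x : Plane, x ∈ {x : Plane | 0 < x 0 ∧ x 0 < τ} → D x = 0 := by
  set S := {x : Plane | 0 < x 0 ∧ x 0 < τ} with hSdef
  set e : Plane := EuclideanSpace.single 1 1
  have hc0 : Continuous fun x : Plane => x 0 := by fun_prop
  have hS : IsOpen S := (isOpen_lt continuous_const hc0).inter (isOpen_lt hc0 continuous_const)
  refine hS.ae_eq_zero_of_integral_contDiff_smul_eq_zero
    (locallyIntegrableOn_of_indicator hS hD) fun k hk hc hs => ?_
  obtain ⟨M, hM⟩ := (hc.isCompact.image (f := fun x : Plane => |x 1|) (by fun_prop)).bddAbove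
  have hM' : ∀ x, k x ≠ 0 → |x 1| ≤ M := fun x hx =>
    hM ⟨x, subset_tsupport _ hx, rfl⟩
  -- A shift of `k` by `l` in `z` moves its support above height `L`, where `D` vanishes. Hence `k`
  -- may be replaced by `k - k (· - l • e)`, which is an integral of translates of `∂_z k`.
  set l : ℝ := max (L + M + 1) 0
  have hl0 : 0 ≤ l := le_max_right _ _
  set K : Set Plane := (fun p : ℝ × Plane => p.2 + p.1 • e) '' (Set.Icc 0 l ×ˢ tsupport k)
  have hK : IsCompact K := (isCompact_Icc.prod hc.isCompact).image (by fun_prop)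
  have hKS : K ⊆ S := by
    rintro _ ⟨p, hp, rfl⟩
    have := hs hp.2
    simpa [hSdef, e] using this
  set k' : Plane → ℝ := fun x => fderiv ℝ k x e
  have hk'c : Continuous k' := continuous_fderiv_apply' hk e
  have hk'0 : ∀ x, x ∉ tsupport k → k' x = 0 := fun x hx =>
    image_eq_zero_of_notMem_tsupport fun h => hx (tsupport_fderiv_apply_subset' _ _ h)
  obtain ⟨C, hC⟩ := (hasCompactSupport_fderiv_apply hc e).exists_bound_of_continuous hk'c
  set μ : Measure ℝ := volume.restrict (Set.Ioc 0 l)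
  have hprod : Integrable (fun p : ℝ × Plane => D p.2 * k' (p.2 - p.1 • e)) (μ.prod volume) := by
    have h1 : Integrable (fun p : ℝ × Plane => C * (K.indicator (fun _ => 1) p.2 * D p.2))
        (μ.prod volume) := by
      simpa using Integrable.mul_prod (f := fun _ : ℝ => (C : ℝ)) (integrable_const C)
        (hD K hKS hK)
    have hcont : Continuous fun p : ℝ × Plane => k' (p.2 - p.1 • e) := by fun_prop
    have h2 : Integrable (fun p : ℝ × Plane => (K.indicator (fun _ => 1) p.2 * D p.2)
        * k' (p.2 - p.1 • e)) (μ.prod volume) := by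
      have h3 : Integrable (fun p : ℝ × Plane => (K.indicator (fun _ => 1) p.2 * D p.2))
          (μ.prod volume) := by
        simpa using Integrable.mul_prod (f := fun _ : ℝ => (1 : ℝ)) (integrable_const 1)
          (hD K hKS hK)
      exact h3.mul_bdd hcont.aestronglyMeasurable (Filter.Eventually.of_forall fun p => hC _)
    refine h2.congr ?_
    have hμ : ∀ᵐ p : ℝ × Plane ∂(μ.prod volume), p.1 ∈ Set.Ioc 0 l :=
      Measure.quasiMeasurePreserving_fst.ae (ae_restrict_mem measurableSet_Ioc)
    filter_upwards [hμ] with p hp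
    by_cases hx : p.2 - p.1 • e ∈ tsupport k
    · have : p.2 ∈ K := ⟨(p.1, p.2 - p.1 • e), ⟨⟨hp.1.le, hp.2⟩, hx⟩, by simp⟩
      simp [this]
    · simp [hk'0 _ hx]
  -- The strip is invariant under translation in `z`, so translates of `k` are again admissible in
  -- `h`.
  have hz : ∀ t : ℝ, 0 ≤ t → ∫ x, D x * k' (x - t • e) = 0 := by
    intro t ht
    have := h (fun x => k (x - t • e)) (hk.comp (contDiff_id.sub contDiff_const))
      (hasCompactSupport_sub hc _) fun x hx => by
        have := hs (mem_tsupport_sub hx)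
        simpa [hSdef, e] using this
    refine Eq.trans ?_ this
    congr 1; ext x
    rw [fderiv_comp_sub]
  have hft : ∀ x, ∫ t in Set.Ioc 0 l, k' (x - t • e) = k x - k (x - l • e) := by
    intro x
    rw [← intervalIntegral.integral_of_le hl0]
    have hd : ∀ t : ℝ, HasDerivAt (fun t : ℝ => -k (x - t • e)) (k' (x - t • e)) t := by
      intro t
      have h1 : HasDerivAt (fun t : ℝ => x - t • e) (-e) t := by
        simpa using ((hasDerivAt_id t).smul_const e).const_sub x
      have h2 := ((hk.differentiable (by simp)) (x - t • e)).hasFDerivAt.comp_hasDerivAt t h1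
      exact h2.neg.congr_deriv (by simp [k'])
    rw [intervalIntegral.integral_eq_sub_of_hasDerivAt (fun t _ => hd t)]
    · simp; ring
    · exact Continuous.intervalIntegrable (by fun_prop) _ _
  have hfar : ∀ x, D x * k (x - l • e) = 0 := by
    intro x
    by_cases hx : k (x - l • e) = 0
    · simp [hx]
    · have h1 := hM' _ hx
      have : L < |x 1| := by
        simp [e] at h1
        have h2 := abs_sub_abs_le_abs_sub l (x 1)
        rw [abs_sub_comm, abs_of_nonneg hl0] at h2
        have : L + M + 1 ≤ l := le_max_left _ _
        linarith
      simp [hL x this]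
  calc ∫ x, k x • D x = ∫ x, ∫ t in Set.Ioc 0 l, D x * k' (x - t • e) := by
        congr 1; ext x
        rw [integral_const_mul, hft, mul_sub, hfar, smul_eq_mul]; ring
    _ = ∫ t in Set.Ioc 0 l, ∫ x, D x * k' (x - t • e) :=
        (integral_integral_swap (f := fun t x => D x * k' (x - t • e)) hprod).symm
    _ = 0 := setIntegral_eq_zero_of_forall_eq_zero fun t ht => hz t ht.1.le

/-- The stream function does not depend on the direction of integration. -/
lemma stream_ae_eq {Ω : Set Plane} (hΩ : IsOpen Ω) (hb : Bornology.IsBounded Ω)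
    (hr : Ω ⊆ offAxis) {τ : ℝ}
    (hτ : 0 ≤ τ) (hR : ∀ x ∈ Ω, x 0 ≤ τ) {G : Plane → Plane} (hG : MemL2 Ω 1 G)
    (horth : ∀ β : H1 Ω, ∫ x in Ω, x 0 * ⟪G x, β.grad x⟫ = 0) (m : ℝ) :
    ∀ᵐ x : Plane, x ∈ {x : Plane | 0 < x 0 ∧ x 0 < τ} →
      stream Ω G m τ x = stream Ω G 0 τ x := by
  have hm := hΩ.measurableSet
  obtain ⟨Z, hZ⟩ := hb.exists_norm_le
  have hZ' : ∀ x ∈ Ω, |x 1| ≤ Z := fun x hx => (PiLp.norm_apply_le x 1).trans (hZ x hx)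
  have hS : {x : Plane | 0 < x 0 ∧ x 0 < τ} ⊆ offAxis := fun x hx => hx.1
  have hvan : ∀ n x, x ∉ Ω → flux Ω G 1 x + -n * flux Ω G 0 x = 0 := fun n x hx => by
    simp [flux, hx]
  -- Both stream functions have `z`-derivative `-r G_r`. The line integral in direction `(1, m)`
  -- over length `τ` moves `z` by at most `τ * |m|`, which bounds the `z`-support of the difference.
  have key := ae_eq_zero_of_integral_mul_fderiv (τ := τ) (L := Z + τ * |m|)
    (fun x => stream Ω G m τ x - stream Ω G 0 τ x) ?_ ?_ ?_
  · filter_upwards [key] with x hx hxS using sub_eq_zero.1 (hx hxS)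
  · intro K hK hKc
    have hi := halfL2_indicator hKc (hK.trans hS) 1
    refine ((integrable_bwd_mul (halfL2_stream_aux hm hr hG m) hi m τ).sub
      (integrable_bwd_mul (halfL2_stream_aux hm hr hG 0) hi 0 τ)).congr
      (Filter.Eventually.of_forall fun x => ?_)
    simp only [Pi.sub_apply, stream]; ring
  · intro x hx
    simp only [stream]
    rw [bwd_eq_zero_of_large hZ' (hvan m) hx, bwd_eq_zero_of_large hZ' (hvan 0), sub_zero]
    have : 0 ≤ τ * |m| := by positivity
    simp; linarith
  · intro k hk hc hs
    have hk1 := halfL2_of_compactSupport hk.continuous hc (hs.trans hS) 1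
    have hk2 := halfL2_of_compactSupport (continuous_fderiv_apply' hk (EuclideanSpace.single 1 1))
      (hasCompactSupport_fderiv_apply hc _)
      ((tsupport_fderiv_apply_subset' _ _).trans (hs.trans hS)) 1
    have hkτ : ∀ y : Plane, k y ≠ 0 → y 0 ≤ τ := fun y hy => (hs (subset_tsupport _ hy)).2.le
    have e := fun n => integral_flux_mul hΩ hr hτ hR hG horth (m := n) hk1 hk2
      (transGrad_of_contDiff _ hk hc) hkτ
    simp only [sub_mul, stream]
    rw [integral_sub (integrable_bwd_mul (halfL2_stream_aux hm hr hG m) hk2 m τ)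
      (integrable_bwd_mul (halfL2_stream_aux hm hr hG 0) hk2 0 τ)]
    have e1 := e m
    have e2 := e 0
    simp only [stream] at e1 e2
    linarith

/-! ### Lipschitz domains near the axis -/

lemma norm_le_abs_add_abs (x : Plane) : ‖x‖ ≤ |x 0| + |x 1| := by
  have h : x = x 0 • EuclideanSpace.single 0 1 + x 1 • EuclideanSpace.single 1 1 := by
    ext i; fin_cases i <;> simp
  calc ‖x‖ = ‖x 0 • (EuclideanSpace.single 0 1 : Plane) + x 1 • EuclideanSpace.single 1 1‖ := by
        rw [← h]
    _ ≤ _ := (norm_add_le _ _).trans (by simp [norm_smul])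

/-- Near a point on the axis a Lipschitz domain in the right half plane is stable under translation
in some direction pointing away from the axis. -/
lemma IsLipschitzDomain.exists_push {Ω : Set Plane} (hΩ : IsLipschitzDomain Ω)
    (hr : ∀ x ∈ Ω, 0 < x 0) {x : Plane} (hx : x ∈ frontier Ω) (hx0 : x 0 = 0) :
    ∃ m δ : ℝ, 0 < δ ∧ ∀ (y : Plane) (t : ℝ), y 0 < δ → |y 1 - x 1| < δ → 0 ≤ t →
      y - t • dir m ∈ Ω → y ∈ Ω := by
  obtain ⟨e, U, γ, L, hU, hxU, hγ, hiff⟩ := hΩ.2.2.2 x hx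
  set A := e.toRealAffineIsometryEquiv
  set ℓ := A.linearIsometryEquiv
  have hAe : ∀ y, A y = e y := fun y => by simp [A]
  have hadd : ∀ y v, e (y + v) = e y + ℓ v := by
    intro y v
    have := A.map_vadd y v
    simpa [hAe, add_comm] using this
  obtain ⟨ρ, hρ, hball⟩ := Metric.isOpen_iff.1 hU x hxU
  have cone : ∀ y v, y ∈ Ω → y ∈ U → y + v ∈ U → L * |ℓ v 0| ≤ ℓ v 1 → y + v ∈ Ω := by
    intro y v hy hyU hvU hc
    rw [hiff _ hvU, hadd]
    have h1 := (hiff y hyU).1 hy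
    have h2 := hγ.dist_le_mul ((e y + ℓ v) 0) (e y 0)
    rw [Real.dist_eq, Real.dist_eq] at h2
    simp only [PiLp.add_apply, add_sub_cancel_left] at h2 ⊢
    have h3 := le_abs_self (γ (e y 0 + ℓ v 0) - γ (e y 0))
    linarith
  set up : Plane := EuclideanSpace.single 1 1
  set d := ℓ.symm up
  have hd : ℓ d = up := by simp [d]
  have hdn : ‖d‖ = 1 := by simp [d, up]
  -- `d` is the upward direction of the local graph. If it did not point away from the axis, the
  -- cone of directions that keep `Ω` invariant would contain one with negative `r`-component, and
  -- points of `Ω` near `x` could be moved across the axis.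
  have hd0 : 0 < d 0 := by
    by_contra hneg
    push Not at hneg
    -- Small enough that tilting `d` by `-c • e0` stays inside the cone of slope `L`: the condition
    -- becomes `L * c + c ≤ 1`, and the value here gives `1 / 2`.
    set c : ℝ := 1 / (2 * (1 + L))
    have hL : (0:ℝ) ≤ L := L.2
    have hc : 0 < c := by positivity
    have hcL : c * (1 + L) = 1 / 2 := by simp only [c]; field_simp
    set e0 : Plane := EuclideanSpace.single 0 1
    set a := ℓ e0
    have ha : ‖a‖ = 1 := by simp [a, e0]
    have ha0 : |a 0| ≤ 1 := ha ▸ PiLp.norm_apply_le a 0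
    have ha1 : |a 1| ≤ 1 := ha ▸ PiLp.norm_apply_le a 1
    set s : ℝ := ρ / 4
    have hs : 0 < s := by positivity
    set v : Plane := s • (d - c • e0)
    have hv0 : v 0 ≤ -(s * c) := by
      simp only [v, PiLp.smul_apply, PiLp.sub_apply, e0, smul_eq_mul]
      simp
      nlinarith
    have hvn : ‖v‖ ≤ 2 * s := by
      have h1 : ‖d - c • e0‖ ≤ 1 + c := by
        refine (norm_sub_le _ _).trans ?_
        rw [hdn, norm_smul]; simp [e0, abs_of_pos hc]
      have : c ≤ 1 := by nlinarith
      rw [norm_smul, Real.norm_eq_abs, abs_of_pos hs]; nlinarith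
    have hvℓ : ℓ v = s • (up - c • a) := by simp [v, hd, a]
    obtain ⟨y, hy, hyx⟩ := Metric.mem_closure_iff.1 (frontier_subset_closure hx)
      (min (ρ / 4) (s * c)) (by positivity)
    have hyx1 : dist x y < ρ / 4 := hyx.trans_le (min_le_left _ _)
    have hyx2 : dist x y < s * c := hyx.trans_le (min_le_right _ _)
    have hyU : y ∈ U := hball (by rw [Metric.mem_ball, dist_comm]; linarith)
    have hyvU : y + v ∈ U := by
      refine hball ?_
      rw [Metric.mem_ball, dist_eq_norm]
      calc ‖y + v - x‖ = ‖(y - x) + v‖ := by congr 1; abel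
        _ ≤ ‖y - x‖ + ‖v‖ := norm_add_le _ _
        _ < ρ := by rw [← dist_eq_norm, dist_comm]; simp only [s] at hvn; linarith
    have hmem := cone y v hy hyU hyvU (by
      rw [hvℓ]
      simp only [PiLp.smul_apply, PiLp.sub_apply, up, smul_eq_mul]
      simp
      rw [abs_of_pos hs, abs_of_pos hc]
      have h1 : a 1 ≤ 1 := (le_abs_self _).trans ha1
      have h2 : L * |a 0| ≤ L := by nlinarith
      have : L * (c * |a 0|) ≤ 1 - c * a 1 := by nlinarith
      nlinarith)
    have h1 := hr _ hmem
    have h2 : |x 0 - y 0| ≤ dist x y := by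
      rw [dist_eq_norm]; exact PiLp.norm_apply_le (x - y) 0
    rw [hx0, zero_sub, abs_neg] at h2
    have := le_abs_self (y 0)
    simp only [PiLp.add_apply] at h1
    linarith
  set m := d 1 / d 0
  have hdir : dir m = (d 0)⁻¹ • d := by
    ext i; fin_cases i
    · simp [hd0.ne']
    · simp [m, div_eq_inv_mul]
  -- Since `y - t • dir m` lies in `Ω`, its first coordinate is positive and `t < y 0 < δ`. Both
  -- endpoints then have distance less than `δ * (2 + |m|)` to `x`, so they lie in the ball of
  -- radius `ρ`.
  have hδ : 0 < ρ / (3 + |m|) := by positivity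
  refine ⟨m, ρ / (3 + |m|), hδ, fun y t hy0 hy1 ht hmem => ?_⟩
  set δ := ρ / (3 + |m|)
  have hδρ : δ * (3 + |m|) = ρ := by simp only [δ]; field_simp
  have h0 := hr _ hmem
  simp only [PiLp.sub_apply, PiLp.smul_apply, dir_zero, smul_eq_mul, mul_one] at h0
  have htm : |t * m| ≤ δ * |m| := by
    rw [abs_mul, abs_of_nonneg ht]; gcongr; linarith
  have hyU : y ∈ U := by
    refine hball ?_
    rw [Metric.mem_ball, dist_eq_norm]
    refine (norm_le_abs_add_abs _).trans_lt ?_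
    simp only [PiLp.sub_apply, hx0, sub_zero]
    rw [abs_of_pos (by linarith : 0 < y 0)]
    have : 0 ≤ δ * |m| := by positivity
    nlinarith
  have hyU' : y - t • dir m ∈ U := by
    refine hball ?_
    rw [Metric.mem_ball, dist_eq_norm]
    refine (norm_le_abs_add_abs _).trans_lt ?_
    simp only [PiLp.sub_apply, PiLp.smul_apply, dir_zero, dir_one, smul_eq_mul, mul_one, hx0,
      sub_zero]
    rw [abs_of_pos h0]
    have : |y 1 - t * m - x 1| ≤ |y 1 - x 1| + |t * m| := by
      have := abs_sub (y 1 - x 1) (t * m)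
      rwa [show y 1 - x 1 - t * m = y 1 - t * m - x 1 by ring] at this
    nlinarith
  have hsum : y - t • dir m + t • dir m = y := by abel
  have := cone (y - t • dir m) (t • dir m) hmem hyU' (by rwa [hsum]) (by
    rw [hdir]
    simp only [map_smul, hd, up, PiLp.smul_apply, smul_eq_mul]
    simp
    positivity)
  rwa [hsum] at this

/-- Square integrability near the axis improves the weight. -/
lemma memL2_zero_of_local {F : Type*} [NormedAddCommGroup F] {Ω : Set Plane} (hΩ : IsOpen Ω)
    (hb : Bornology.IsBounded Ω) (hr : ∀ x ∈ Ω, 0 < x 0) {h : Plane → F} (hh : MemL2 Ω 1 h)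
    (hloc : ∀ x ∈ frontier Ω, x 0 = 0 → ∃ δ > 0,
      IntegrableOn (fun y => ‖h y‖ ^ 2) (Ω ∩ {y | y 0 < δ ∧ |y 1 - x 1| < δ})) :
    MemL2 Ω 0 h := by
  have hc0 : Continuous fun x : Plane => x 0 := by fun_prop
  have hc1 : Continuous fun x : Plane => x 1 := by fun_prop
  have hK : IsCompact (closure Ω) := hb.isCompact_closure
  have main : IntegrableOn (fun y => ‖h y‖ ^ 2) (Ω ∩ closure Ω) := by
    -- Compactness of the closure: at points with `x 0 > 0` the weight is bounded below, and the
    -- remaining points are boundary points on the axis, covered by `hloc`.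
    refine hK.induction_on (p := fun s => IntegrableOn (fun y => ‖h y‖ ^ 2) (Ω ∩ s)) (by simp)
      (fun s t hst ht => ht.mono_set (Set.inter_subset_inter_right _ hst))
      (fun s t hs ht => by rw [Set.inter_union_distrib_left]; exact hs.union ht) fun x hx => ?_
    have hxnn : 0 ≤ x 0 := by
      have : closure Ω ⊆ {x : Plane | 0 ≤ x 0} :=
        closure_minimal (fun y hy => (hr y hy).le) (isClosed_le continuous_const hc0)
      exact this hx
    rcases hxnn.eq_or_lt with hx0 | hx0
    · have hxf : x ∈ frontier Ω := by
        rw [frontier, hΩ.interior_eq]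
        exact ⟨hx, fun h => absurd (hr x h) (by rw [← hx0]; exact lt_irrefl _)⟩
      obtain ⟨δ, hδ, hi⟩ := hloc x hxf hx0.symm
      refine ⟨_, mem_nhdsWithin_of_mem_nhds (IsOpen.mem_nhds ?_ ?_), hi⟩
      · exact (isOpen_lt hc0 continuous_const).inter
          (isOpen_lt ((hc1.sub continuous_const).abs) continuous_const)
      · exact ⟨by rw [← hx0]; exact hδ, by simpa using hδ⟩
    · have ho : IsOpen {y : Plane | x 0 / 2 < y 0} := isOpen_lt continuous_const hc0
      refine ⟨{y | x 0 / 2 < y 0}, mem_nhdsWithin_of_mem_nhds (ho.mem_nhds ?_), ?_⟩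
      · simp [hx0]
      · have hi := (hh.2.mono_set (s := Ω ∩ {y : Plane | x 0 / 2 < y 0})
          Set.inter_subset_left).const_mul (2 / x 0)
        refine hi.mono' ?_ ?_
        · exact (hh.1.mono_set Set.inter_subset_left).norm.pow 2
        · filter_upwards [ae_restrict_mem (hΩ.measurableSet.inter ho.measurableSet)] with y hy
          have : x 0 / 2 < y 0 := hy.2
          rw [Real.norm_eq_abs, abs_of_nonneg (by positivity), zpow_one, ← mul_assoc]
          have : 1 ≤ 2 / x 0 * y 0 := by
            rw [div_mul_eq_mul_div, le_div_iff₀ hx0]; linarith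
          nlinarith [sq_nonneg ‖h y‖]
  rw [Set.inter_eq_left.2 subset_closure] at main
  exact ⟨hh.1, by simpa using main⟩

/-! ### Cutoffs and Hardy inequalities near the axis -/

lemma exists_cutoff (c : ℝ) {δ : ℝ} (hδ : 0 < δ) : ∃ θ : ℝ → ℝ, ContDiff ℝ ∞ θ ∧
    (∀ x, 0 ≤ θ x) ∧ (∀ x, θ x ≤ 1) ∧ (∀ x, |x - c| ≤ δ → θ x = 1) ∧
    (∀ x, 2 * δ < |x - c| → θ x = 0) ∧ ∃ L, ∀ x, |deriv θ x| ≤ L := by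
  let f : ContDiffBump c := ⟨δ, 2 * δ, hδ, by linarith⟩
  have hd : Continuous (deriv f) := (f.contDiff (n := 1)).continuous_deriv le_rfl
  obtain ⟨L, hL⟩ := f.hasCompactSupport.deriv.exists_bound_of_continuous hd
  refine ⟨f, f.contDiff, fun _ => f.nonneg, fun _ => f.le_one, fun x hx => ?_, fun x hx => ?_,
    L, hL⟩
  · exact f.one_of_mem_closedBall (by simpa [Real.dist_eq] using hx)
  · exact f.zero_of_le_dist (by rw [Real.dist_eq]; exact hx.le)

lemma fderiv_mul_coords {a b : ℝ → ℝ} {y : Plane} (ha : DifferentiableAt ℝ a (y 0))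
    (hb : DifferentiableAt ℝ b (y 1)) (v : Plane) :
    fderiv ℝ (fun y : Plane => a (y 0) * b (y 1)) y v
      = deriv a (y 0) * v 0 * b (y 1) + a (y 0) * (deriv b (y 1) * v 1) := by
  have h0 : HasFDerivAt (fun y : Plane => y 0) (EuclideanSpace.proj (𝕜 := ℝ) 0) y :=
    (EuclideanSpace.proj (𝕜 := ℝ) (0 : Fin 2)).hasFDerivAt
  have h1 : HasFDerivAt (fun y : Plane => y 1) (EuclideanSpace.proj (𝕜 := ℝ) 1) y :=
    (EuclideanSpace.proj (𝕜 := ℝ) (1 : Fin 2)).hasFDerivAt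
  have h := (ha.hasDerivAt.comp_hasFDerivAt y h0).mul (hb.hasDerivAt.comp_hasFDerivAt y h1)
  have e : fderiv ℝ (fun y : Plane => a (y 0) * b (y 1)) y = _ := h.fderiv
  rw [e]
  simp
  ring

/-- The translated test function is supported in `U` shifted along `dir m`; by `hpush` this shifted
set stays in `U` on the support of `κ`, so the product with `κ` is a legitimate test function. No
regularity of the zero extension across `∂Ω` is needed. -/
lemma TransGrad.of_isWeakGrad {Ω U : Set Plane} (hΩ : MeasurableSet Ω) (hr : Ω ⊆ offAxis)
    (hU : U ⊆ offAxis) {q : Plane → ℝ} {g : Plane → Plane} (h : IsWeakGrad Ω U q g)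
    (hq : MemL2 Ω 1 q) (hg : MemL2 Ω 1 g) {κ : Plane → ℝ} (hκ : ContDiffOn ℝ ∞ κ offAxis)
    {m τ : ℝ} (hpush : ∀ (t : ℝ) y, 0 ≤ t → y ∈ tsupport κ → y - t • dir m ∈ U → y ∈ U) (i : Fin 2) :
    TransGrad U m τ (EuclideanSpace.single i 1) (Ω.indicator fun y => κ y * q y)
      (Ω.indicator fun y => κ y * g y i + fderiv ℝ κ y (EuclideanSpace.single i 1) * q y) :=
  fun _ hφ hc hs t ht => h.translate hΩ hr hU hq hg hκ hφ hc hs (by simpa using ht.1.le)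
    (fun y hy hyU => hpush t y ht.1.le hy hyU) i

lemma TransGrad.of_components {U : Set Plane} (hUo : U ⊆ offAxis) {m τ : ℝ} {k k0 k1 : Plane → ℝ}
    (hk : HalfL2 1 k) (hk0 : HalfL2 1 k0) (hk1 : HalfL2 1 k1)
    (h0 : TransGrad U m τ (EuclideanSpace.single 0 1) k k0)
    (h1 : TransGrad U m τ (EuclideanSpace.single 1 1) k k1) :
    TransGrad U m τ (dir m) k (fun y => k0 y + m * k1 y) := by
  intro φ hφ hc hs t ht
  have hφv : ContDiff ℝ ∞ fun x => φ (x - t • dir m) :=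
    hφ.comp (contDiff_id.sub contDiff_const)
  have hcv := hasCompactSupport_sub hc (t • dir m)
  have hsv := tsupport_sub_subset (hs.trans hUo) (v := t • dir m)
    (by simpa using ht.1.le)
  have hA := halfL2_of_compactSupport hφv.continuous hcv hsv (-1)
  have hA' : ∀ e, HalfL2 (-1) (fun x => fderiv ℝ φ (x - t • dir m) e) := by
    intro e
    have := halfL2_of_compactSupport (continuous_fderiv_apply' hφv e)
      (hasCompactSupport_fderiv_apply hcv e)
      ((tsupport_fderiv_apply_subset' _ _).trans hsv) (-1)
    convert! this using 2
    rw [fderiv_comp_sub]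
  have e : ∀ y, k y * fderiv ℝ φ (y - t • dir m) (dir m)
      = k y * fderiv ℝ φ (y - t • dir m) (EuclideanSpace.single 0 1)
        + m * (k y * fderiv ℝ φ (y - t • dir m) (EuclideanSpace.single 1 1)) := by
    intro y
    have : dir m
        = (EuclideanSpace.single 0 1 : Plane) + m • EuclideanSpace.single 1 1 := by
      ext i; fin_cases i <;> simp
    generalize y - t • dir m = w
    rw [this, map_add, map_smul, smul_eq_mul]
    ring
  simp only [e, add_mul, mul_assoc]
  have comm : ∀ {A k : Plane → ℝ}, HalfL2 (-1) A → HalfL2 1 k → Integrable fun y => k y * A y :=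
    fun hA hk => by simpa only [mul_comm] using hA.integrable_mul hk
  rw [integral_add (comm (hA' _) hk) ((comm (hA' _) hk).const_mul m), integral_const_mul,
    integral_add (comm hA hk0) ((comm hA hk1).const_mul m), integral_const_mul,
    h0 φ hφ hc hs t ht, h1 φ hφ hc hs t ht]
  ring

lemma halfL2_cutoff {Ω : Set Plane} (hΩ : MeasurableSet Ω) (hr : Ω ⊆ offAxis) {q : Plane → ℝ}
    (hq : MemL2 Ω 1 q) {κ : Plane → ℝ} (hκ : ContDiffOn ℝ ∞ κ offAxis) {C : ℝ}
    (hC : ∀ x ∈ Ω, |κ x| ≤ C) : HalfL2 1 (Ω.indicator fun y => κ y * q y) :=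
  (hq.mul_bdd hΩ hr ((hκ.continuousOn.mono hr).aestronglyMeasurable hΩ) hC).halfL2 hΩ hr

lemma memL2_cutoff_grad {Ω : Set Plane} (hΩ : MeasurableSet Ω) (hr : Ω ⊆ offAxis) (α : H1 Ω)
    {κ : Plane → ℝ} (hκ : ContDiffOn ℝ ∞ κ offAxis) {C C' : ℝ} (hC : ∀ x ∈ Ω, |κ x| ≤ C)
    (i : Fin 2) (hC' : ∀ x ∈ Ω, |fderiv ℝ κ x (EuclideanSpace.single i 1)| ≤ C') :
    MemL2 Ω 1 (fun y => κ y * α.grad y i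
      + fderiv ℝ κ y (EuclideanSpace.single i 1) * α.val y) := by
  have hκ' : ContinuousOn (fun x => fderiv ℝ κ x (EuclideanSpace.single i 1)) Ω :=
    ((hκ.continuousOn_fderiv_of_isOpen isOpen_offAxis (by simp)).clm_apply
      continuousOn_const).mono hr
  exact ((α.grad_mem.comp hΩ hr i).mul_bdd hΩ hr
    ((hκ.continuousOn.mono hr).aestronglyMeasurable hΩ) hC).add hΩ hr
    (α.val_mem.mul_bdd hΩ hr (hκ'.aestronglyMeasurable hΩ) hC')

/-- Multiplication of an `H¹_1` function by a smooth function that is bounded with its gradient. -/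
lemma H1.exists_mul {Ω : Set Plane} (hΩ : MeasurableSet Ω) (hr : Ω ⊆ offAxis) (α : H1 Ω)
    {κ : Plane → ℝ} (hκ : ContDiffOn ℝ ∞ κ offAxis) {C C' : ℝ} (hC : ∀ x ∈ Ω, |κ x| ≤ C)
    (hC' : ∀ i, ∀ x ∈ Ω, |fderiv ℝ κ x (EuclideanSpace.single i 1)| ≤ C') :
    ∃ β : H1 Ω, ∀ x i, β.grad x i = κ x * α.grad x i
      + fderiv ℝ κ x (EuclideanSpace.single i 1) * α.val x := by
  have hg := fun i => memL2_cutoff_grad hΩ hr α hκ hC i (hC' i)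
  refine ⟨⟨fun y => κ y * α.val y, fun y => !₂[κ y * α.grad y 0
      + fderiv ℝ κ y (EuclideanSpace.single 0 1) * α.val y, κ y * α.grad y 1
      + fderiv ℝ κ y (EuclideanSpace.single 1 1) * α.val y],
    α.val_mem.mul_bdd hΩ hr ((hκ.continuousOn.mono hr).aestronglyMeasurable hΩ) hC,
    memL2_vec hΩ hr (hg 0) (hg 1), ?_⟩, fun x i => by fin_cases i <;> simp⟩
  intro φ hφ hc hs i
  have := α.weak.translate hΩ hr hr α.val_mem α.grad_mem hκ hφ hc hs (v := 0) (by simp)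
    (fun y _ h => by simpa using h) i
  simp only [sub_zero] at this
  rw [← integral_indicator hΩ, ← integral_indicator hΩ]
  convert! this using 2
  · ext x; by_cases hx : x ∈ Ω <;> simp [hx]
  · congr 1; ext x; by_cases hx : x ∈ Ω <;> fin_cases i <;> simp [hx]

lemma tsupport_mul_coords_subset {a b : ℝ → ℝ} {c ρ : ℝ} (ha : ∀ x, ρ < |x| → a x = 0)
    (hb : ∀ x, ρ < |x - c| → b x = 0) :
    tsupport (fun y : Plane => a (y 0) * b (y 1)) ⊆ {y | |y 0| ≤ ρ ∧ |y 1 - c| ≤ ρ} := by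
  have hc0 : Continuous fun x : Plane => |x 0| := by fun_prop
  have hc1 : Continuous fun x : Plane => |x 1 - c| := by fun_prop
  refine closure_minimal (fun y hy => ⟨?_, ?_⟩)
    ((isClosed_le hc0 continuous_const).inter (isClosed_le hc1 continuous_const))
  · by_contra h
    exact hy (by simp [ha _ (not_le.1 h)])
  · by_contra h
    exact hy (by simp [hb _ (not_le.1 h)])

lemma contDiffOn_mul_coords {a b : ℝ → ℝ} (ha : ContDiffOn ℝ ∞ a (Set.Ioi 0))
    (hb : ContDiff ℝ ∞ b) : ContDiffOn ℝ ∞ (fun y : Plane => a (y 0) * b (y 1)) offAxis := by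
  have h0 : ContDiff ℝ ∞ fun y : Plane => y 0 := by fun_prop
  have h1 : ContDiff ℝ ∞ fun y : Plane => y 1 := by fun_prop
  exact (ha.comp h0.contDiffOn fun x hx => hx).mul (hb.comp h1).contDiffOn

/-- Near the axis a function in `H¹_1` is in the unweighted space `L²`. -/
lemma H1.memL2_zero {Ω : Set Plane} (hΩ : IsLipschitzDomain Ω) (hr : ∀ x ∈ Ω, 0 < x 0)
    (α : H1 Ω) : MemL2 Ω 0 α.val := by
  have hm := hΩ.1.measurableSet
  have hro : Ω ⊆ offAxis := hr
  obtain ⟨Z, hZ⟩ := hΩ.2.2.1.exists_norm_le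
  have hR : ∀ x ∈ Ω, x 0 ≤ |Z| := fun x hx =>
    (le_abs_self _).trans ((PiLp.norm_apply_le x 0).trans ((hZ x hx).trans (le_abs_self _)))
  refine memL2_zero_of_local hΩ.1 hΩ.2.2.1 hr α.val_mem fun x hx hx0 => ?_
  obtain ⟨m, δ₀, hδ₀, hpush⟩ := hΩ.exists_push hr hx hx0
  set δ := δ₀ / 3
  have hδ : 0 < δ := by positivity
  have hδ2 : 2 * δ < δ₀ := by simp only [δ]; linarith
  obtain ⟨χ, hχs, hχ0, hχ1, hχe, hχz, Lχ, hLχ⟩ := exists_cutoff 0 hδ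
  obtain ⟨θ, hθs, hθ0, hθ1, hθe, hθz, Lθ, hLθ⟩ := exists_cutoff (x 1) hδ
  simp only [sub_zero] at hχe hχz
  set κ : Plane → ℝ := fun y => χ (y 0) * θ (y 1)
  have hκ : ContDiffOn ℝ ∞ κ offAxis := contDiffOn_mul_coords hχs.contDiffOn hθs
  have hκC : ∀ x ∈ Ω, |κ x| ≤ 1 := fun x _ => by
    rw [abs_of_nonneg (mul_nonneg (hχ0 _) (hθ0 _))]
    exact mul_le_one₀ (hχ1 _) (hθ0 _) (hθ1 _)
  have hκC' : ∀ i, ∀ x ∈ Ω, |fderiv ℝ κ x (EuclideanSpace.single i 1)| ≤ |Lχ| + |Lθ| := by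
    intro i y _
    rw [fderiv_mul_coords (hχs.differentiable (by simp) _) (hθs.differentiable (by simp) _)]
    have h1 : |deriv χ (y 0)| * |θ (y 1)| ≤ |Lχ| * 1 :=
      mul_le_mul ((hLχ _).trans (le_abs_self _)) (by rw [abs_of_nonneg (hθ0 _)]; exact hθ1 _)
        (abs_nonneg _) (abs_nonneg _)
    have h2 : |χ (y 0)| * |deriv θ (y 1)| ≤ 1 * |Lθ| :=
      mul_le_mul (by rw [abs_of_nonneg (hχ0 _)]; exact hχ1 _) ((hLθ _).trans (le_abs_self _))
        (abs_nonneg _) zero_le_one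
    have := abs_nonneg Lχ
    have := abs_nonneg Lθ
    fin_cases i
    · simp [abs_mul]; linarith
    · simp [abs_mul]; linarith
  have hp : ∀ (t : ℝ) y, 0 ≤ t → y ∈ tsupport κ → y - t • dir m ∈ Ω → y ∈ Ω := by
    intro t y ht hy hyΩ
    have := tsupport_mul_coords_subset hχz hθz hy
    exact hpush y t (((le_abs_self _).trans this.1).trans_lt hδ2) (this.2.trans_lt hδ2) ht hyΩ
  have hk := halfL2_cutoff hm hro α.val_mem hκ hκC
  have hki := fun i => (memL2_cutoff_grad hm hro α hκ hκC i (hκC' i)).halfL2 hm hro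
  have htg := fun i => TransGrad.of_isWeakGrad (τ := |Z|) hm hro hro α.weak α.val_mem α.grad_mem
    hκ hp i
  -- Hardy's inequality in the push direction for the localized function. The whole derivative along
  -- `dir m`, including the part falling on the cutoff, is in `L²_1`.
  have key := ((htg 0).of_components hro hk (hki 0) (hki 1) (htg 1)).lintegral_sq_le hΩ.1 hro
    (abs_nonneg Z) hk ((hki 0).add ((hki 1).const_mul m)) fun y hy =>
      hR y (Set.mem_of_indicator_ne_zero hy)
  refine ⟨δ, hδ, ⟨?_, ?_⟩⟩
  · exact (α.val_mem.1.mono_set Set.inter_subset_left).norm.pow 2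
  · refine lt_of_le_of_lt ?_ (key.trans_lt (ENNReal.mul_lt_top ENNReal.ofReal_lt_top
      ENNReal.ofReal_lt_top))
    have hs : MeasurableSet (Ω ∩ {y : Plane | y 0 < δ ∧ |y 1 - x 1| < δ}) := by
      have hc0 : Continuous fun x : Plane => x 0 := by fun_prop
      have hc1 : Continuous fun y : Plane => |y 1 - x 1| := by fun_prop
      exact hm.inter ((isOpen_lt hc0 continuous_const).inter
        (isOpen_lt hc1 continuous_const)).measurableSet
    refine le_trans (le_of_eq ?_) (lintegral_mono_set (Set.inter_subset_left
      (t := {y : Plane | y 0 < δ ∧ |y 1 - x 1| < δ})))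
    refine setLIntegral_congr_fun hs fun y hy => ?_
    have h1 : |y 0| ≤ δ := by rw [abs_of_pos (hr y hy.1)]; exact hy.2.1.le
    simp [hy.1, κ, hχe _ h1, hθe _ hy.2.2.le]

/-- Weighted Hardy inequality for stream functions. -/
lemma lintegral_bwd_weighted_le {A : Plane → ℝ} (hA : HalfL2 (-1) A) {τ ε : ℝ} (hτ : 0 ≤ τ)
    (hε : 0 < ε) {θ : ℝ → ℝ} (hθ : Continuous θ) :
    ∫⁻ x in {x : Plane | 0 < x 0 ∧ x 0 ≤ τ},
        ENNReal.ofReal (θ (x 1) ^ 2 / (x 0 * (x 0 + ε) ^ 3)) * ‖bwd 0 τ A x‖ₑ ^ 2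
      ≤ ∫⁻ y in offAxis, ENNReal.ofReal (θ (y 1) ^ 2 / (2 * (y 0 * (y 0 + ε)))) * ‖A y‖ₑ ^ 2 := by
  set μ : Measure ℝ := volume.restrict (Set.Ioc 0 τ)
  set S : Set Plane := {x : Plane | 0 < x 0 ∧ x 0 ≤ τ}
  have hc0 : Continuous fun x : Plane => x 0 := by fun_prop
  have hS : MeasurableSet S := (measurableSet_lt measurable_const hc0.measurable).inter
    (measurableSet_le hc0.measurable measurable_const)
  set H : Plane → ℝ≥0∞ := fun y => ‖A y‖ₑ ^ 2 * ENNReal.ofReal (y 0)⁻¹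
  have hHm : AEMeasurable H volume := (hA.meas.enorm.pow_const 2).mul
    (hc0.measurable.inv.ennreal_ofReal).aemeasurable
  set W : Plane → ℝ≥0∞ := S.indicator fun x =>
    ENNReal.ofReal (θ (x 1) ^ 2 * x 0 / (2 * (x 0 + ε) ^ 3))
  have hWm : Measurable W := by
    refine Measurable.indicator ?_ hS
    refine Measurable.ennreal_ofReal ?_
    have h1 : Measurable fun x : Plane => θ (x 1) := by fun_prop
    fun_prop
  have hsh : ∀ᵐ x : Plane, AEStronglyMeasurable (fun t => A (x - t • dir 0)) μ := by
    have := (aestronglyMeasurable_shear hA.meas (-dir 0) μ).prod_swap.prodMk_left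
    simpa [sub_eq_add_neg] using this
  have hpt : ∀ᵐ x : Plane, x ∈ S →
      ENNReal.ofReal (θ (x 1) ^ 2 / (x 0 * (x 0 + ε) ^ 3)) * ‖bwd 0 τ A x‖ₑ ^ 2
        ≤ W x * ∫⁻ t, H (x - t • dir 0) ∂μ := by
    filter_upwards [hsh] with x hx hxS
    have hx0 : 0 < x 0 := hxS.1
    have hsub : Set.Ioo 0 (x 0) ⊆ Set.Ioc 0 τ := fun t ht => ⟨ht.1, ht.2.le.trans hxS.2⟩
    have e1 : bwd 0 τ A x = ∫ t in Set.Ioo 0 (x 0), A (x - t • dir 0) := by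
      refine (setIntegral_eq_of_subset_of_forall_sdiff_eq_zero measurableSet_Ioc hsub
        fun t ht => hA.supp _ ?_)
      have : x 0 ≤ t := by
        by_contra h
        exact ht.2 ⟨ht.1.1, not_le.1 h⟩
      simpa using this
    -- Cauchy–Schwarz with weight `x 0 - t`, the distance of `x - t • dir 0` to the axis. Its
    -- integral `x 0 ^ 2 / 2` cancels part of the singular weight at `x`.
    have e2 := enorm_integral_sq_le (μ := volume.restrict (Set.Ioo 0 (x 0)))
      (hx.mono_set hsub) (p := fun t => x 0 - t) (by fun_prop)
      (by filter_upwards [ae_restrict_mem measurableSet_Ioo] with t ht using sub_pos.2 ht.2)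
    have e3 : ∫⁻ t in Set.Ioo 0 (x 0), ENNReal.ofReal (x 0 - t) = ENNReal.ofReal (x 0 ^ 2 / 2) := by
      rw [← ofReal_integral_eq_lintegral_ofReal, ← integral_Ioc_eq_integral_Ioo,
        ← intervalIntegral.integral_of_le hx0.le]
      · congr 1
        rw [intervalIntegral.integral_sub (by simp) (by simp)]
        simp; ring
      · exact (Continuous.integrableOn_Icc (by fun_prop)).mono_set Set.Ioo_subset_Icc_self
      · filter_upwards [ae_restrict_mem measurableSet_Ioo] with t ht using (sub_pos.2 ht.2).le
    rw [e3] at e2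
    have e4 : ∫⁻ t in Set.Ioo 0 (x 0), ‖A (x - t • dir 0)‖ₑ ^ 2 * ENNReal.ofReal (x 0 - t)⁻¹
        ≤ ∫⁻ t, H (x - t • dir 0) ∂μ := by
      refine le_trans (le_of_eq ?_) (lintegral_mono_set hsub)
      simp [H]
    rw [e1]
    calc _ ≤ ENNReal.ofReal (θ (x 1) ^ 2 / (x 0 * (x 0 + ε) ^ 3))
          * ((∫⁻ t, H (x - t • dir 0) ∂μ) * ENNReal.ofReal (x 0 ^ 2 / 2)) := by
          gcongr
          exact e2.trans (by gcongr)
      _ = _ := by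
          simp only [W, Set.indicator_of_mem hxS]
          rw [mul_comm _ (ENNReal.ofReal (x 0 ^ 2 / 2)), ← mul_assoc,
            ← ENNReal.ofReal_mul (by positivity)]
          congr 2
          field_simp
  calc _ ≤ ∫⁻ x in S, W x * ∫⁻ t, H (x - t • dir 0) ∂μ := by
        refine lintegral_mono_ae ?_
        filter_upwards [ae_restrict_of_ae hpt, ae_restrict_mem hS] with x hx hxS using hx hxS
    _ ≤ ∫⁻ x, W x * ∫⁻ t, H (x - t • dir 0) ∂μ := setLIntegral_le_lintegral _ _
    _ = ∫⁻ x, ∫⁻ t, W x * H (x - t • dir 0) ∂μ := by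
        refine lintegral_congr fun x => ?_
        rw [lintegral_const_mul']
        simp only [W]
        by_cases hx : x ∈ S <;> simp [hx]
    _ = ∫⁻ y, ∫⁻ t, W (y + t • dir 0) * H y ∂μ := by
        have hH2 : AEMeasurable (fun p : ℝ × Plane => H (p.2 + p.1 • (-dir 0))) (μ.prod volume) :=
          hHm.comp_quasiMeasurePreserving (quasiMeasurePreserving_add_smul _ μ)
        have hprod : AEMeasurable (fun p : ℝ × Plane => W p.2 * H (p.2 - p.1 • dir 0))
            (μ.prod volume) := by
          have : AEMeasurable (fun p : ℝ × Plane => W p.2 * H (p.2 + p.1 • (-dir 0)))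
            (μ.prod volume) := (hWm.comp measurable_snd).aemeasurable.mul hH2
          simpa [sub_eq_add_neg] using this
        rw [lintegral_shear (fun t x => W x * H (x - t • dir 0)) hprod (dir 0)]
        simp
    _ ≤ ∫⁻ y in offAxis, ENNReal.ofReal (θ (y 1) ^ 2 / (2 * (y 0 * (y 0 + ε))))
          * ‖A y‖ₑ ^ 2 := by
        rw [← lintegral_indicator measurableSet_offAxis]
        refine lintegral_mono fun y => ?_
        have hWy : Measurable fun t : ℝ => W (y + t • dir 0) := hWm.comp (by fun_prop)
        rw [lintegral_mul_const _ hWy]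
        rcases le_or_gt (y 0) 0 with hy | hy
        · simp [H, hA.supp y hy]
        have hyo : y ∈ offAxis := hy
        -- After exchanging the integrals the weight is integrated along the ray leaving `y`. It is
        -- at most a multiple of `(y 0 + ε + t)⁻¹ ^ 2`, whose integral is at most `(y 0 + ε)⁻¹`; the
        -- cutoff is constant along the ray because `dir 0` has no `z`-component.
        have hi : ∫⁻ t, W (y + t • dir 0) ∂μ
            ≤ ENNReal.ofReal (θ (y 1) ^ 2 / (2 * (y 0 + ε))) := by
          calc ∫⁻ t, W (y + t • dir 0) ∂μ
              ≤ ∫⁻ t in Set.Ioc 0 τ, ENNReal.ofReal (θ (y 1) ^ 2 / 2 * (y 0 + ε + t)⁻¹ ^ 2) := by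
                refine setLIntegral_mono (by fun_prop) fun t ht => ?_
                simp only [W]
                refine (Set.indicator_le_self' (fun _ _ => zero_le) _).trans ?_
                simp only [PiLp.add_apply, PiLp.smul_apply, dir_zero, dir_one, smul_eq_mul,
                  mul_one, mul_zero, add_zero]
                refine ENNReal.ofReal_le_ofReal ?_
                have ht0 := ht.1
                have h1 : 0 < y 0 + ε + t := by positivity
                have e : θ (y 1) ^ 2 * (y 0 + t) / (2 * (y 0 + t + ε) ^ 3)
                    = θ (y 1) ^ 2 / 2 * (y 0 + ε + t)⁻¹ ^ 2 * ((y 0 + t) / (y 0 + ε + t)) := by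
                  rw [show y 0 + t + ε = y 0 + ε + t by ring]; field_simp
                rw [e]
                refine mul_le_of_le_one_right (by positivity) ?_
                rw [div_le_one h1]; linarith
            _ = ENNReal.ofReal (∫ t in (0:ℝ)..τ, θ (y 1) ^ 2 / 2 * (y 0 + ε + t)⁻¹ ^ 2) := by
                rw [intervalIntegral.integral_of_le hτ, ofReal_integral_eq_lintegral_ofReal]
                · refine (ContinuousOn.integrableOn_Icc (continuousOn_const.mul
                    (ContinuousOn.pow (ContinuousOn.inv₀ (by fun_prop) fun t ht => ?_) 2))
                    ).mono_set Set.Ioc_subset_Icc_self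
                  have := ht.1; positivity
                · exact Filter.Eventually.of_forall fun t => by simp only [Pi.zero_apply]; positivity
            _ ≤ _ := by
                refine ENNReal.ofReal_le_ofReal ?_
                have hd : ∀ t ∈ Set.uIcc 0 τ, HasDerivAt
                    (fun t => -(θ (y 1) ^ 2 / 2 * (y 0 + ε + t)⁻¹))
                    (θ (y 1) ^ 2 / 2 * (y 0 + ε + t)⁻¹ ^ 2) t := by
                  intro t ht
                  rw [Set.uIcc_of_le hτ] at ht
                  have h1 : y 0 + ε + t ≠ 0 := by have := ht.1; positivity
                  have h2 : HasDerivAt (fun t => y 0 + ε + t) 1 t := by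
                    simpa using (hasDerivAt_id t).const_add (y 0 + ε)
                  refine ((h2.inv h1).const_mul (θ (y 1) ^ 2 / 2)).neg.congr_deriv ?_
                  field_simp
                rw [intervalIntegral.integral_eq_sub_of_hasDerivAt hd]
                · have : 0 ≤ θ (y 1) ^ 2 / 2 * (y 0 + ε + τ)⁻¹ := by positivity
                  have e : θ (y 1) ^ 2 / (2 * (y 0 + ε)) = θ (y 1) ^ 2 / 2 * (y 0 + ε + 0)⁻¹ := by
                    rw [add_zero]; field_simp
                  rw [e]; linarith
                · refine ContinuousOn.intervalIntegrable (continuousOn_const.mul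
                    (ContinuousOn.pow (ContinuousOn.inv₀ (by fun_prop) fun t ht => ?_) 2))
                  rw [Set.uIcc_of_le hτ] at ht
                  have := ht.1; positivity
        rw [Set.indicator_of_mem hyo]
        calc _ ≤ ENNReal.ofReal (θ (y 1) ^ 2 / (2 * (y 0 + ε))) * H y := by gcongr
          _ = _ := by
            simp only [H]
            rw [mul_comm (‖A y‖ₑ ^ 2), ← mul_assoc, ← ENNReal.ofReal_mul (by positivity)]
            congr 2
            field_simp

/-! ### Weighted energy estimate and regularity of the Helmholtz projection -/

lemma mul_le_young {k u v c d : ℝ} (hk : 0 ≤ k) (hc : 0 < c) (hcd : 4 * c * d = 1) :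
    k * (u * v) ≤ c * (k * u ^ 2) + d * (k * v ^ 2) := by
  have h : 0 ≤ k * (c * (u - 2 * d * v) ^ 2) := by positivity
  have e : k * (c * (u - 2 * d * v) ^ 2)
      = c * (k * u ^ 2) + d * (k * v ^ 2) * (4 * c * d) - k * (u * v) * (4 * c * d) := by ring
  rw [hcd] at e
  linarith

/-- Pointwise absorption in the weighted energy identity. The arguments stand for: distance `r` to
the axis, `W = 1/(r+ε)`, the cutoffs `θ` (with derivative `θ'`) and `χ`, the stream function `ψ`, the
potential `a`, and the components of `G` and `f`. -/
lemma energy_pointwise {r W θ θ' χ ψ a L δ G0 G1 f0 f1 : ℝ} (hr : 0 < r) (hW : 0 < W)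
    (hrW : r * W ≤ 1) (hθ0 : 0 ≤ θ) (hθ1 : θ ≤ 1) (hθ' : |θ'| ≤ L) (hχ0 : 0 ≤ χ) (hχ1 : χ ≤ 1)
    (hδ : 0 < δ) (hχ : r ≤ δ → χ = 1) :
    W * θ ^ 2 * r * (G0 * f0 + G1 * f1) + a * (r * G0) * (-W ^ 2) * θ ^ 2 * (1 - χ)
      + a * (r * G1) * W * (2 * θ * θ')
      + ψ * (χ * (-W ^ 2) * (θ ^ 2 * (f1 - G1) + 2 * θ * θ' * a))
    ≤ 5 / 12 * (θ ^ 2 * r * W * (G0 ^ 2 + G1 ^ 2)) + 5 / 6 * (θ ^ 2 * ψ ^ 2 * W ^ 3 / r)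
      + (12 * (f0 ^ 2 + f1 ^ 2) + 48 * (L ^ 2 * a ^ 2)
        + (r * a ^ 2 + r * (G0 ^ 2 + G1 ^ 2)) / δ ^ 2) := by
  have hθ2 : θ ^ 2 ≤ 1 := pow_le_one₀ hθ0 hθ1
  have hL : θ' ^ 2 ≤ L ^ 2 := by
    rw [← sq_abs]; exact pow_le_pow_left₀ (abs_nonneg _) hθ' 2
  have hχsq : χ ^ 2 ≤ 1 := pow_le_one₀ hχ0 hχ1
  have hWr0 : 0 ≤ r * W := by positivity
  have t1 : ∀ G f : ℝ, W * θ ^ 2 * r * (G * f)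
      ≤ 1 / 24 * (θ ^ 2 * r * W * G ^ 2) + 6 * f ^ 2 := by
    intro G f
    have y := mul_le_young (u := θ * G) (v := θ * f) (c := 1 / 24) (d := 6) hWr0 (by norm_num)
      (by norm_num)
    have y2 : r * W * θ ^ 2 * f ^ 2 ≤ f ^ 2 :=
      mul_le_of_le_one_left (sq_nonneg _) (mul_le_one₀ hrW (sq_nonneg _) hθ2)
    linarith
  -- The part of the singular term away from the axis: `1 - χ` vanishes for `r ≤ δ`, and for `r > δ`
  -- one has `W ≤ 1 / δ`.
  have t2 : a * (r * G0) * (-W ^ 2) * θ ^ 2 * (1 - χ)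
      ≤ (r * a ^ 2 + r * (G0 ^ 2 + G1 ^ 2)) / δ ^ 2 := by
    rcases le_or_gt r δ with h | h
    · rw [hχ h]
      have : 0 ≤ (r * a ^ 2 + r * (G0 ^ 2 + G1 ^ 2)) / δ ^ 2 := by positivity
      simpa using this
    · have hWδ : W ≤ 1 / δ := by
        rw [le_div_iff₀ hδ]; nlinarith
      have hW2 : W ^ 2 ≤ 1 / δ ^ 2 := by
        rw [← one_div_pow]; exact pow_le_pow_left₀ hW.le hWδ 2
      have y : -(a * G0) ≤ a ^ 2 + G0 ^ 2 := by nlinarith [sq_nonneg (a + G0), sq_nonneg (a - G0)]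
      have hc0 : 0 ≤ W ^ 2 * θ ^ 2 * (1 - χ) := by
        have : 0 ≤ 1 - χ := by linarith
        positivity
      have hc1 : W ^ 2 * θ ^ 2 * (1 - χ) ≤ 1 / δ ^ 2 := by
        have e1 : W ^ 2 * θ ^ 2 ≤ 1 / δ ^ 2 := by nlinarith [sq_nonneg W]
        have e2 : 0 ≤ W ^ 2 * θ ^ 2 := by positivity
        nlinarith
      calc a * (r * G0) * (-W ^ 2) * θ ^ 2 * (1 - χ)
          = r * (-(a * G0)) * (W ^ 2 * θ ^ 2 * (1 - χ)) := by ring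
        _ ≤ r * (a ^ 2 + G0 ^ 2) * (W ^ 2 * θ ^ 2 * (1 - χ)) := by gcongr
        _ ≤ r * (a ^ 2 + G0 ^ 2) * (1 / δ ^ 2) := by gcongr
        _ ≤ (r * a ^ 2 + r * (G0 ^ 2 + G1 ^ 2)) * (1 / δ ^ 2) := by
            gcongr; nlinarith [mul_nonneg hr.le (sq_nonneg G1)]
        _ = _ := by ring
  have t3 : a * (r * G1) * W * (2 * θ * θ')
      ≤ 1 / 24 * (θ ^ 2 * r * W * G1 ^ 2) + 24 * (L ^ 2 * a ^ 2) := by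
    have y := mul_le_young (u := θ * G1) (v := 2 * θ' * a) (c := 1 / 24) (d := 6) hWr0
      (by norm_num) (by norm_num)
    have y2 : r * W * θ' ^ 2 * a ^ 2 ≤ L ^ 2 * a ^ 2 := by
      have : r * W * θ' ^ 2 ≤ L ^ 2 := (mul_le_of_le_one_left (sq_nonneg _) hrW).trans hL
      gcongr
    linarith
  -- `ρ = W / r` is the weight that turns the stream function density into `ρ * (θ * ψ * W) ^ 2`, a
  -- square suited to Young's inequality.
  obtain ⟨ρ, hρ0, hρ⟩ : ∃ ρ, 0 ≤ ρ ∧ ρ * r = W := ⟨W / r, by positivity, by field_simp⟩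
  have ex : θ ^ 2 * ψ ^ 2 * W ^ 3 / r = ρ * (θ * ψ * W) ^ 2 := by
    rw [div_eq_iff hr.ne']
    linear_combination (-(θ * ψ * W) ^ 2) * hρ
  rw [ex]
  have t4 : ψ * (χ * (-W ^ 2) * (θ ^ 2 * f1)) ≤ 1 / 24 * (ρ * (θ * ψ * W) ^ 2) + 6 * f1 ^ 2 := by
    have y := mul_le_young (u := θ * ψ * W) (v := -(r * χ * θ * f1)) (c := 1 / 24) (d := 6) hρ0
      (by norm_num) (by norm_num)
    have e1 : ρ * (θ * ψ * W * -(r * χ * θ * f1)) = ψ * (χ * (-W ^ 2) * (θ ^ 2 * f1)) := by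
      linear_combination (-(θ * ψ * W * χ * θ * f1)) * hρ
    have e2 : ρ * (-(r * χ * θ * f1)) ^ 2 = r * W * (χ ^ 2 * θ ^ 2) * f1 ^ 2 := by
      linear_combination (r * χ ^ 2 * θ ^ 2 * f1 ^ 2) * hρ
    have e3 : r * W * (χ ^ 2 * θ ^ 2) * f1 ^ 2 ≤ f1 ^ 2 :=
      mul_le_of_le_one_left (sq_nonneg _) (mul_le_one₀ hrW (by positivity)
        (mul_le_one₀ hχsq (sq_nonneg _) hθ2))
    rw [e1, e2] at y
    linarith
  have t5 : ψ * (χ * (-W ^ 2) * (2 * θ * θ' * a))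
      ≤ 1 / 24 * (ρ * (θ * ψ * W) ^ 2) + 24 * (L ^ 2 * a ^ 2) := by
    have y := mul_le_young (u := θ * ψ * W) (v := -(2 * r * χ * θ' * a)) (c := 1 / 24) (d := 6) hρ0
      (by norm_num) (by norm_num)
    have e1 : ρ * (θ * ψ * W * -(2 * r * χ * θ' * a))
        = ψ * (χ * (-W ^ 2) * (2 * θ * θ' * a)) := by
      linear_combination (-(θ * ψ * W * 2 * χ * θ' * a)) * hρ
    have e2 : ρ * (-(2 * r * χ * θ' * a)) ^ 2 = 4 * (r * W * (χ ^ 2 * θ' ^ 2) * a ^ 2) := by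
      linear_combination (4 * r * χ ^ 2 * θ' ^ 2 * a ^ 2) * hρ
    have e3 : r * W * (χ ^ 2 * θ' ^ 2) * a ^ 2 ≤ L ^ 2 * a ^ 2 := by
      have h1 : χ ^ 2 * θ' ^ 2 ≤ L ^ 2 := (mul_le_of_le_one_left (sq_nonneg _) hχsq).trans hL
      have : r * W * (χ ^ 2 * θ' ^ 2) ≤ L ^ 2 :=
        (mul_le_of_le_one_left (by positivity) hrW).trans h1
      gcongr
    rw [e1, e2] at y
    linarith
  -- The critical product of stream function and `G_z`, with no small factor. The Hardy inequality
  -- later bounds the first density by half of the total energy, so the cost is `3/4 * 1/2 + 1/3 =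
  -- 17/24 < 1`, close to the optimum `1/√2`; the other terms use coefficients `1/24`.
  have t6 : ψ * (χ * (-W ^ 2) * (θ ^ 2 * -G1))
      ≤ 3 / 4 * (ρ * (θ * ψ * W) ^ 2) + 1 / 3 * (θ ^ 2 * r * W * G1 ^ 2) := by
    have y := mul_le_young (u := θ * ψ * W) (v := r * χ * θ * G1) (c := 3 / 4) (d := 1 / 3) hρ0
      (by norm_num) (by norm_num)
    have e1 : ρ * (θ * ψ * W * (r * χ * θ * G1)) = ψ * (χ * (-W ^ 2) * (θ ^ 2 * -G1)) := by
      linear_combination (θ * ψ * W * χ * θ * G1) * hρ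
    have e2 : ρ * (r * χ * θ * G1) ^ 2 = θ ^ 2 * r * W * G1 ^ 2 * χ ^ 2 := by
      linear_combination (r * χ ^ 2 * θ ^ 2 * G1 ^ 2) * hρ
    have e3 : θ ^ 2 * r * W * G1 ^ 2 * χ ^ 2 ≤ θ ^ 2 * r * W * G1 ^ 2 :=
      mul_le_of_le_one_right (by positivity) hχsq
    rw [e1, e2] at y
    linarith
  have s0 := t1 G0 f0
  have s1 := t1 G1 f1
  have p1 : 0 ≤ θ ^ 2 * r * W * G0 ^ 2 := by positivity
  have p2 : 0 ≤ f0 ^ 2 := sq_nonneg _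
  linarith

lemma MemL2.integrable_inner {Ω : Set Plane} (hΩ : MeasurableSet Ω) (hr : Ω ⊆ offAxis)
    {u v : Plane → Plane} (hu : MemL2 Ω 1 u) (hv : MemL2 Ω 1 v) :
    IntegrableOn (fun x => x 0 * ⟪u x, v x⟫) Ω := by
  refine (hu.2.add hv.2).mono' ?_ ?_
  · exact (by fun_prop : Measurable fun x : Plane => x 0).aestronglyMeasurable.mul
      (hu.1.inner hv.1)
  · filter_upwards [ae_restrict_mem hΩ] with x hx
    have hx0 : (0:ℝ) < x 0 := hr hx
    have h1 : |⟪u x, v x⟫| ≤ ‖u x‖ * ‖v x‖ := abs_real_inner_le_norm _ _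
    have h2 : ‖u x‖ * ‖v x‖ ≤ ‖u x‖ ^ 2 + ‖v x‖ ^ 2 := by
      nlinarith [sq_nonneg (‖u x‖ - ‖v x‖), sq_nonneg (‖u x‖ + ‖v x‖)]
    rw [Real.norm_eq_abs, abs_mul, abs_of_pos hx0]
    simp only [Pi.add_apply, zpow_one]
    rw [← mul_add]
    exact mul_le_mul_of_nonneg_left (h1.trans h2) hx0.le

lemma MemL2.neg {F : Type*} [NormedAddCommGroup F] {Ω : Set Plane} {s : ℤ} {v : Plane → F}
    (hv : MemL2 Ω s v) : MemL2 Ω s (fun x => -v x) :=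
  ⟨hv.1.neg, by simpa using hv.2⟩

lemma memL2_helmholtzProj {Ω : Set Plane} (hΩ : MeasurableSet Ω) (hr : Ω ⊆ offAxis)
    {f : Plane → Plane} (hf : MemL2 Ω 1 f) (α : H1 Ω) : MemL2 Ω 1 (helmholtzProj f α) := by
  have := hf.add hΩ hr α.grad_mem.neg
  simp only [← sub_eq_add_neg] at this
  exact this

lemma IsHelmholtzPotential.orthogonal {Ω : Set Plane} (hΩ : MeasurableSet Ω) (hr : Ω ⊆ offAxis)
    {f : Plane → Plane} (hf : MemL2 Ω 1 f) {α : H1 Ω} (hα : IsHelmholtzPotential f α)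
    (β : H1 Ω) : ∫ x in Ω, x 0 * ⟪helmholtzProj f α x, β.grad x⟫ = 0 := by
  simp only [helmholtzProj, inner_sub_left, mul_sub]
  rw [integral_sub (hf.integrable_inner hΩ hr β.grad_mem)
    (α.grad_mem.integrable_inner hΩ hr β.grad_mem), hα β, sub_self]

lemma norm_sq_eq_coords (v : Plane) : ‖v‖ ^ 2 = v 0 ^ 2 + v 1 ^ 2 := by
  rw [EuclideanSpace.norm_sq_eq]; simp [Fin.sum_univ_two]

lemma inner_eq_coords (u v : Plane) : ⟪u, v⟫ = u 0 * v 0 + u 1 * v 1 := by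
  simp [PiLp.inner_apply, Fin.sum_univ_two, mul_comm]

lemma hasDerivAt_inv_add {ε r : ℝ} (h : r + ε ≠ 0) :
    HasDerivAt (fun r => (r + ε)⁻¹) (-((r + ε)⁻¹) ^ 2) r := by
  have h2 : HasDerivAt (fun t => t + ε) 1 r := by simpa using (hasDerivAt_id r).add_const ε
  refine (h2.inv h).congr_deriv ?_
  field_simp

lemma contDiffOn_inv_add {ε : ℝ} (hε : 0 < ε) :
    ContDiffOn ℝ ∞ (fun r : ℝ => (r + ε)⁻¹) (Set.Ioi 0) :=
  ContDiffOn.inv (by fun_prop) fun r hr => (add_pos hr hε).ne'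

/-- The energy estimate with truncated weight, uniform in the truncation parameter. -/
lemma weighted_energy_le {Ω : Set Plane} (hΩ : IsLipschitzDomain Ω) (hr : ∀ x ∈ Ω, 0 < x 0)
    {f : Plane → Plane} (hf1 : MemL2 Ω 1 f) (hf0 : MemL2 Ω 0 f) {α : H1 Ω}
    (hα : IsHelmholtzPotential f α) {m δ c L : ℝ} (hδ : 0 < δ)
    (hpush : ∀ (y : Plane) (t : ℝ), y 0 ≤ 2 * δ → |y 1 - c| ≤ 2 * δ → 0 ≤ t →
      y - t • dir m ∈ Ω → y ∈ Ω)
    {θ : ℝ → ℝ} (hθs : ContDiff ℝ ∞ θ) (hθ0 : ∀ x, 0 ≤ θ x) (hθ1 : ∀ x, θ x ≤ 1)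
    (hθz : ∀ x, 2 * δ < |x - c| → θ x = 0) (hL : ∀ x, |deriv θ x| ≤ L) {ε : ℝ} (hε : 0 < ε) :
    IntegrableOn (fun y => θ (y 1) ^ 2 * y 0 * (y 0 + ε)⁻¹ * ‖helmholtzProj f α y‖ ^ 2) Ω ∧
    ∫ y in Ω, θ (y 1) ^ 2 * y 0 * (y 0 + ε)⁻¹ * ‖helmholtzProj f α y‖ ^ 2
      ≤ 6 * ∫ y in Ω, (12 * ‖f y‖ ^ 2 + 48 * (L ^ 2 * α.val y ^ 2)
        + (y 0 * α.val y ^ 2 + y 0 * ‖helmholtzProj f α y‖ ^ 2) / δ ^ 2) := by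
  have hm := hΩ.1.measurableSet
  have hro : Ω ⊆ offAxis := hr
  obtain ⟨Z, hZ⟩ := hΩ.2.2.1.exists_norm_le
  -- The extra `1` gives `x 0 < τ` strictly, since stream functions are only compared on the open
  -- strip `0 < r < τ`.
  set τ : ℝ := |Z| + 1
  have hτ : 0 ≤ τ := by positivity
  have hR : ∀ x ∈ Ω, x 0 < τ := fun x hx => by
    have := (le_abs_self _).trans ((PiLp.norm_apply_le x 0).trans ((hZ x hx).trans (le_abs_self _)))
    simp only [τ]; linarith
  set G := helmholtzProj f α with hGdef
  have hG : MemL2 Ω 1 G := memL2_helmholtzProj hm hro hf1 α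
  have horth := hα.orthogonal hm hro hf1
  obtain ⟨χ, hχs, hχ0, hχ1, hχe, hχz, -⟩ := exists_cutoff 0 hδ
  simp only [sub_zero] at hχe hχz
  have hθ2s : ContDiff ℝ ∞ fun z => θ z ^ 2 := hθs.pow 2
  have hθd : ∀ z, deriv (fun z => θ z ^ 2) z = 2 * θ z * deriv θ z := fun z => by
    have := ((hθs.differentiable (by simp) z).hasDerivAt.fun_pow 2).deriv
    simpa using this
  have hθL : ∀ z, |deriv (fun z => θ z ^ 2) z| ≤ 2 * L := fun z => by
    rw [hθd, abs_mul, abs_mul, abs_of_nonneg (hθ0 z), abs_two]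
    have := hL z
    have := abs_nonneg (deriv θ z)
    nlinarith [hθ0 z, hθ1 z]
  have hθsq : ∀ z, |θ z ^ 2| ≤ 1 := fun z => by
    rw [abs_of_nonneg (sq_nonneg _)]; exact pow_le_one₀ (hθ0 z) (hθ1 z)
  have hWpos : ∀ y ∈ Ω, 0 < (y 0 + ε)⁻¹ := fun y hy => by have := hr y hy; positivity
  have hWle : ∀ y ∈ Ω, (y 0 + ε)⁻¹ ≤ ε⁻¹ := fun y hy => by
    have := hr y hy
    gcongr; linarith
  -- the multiplier of the test function
  set η : Plane → ℝ := fun y => (y 0 + ε)⁻¹ * θ (y 1) ^ 2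
  have hη : ContDiffOn ℝ ∞ η offAxis :=
    contDiffOn_mul_coords (a := fun r => (r + ε)⁻¹) (contDiffOn_inv_add hε) hθ2s
  have hηC : ∀ x ∈ Ω, |η x| ≤ ε⁻¹ := fun y hy => by
    simp only [η]
    rw [abs_mul, abs_of_pos (hWpos y hy)]
    exact (mul_le_of_le_one_right (hWpos y hy).le (hθsq _)).trans (hWle y hy)
  have hηd : ∀ y ∈ Ω, ∀ v, fderiv ℝ η y v = -((y 0 + ε)⁻¹) ^ 2 * v 0 * θ (y 1) ^ 2
      + (y 0 + ε)⁻¹ * (2 * θ (y 1) * deriv θ (y 1) * v 1) := fun y hy v => by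
    have hd := hasDerivAt_inv_add (ε := ε) (r := y 0) (by have := hr y hy; positivity)
    have := fderiv_mul_coords (a := fun r => (r + ε)⁻¹) (b := fun z => θ z ^ 2) (y := y)
      hd.differentiableAt (hθ2s.differentiable (by simp) _) v
    rw [hd.deriv, hθd] at this
    exact this
  have hηC' : ∀ i, ∀ y ∈ Ω, |fderiv ℝ η y (EuclideanSpace.single i 1)|
      ≤ ε⁻¹ ^ 2 + ε⁻¹ * (2 * L) := by
    intro i y hy
    rw [hηd y hy]
    have hL0 : 0 ≤ L := (abs_nonneg _).trans (hL 0)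
    have h1 : ((y 0 + ε)⁻¹) ^ 2 ≤ ε⁻¹ ^ 2 := pow_le_pow_left₀ (hWpos y hy).le (hWle y hy) 2
    have h2 := hθsq (y 1)
    have h3 := hθL (y 1)
    rw [hθd] at h3
    fin_cases i
    · have : |((y 0 + ε)⁻¹) ^ 2 * θ (y 1) ^ 2| ≤ ε⁻¹ ^ 2 := by
        rw [abs_mul, abs_of_nonneg (sq_nonneg (y 0 + ε)⁻¹)]
        exact (mul_le_of_le_one_right (sq_nonneg _) h2).trans h1
      have h4 : 0 ≤ ε⁻¹ * (2 * L) := by positivity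
      simp only [Fin.zero_eta, PiLp.single_apply]
      simp only [if_true, mul_one, one_ne_zero, if_false, mul_zero, add_zero, neg_mul, abs_neg]
      linarith
    · have : |(y 0 + ε)⁻¹ * (2 * θ (y 1) * deriv θ (y 1))| ≤ ε⁻¹ * (2 * L) := by
        rw [abs_mul, abs_of_pos (hWpos y hy)]
        exact mul_le_mul (hWle y hy) h3 (abs_nonneg _) (by positivity)
      have h4 : 0 ≤ ε⁻¹ ^ 2 := by positivity
      simp only [Fin.mk_one, PiLp.single_apply]
      simp only [zero_ne_one, if_false, mul_zero, zero_mul, zero_add, if_true, mul_one]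
      linarith
  -- The truncation by `ε` keeps `η` and its gradient bounded, so `ηα` is admissible in the
  -- orthogonality relation.
  obtain ⟨β, hβ⟩ := α.exists_mul hm hro hη hηC hηC'
  have hβ0 := horth β
  have hβi : IntegrableOn (fun y => y 0 * ⟪G y, β.grad y⟫) Ω :=
    hG.integrable_inner hm hro β.grad_mem
  -- the multiplier of the localized part
  set a : ℝ → ℝ := fun r => χ r * -((r + ε)⁻¹) ^ 2
  have hχabs : ∀ r, |χ r| ≤ 1 := fun r => by rw [abs_of_nonneg (hχ0 r)]; exact hχ1 r
  have ha : ContDiffOn ℝ ∞ a (Set.Ioi 0) := hχs.contDiffOn.mul ((contDiffOn_inv_add hε).pow 2).neg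
  have haC : ∀ y ∈ Ω, |a (y 0)| ≤ ε⁻¹ ^ 2 := fun y hy => by
    simp only [a]
    rw [abs_mul, abs_neg, abs_of_nonneg (sq_nonneg (y 0 + ε)⁻¹)]
    exact (mul_le_of_le_one_left (sq_nonneg _) (hχabs _)).trans
      (pow_le_pow_left₀ (hWpos y hy).le (hWle y hy) 2)
  set κ : Plane → ℝ := fun y => a (y 0) * θ (y 1) ^ 2
  have hκ : ContDiffOn ℝ ∞ κ offAxis := contDiffOn_mul_coords ha hθ2s
  have hκC : ∀ x ∈ Ω, |κ x| ≤ ε⁻¹ ^ 2 := fun y hy => by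
    simp only [κ]
    rw [abs_mul]
    exact (mul_le_of_le_one_right (abs_nonneg _) (hθsq _)).trans (haC y hy)
  have hκd : ∀ y ∈ Ω, fderiv ℝ κ y (EuclideanSpace.single 1 1)
      = a (y 0) * (2 * θ (y 1) * deriv θ (y 1)) := fun y hy => by
    have hda : DifferentiableAt ℝ a (y 0) :=
      (ha.contDiffAt (Ioi_mem_nhds (hr y hy))).differentiableAt (by simp)
    have := fderiv_mul_coords (a := a) (b := fun z => θ z ^ 2) (y := y)
      hda (hθ2s.differentiable (by simp) _) (EuclideanSpace.single 1 1)
    rw [hθd] at this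
    simpa using this
  have hκC' : ∀ x ∈ Ω, |fderiv ℝ κ x (EuclideanSpace.single 1 1)| ≤ ε⁻¹ ^ 2 * (2 * L) :=
    fun y hy => by
      have h3 := hθL (y 1)
      rw [hθd] at h3
      rw [hκd y hy, abs_mul]
      exact mul_le_mul (haC y hy) h3 (abs_nonneg _) (by positivity)
  have hp : ∀ (t : ℝ) y, 0 ≤ t → y ∈ tsupport κ → y - t • dir m ∈ Ω → y ∈ Ω := by
    intro t y ht hy hyΩ
    have := tsupport_mul_coords_subset (a := a) (b := fun z => θ z ^ 2) (c := c) (ρ := 2 * δ)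
      (fun r h => by simp [a, hχz r h]) (fun z h => by simp [hθz z h]) hy
    exact hpush y t ((le_abs_self _).trans this.1) this.2 ht hyΩ
  have hk := halfL2_cutoff hm hro α.val_mem hκ hκC
  have hk1 := (memL2_cutoff_grad hm hro α hκ hκC 1 hκC').halfL2 hm hro
  set k : Plane → ℝ := Ω.indicator fun y => κ y * α.val y
  set k1 : Plane → ℝ := Ω.indicator fun y => κ y * α.grad y 1
    + fderiv ℝ κ y (EuclideanSpace.single 1 1) * α.val y
  -- Integration by parts in `z` for the singular term near the axis, `k = χ ∂_r η α`. It is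
  -- available only for the push direction `m`, because `k` does not vanish on `∂Ω`.
  have hflux := integral_flux_mul hΩ.1 hro hτ (fun x hx => (hR x hx).le) hG horth hk hk1
    (TransGrad.of_isWeakGrad hm hro hro α.weak α.val_mem α.grad_mem hκ hp 1)
    fun y hy => (hR y (Set.mem_of_indicator_ne_zero hy)).le
  set ψ := stream Ω G 0 τ with hψ
  have hA := halfL2_stream_aux hm hro hG 0
  have hψk1 : Integrable fun y => ψ y * k1 y := integrable_bwd_mul hA hk1 0 τ
  have hFk : Integrable fun y => flux Ω G 0 y * k y := (halfL2_flux hm hro hG 0).integrable_mul hk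
  -- The stream function in direction `(1, m)` is replaced by the one in direction `(1, 0)`, to
  -- which the Hardy inequality applies.
  have hflux' : ∫ y in Ω, flux Ω G 0 y * k y = ∫ y in Ω, ψ y * k1 y := by
    rw [setIntegral_eq_integral_of_forall_compl_eq_zero fun y hy => by simp [k, hy],
      setIntegral_eq_integral_of_forall_compl_eq_zero fun y hy => by simp [k1, hy], hflux]
    refine integral_congr_ae ?_
    filter_upwards [stream_ae_eq hΩ.1 hΩ.2.2.1 hro hτ (fun x hx => (hR x hx).le) hG horth m]
      with y hy
    by_cases hyΩ : y ∈ Ω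
    · rw [hy ⟨hr y hyΩ, hR y hyΩ⟩]
    · simp [k1, hyΩ]
  -- the energy densities
  set Y : Plane → ℝ := fun y => θ (y 1) ^ 2 * y 0 * (y 0 + ε)⁻¹ * ‖G y‖ ^ 2
  have hθc : Continuous fun y : Plane => θ (y 1) := hθs.continuous.comp (by fun_prop)
  have hc0 : Continuous fun y : Plane => y 0 := by fun_prop
  have hWm : Measurable fun y : Plane => (y 0 + ε)⁻¹ := by fun_prop
  have hYnn : ∀ y ∈ Ω, 0 ≤ Y y := fun y hy => by
    have := hr y hy; simp only [Y]; positivity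
  have hYi : IntegrableOn Y Ω := by
    refine (hG.2.const_mul ε⁻¹).mono' ?_ ?_
    · exact ((((hθc.measurable.pow_const 2).mul hc0.measurable).mul hWm).aestronglyMeasurable).mul
        (hG.1.norm.pow 2)
    · filter_upwards [ae_restrict_mem hm] with y hy
      rw [Real.norm_eq_abs, abs_of_nonneg (hYnn y hy), zpow_one]
      have h1 := hWle y hy
      have h2 := hθsq (y 1)
      rw [abs_of_nonneg (sq_nonneg _)] at h2
      have h3 := hr y hy
      have h4 := hWpos y hy
      calc Y y = (θ (y 1) ^ 2 * (y 0 + ε)⁻¹) * (y 0 * ‖G y‖ ^ 2) := by simp only [Y]; ring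
        _ ≤ (1 * ε⁻¹) * (y 0 * ‖G y‖ ^ 2) := by gcongr
        _ = _ := by ring
  set X : Plane → ℝ := fun y => θ (y 1) ^ 2 * ψ y ^ 2 * ((y 0 + ε)⁻¹) ^ 3 / y 0
  have hXnn : ∀ y ∈ Ω, 0 ≤ X y := fun y hy => by
    have := hr y hy; have := hWpos y hy; simp only [X]; positivity
  have hψm : AEStronglyMeasurable ψ volume := aestronglyMeasurable_bwd hA.meas 0 τ
  have hXm : AEStronglyMeasurable X (volume.restrict Ω) := by
    have h1 : AEMeasurable X (volume.restrict Ω) :=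
      ((((hθc.measurable.pow_const 2).aemeasurable.mul (hψm.aemeasurable.restrict.pow_const 2)).mul
        (hWm.pow_const 3).aemeasurable).div hc0.measurable.aemeasurable)
    exact h1.aestronglyMeasurable
  have hYl : ∫⁻ y in Ω, ENNReal.ofReal (1 / 2 * Y y) = ENNReal.ofReal (1 / 2 * ∫ y in Ω, Y y) := by
    rw [← integral_const_mul, ofReal_integral_eq_lintegral_ofReal (hYi.const_mul _)]
    filter_upwards [ae_restrict_mem hm] with y hy
    have := hYnn y hy
    simp only [Pi.zero_apply]; positivity
  -- With `m = 0` the stream function is the radial integral of `r G_z`, so only that component of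
  -- `G` enters on the right.
  have hXl : ∫⁻ y in Ω, ENNReal.ofReal (X y) ≤ ENNReal.ofReal (1 / 2 * ∫ y in Ω, Y y) := by
    calc ∫⁻ y in Ω, ENNReal.ofReal (X y)
        = ∫⁻ y in Ω, ENNReal.ofReal (θ (y 1) ^ 2 / (y 0 * (y 0 + ε) ^ 3)) * ‖ψ y‖ₑ ^ 2 := by
          refine setLIntegral_congr_fun hm fun y hy => ?_
          have := hr y hy
          have h1 : 0 < y 0 + ε := by positivity
          rw [← enorm_pow, Real.enorm_of_nonneg (sq_nonneg (ψ y)),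
            ← ENNReal.ofReal_mul (by positivity)]
          congr 1
          simp only [X]
          field_simp
      _ ≤ ∫⁻ y in {x : Plane | 0 < x 0 ∧ x 0 ≤ τ},
            ENNReal.ofReal (θ (y 1) ^ 2 / (y 0 * (y 0 + ε) ^ 3)) * ‖ψ y‖ₑ ^ 2 :=
          lintegral_mono_set fun y hy => ⟨hr y hy, (hR y hy).le⟩
      _ ≤ _ := lintegral_bwd_weighted_le hA hτ hε hθs.continuous
      _ = ∫⁻ y in Ω, ENNReal.ofReal (θ (y 1) ^ 2 / (2 * (y 0 * (y 0 + ε))))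
            * ‖flux Ω G 1 y + -0 * flux Ω G 0 y‖ₑ ^ 2 := by
          rw [← lintegral_indicator measurableSet_offAxis, ← lintegral_indicator hm]
          congr 1; ext y
          by_cases hy : y ∈ Ω
          · simp [hy, hro hy]
          · simp [hy, flux, Set.indicator]
      _ ≤ ∫⁻ y in Ω, ENNReal.ofReal (1 / 2 * Y y) := by
          refine setLIntegral_mono' hm fun y hy => ?_
          have h0 := hr y hy
          have h1 : 0 < y 0 + ε := by positivity
          rw [← enorm_pow, Real.enorm_of_nonneg (sq_nonneg _),
            ← ENNReal.ofReal_mul (by positivity)]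
          refine ENNReal.ofReal_le_ofReal ?_
          simp only [flux, Set.indicator_of_mem hy, Y, norm_sq_eq_coords]
          have e : θ (y 1) ^ 2 / (2 * (y 0 * (y 0 + ε))) * (y 0 * G y 1 + -0 * (y 0 * G y 0)) ^ 2
              = 1 / 2 * (θ (y 1) ^ 2 * y 0 * (y 0 + ε)⁻¹ * G y 1 ^ 2) := by
            field_simp; ring
          rw [e]
          gcongr
          nlinarith [sq_nonneg (G y 0)]
      _ = _ := hYl
  have hXi : IntegrableOn X Ω := by
    refine ⟨hXm, ?_⟩
    rw [hasFiniteIntegral_iff_ofReal]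
    · exact hXl.trans_lt ENNReal.ofReal_lt_top
    · filter_upwards [ae_restrict_mem hm] with y hy using hXnn y hy
  have hYint : 0 ≤ ∫ y in Ω, Y y := setIntegral_nonneg hm hYnn
  have hX : ∫ y in Ω, X y ≤ 1 / 2 * ∫ y in Ω, Y y := by
    rw [integral_eq_lintegral_of_nonneg_ae _ hXm]
    · exact ENNReal.toReal_le_of_le_ofReal (by positivity) hXl
    · filter_upwards [ae_restrict_mem hm] with y hy using hXnn y hy
  have hα0 := α.memL2_zero hΩ hr
  set M : Plane → ℝ := fun y => 12 * ‖f y‖ ^ 2 + 48 * (L ^ 2 * α.val y ^ 2)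
        + (y 0 * α.val y ^ 2 + y 0 * ‖G y‖ ^ 2) / δ ^ 2
  have hMi : IntegrableOn M Ω := by
    have i1 : IntegrableOn (fun y => ‖f y‖ ^ 2) Ω := by simpa using hf0.2
    have i2 : IntegrableOn (fun y => α.val y ^ 2) Ω := by simpa using hα0.2
    have i3 : IntegrableOn (fun y => y 0 * α.val y ^ 2) Ω := by simpa using α.val_mem.2
    have i4 : IntegrableOn (fun y => y 0 * ‖G y‖ ^ 2) Ω := by simpa using hG.2
    exact ((i1.const_mul _).add ((i2.const_mul _).const_mul _)).add ((i3.add i4).div_const _)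
  have i1 : IntegrableOn (fun y => Y y + y 0 * ⟪G y, β.grad y⟫) Ω := hYi.add hβi
  have i2 : IntegrableOn (fun y => Y y + y 0 * ⟪G y, β.grad y⟫ - flux Ω G 0 y * k y) Ω :=
    i1.sub hFk.integrableOn
  have i3 : IntegrableOn (fun y => 5 / 12 * Y y + 5 / 6 * X y) Ω :=
    (hYi.const_mul _).add (hXi.const_mul _)
  -- The added terms integrate to zero: the first by orthogonality to `∇β`, the other two by the
  -- stream function identity. Pointwise they cancel `|G|²` in favour of `f·G` and exchange the
  -- near-axis part of the singular term for one with `ψ`.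
  have hTint : ∫ y in Ω, (Y y + y 0 * ⟪G y, β.grad y⟫ - flux Ω G 0 y * k y + ψ y * k1 y)
      = ∫ y in Ω, Y y := by
    rw [integral_add i2 hψk1.integrableOn, integral_sub i1 hFk.integrableOn, integral_add hYi hβi, hβ0, hflux']
    ring
  have hle : ∫ y in Ω, (Y y + y 0 * ⟪G y, β.grad y⟫ - flux Ω G 0 y * k y + ψ y * k1 y)
      ≤ ∫ y in Ω, (5 / 12 * Y y + 5 / 6 * X y + M y) := by
    refine setIntegral_mono_on (i2.add hψk1.integrableOn) (i3.add hMi) hm fun y hy => ?_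
    have h0 := hr y hy
    have h1 : y 0 * (y 0 + ε)⁻¹ ≤ 1 := by
      rw [← div_eq_mul_inv, div_le_one (by positivity)]; linarith
    have key := energy_pointwise (r := y 0) (W := (y 0 + ε)⁻¹) (θ := θ (y 1)) (θ' := deriv θ (y 1))
      (χ := χ (y 0)) (ψ := ψ y) (a := α.val y) (L := L) (δ := δ) (G0 := G y 0) (G1 := G y 1)
      (f0 := f y 0) (f1 := f y 1) h0 (hWpos y hy) h1 (hθ0 _) (hθ1 _) (hL _) (hχ0 _) (hχ1 _) hδ
      (fun h => hχe _ (by rwa [abs_of_pos h0]))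
    have eG : ∀ i, α.grad y i = f y i - G y i := fun i => by simp [hGdef, helmholtzProj]
    simp only [k, k1, flux, Set.indicator_of_mem hy, inner_eq_coords, hβ, hηd y hy, hκd y hy, eG,
      Y, X, M, norm_sq_eq_coords]
    simp only [PiLp.single_apply, η, κ, a]
    simp only [if_true, zero_ne_one, one_ne_zero, if_false]
    refine le_trans (le_of_eq ?_) key
    ring
  rw [hTint, integral_add i3 hMi,
    integral_add (hYi.const_mul _) (hXi.const_mul _), integral_const_mul, integral_const_mul] at hle
  -- Absorption: `5/12 + 5/6 * 1/2 = 5/6` of the energy returns on the right, which leaves the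
  -- factor `6`.
  exact ⟨hYi, by linarith⟩

/-- The Helmholtz projection of a square integrable field is square integrable. -/
lemma memL2_zero_helmholtzProj {Ω : Set Plane} (hΩ : IsLipschitzDomain Ω)
    (hr : ∀ x ∈ Ω, 0 < x 0) {f : Plane → Plane} (hf1 : MemL2 Ω 1 f) (hf0 : MemL2 Ω 0 f)
    {α : H1 Ω} (hα : IsHelmholtzPotential f α) : MemL2 Ω 0 (helmholtzProj f α) := by
  have hm := hΩ.1.measurableSet
  have hG := memL2_helmholtzProj hm hr hf1 α
  refine memL2_zero_of_local hΩ.1 hΩ.2.2.1 hr hG fun x hx hx0 => ?_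
  obtain ⟨m, δ₀, hδ₀, hpush⟩ := hΩ.exists_push hr hx hx0
  set δ := δ₀ / 3
  have hδ : 0 < δ := by positivity
  have hδ2 : 2 * δ < δ₀ := by simp only [δ]; linarith
  obtain ⟨θ, hθs, hθ0, hθ1, hθe, hθz, L, hL⟩ := exists_cutoff (x 1) hδ
  have key := fun ε (hε : 0 < ε) => weighted_energy_le hΩ hr hf1 hf0 hα hδ
    (fun y t h0 h1 => hpush y t (h0.trans_lt hδ2) (h1.trans_lt hδ2)) hθs hθ0 hθ1 hθz hL hε
  set I := 6 * ∫ y in Ω, (12 * ‖f y‖ ^ 2 + 48 * (L ^ 2 * α.val y ^ 2)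
        + (y 0 * α.val y ^ 2 + y 0 * ‖helmholtzProj f α y‖ ^ 2) / δ ^ 2)
  set G := helmholtzProj f α
  refine ⟨δ, hδ, ?_⟩
  set S := Ω ∩ {y : Plane | y 0 < δ ∧ |y 1 - x 1| < δ}
  have hc0 : Continuous fun x : Plane => x 0 := by fun_prop
  have hc1 : Continuous fun y : Plane => |y 1 - x 1| := by fun_prop
  have hS : MeasurableSet S := hm.inter ((isOpen_lt hc0 continuous_const).inter
        (isOpen_lt hc1 continuous_const)).measurableSet
  -- The same `ε n` truncates the weight and cuts off the axis: where `r > ε n`, the weight `r / (r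
  -- + ε n)` exceeds `1/2`. The energy bound is independent of `n`, so exhausting the set gives
  -- integrability up to the axis.
  set ε : ℕ → ℝ := fun n => 1 / (n + 1)
  have hεpos : ∀ n, 0 < ε n := fun n => by positivity
  have hV : ∀ n, MeasurableSet {y : Plane | ε n < y 0} := fun n =>
    (isOpen_lt continuous_const hc0).measurableSet
  have hcover : AECover (volume.restrict S) Filter.atTop fun n => {y : Plane | ε n < y 0} := by
    refine ⟨?_, hV⟩
    filter_upwards [ae_restrict_mem hS] with y hy
    exact tendsto_one_div_add_atTop_nhds_zero_nat.eventually_lt_const (hr y hy.1)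
  have hbd : ∀ n, ∀ y ∈ S ∩ {y : Plane | ε n < y 0}, ‖G y‖ ^ 2
      ≤ 2 * (θ (y 1) ^ 2 * y 0 * (y 0 + ε n)⁻¹ * ‖G y‖ ^ 2) := by
    intro n y hy
    have h0 := hr y hy.1.1
    have h1 : ε n < y 0 := hy.2
    rw [hθe _ hy.1.2.2.le]
    have h2 : 1 ≤ 2 * (y 0 * (y 0 + ε n)⁻¹) := by
      have := hεpos n
      rw [← div_eq_mul_inv, mul_div_assoc', le_div_iff₀ (by positivity)]; linarith
    nlinarith [sq_nonneg ‖G y‖]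
  have hSV : ∀ n, S ∩ {y : Plane | ε n < y 0} ⊆ Ω := fun n y hy => hy.1.1
  have hint : ∀ n, IntegrableOn (fun y => ‖G y‖ ^ 2) (S ∩ {y : Plane | ε n < y 0}) := by
    intro n
    refine (((key (ε n) (hεpos n)).1.mono_set (hSV n)).const_mul 2).mono'
      ((hG.1.mono_set (hSV n)).norm.pow 2) ?_
    filter_upwards [ae_restrict_mem (hS.inter (hV n))] with y hy
    rw [Real.norm_eq_abs, abs_of_nonneg (sq_nonneg _)]
    exact hbd n y hy
  refine hcover.integrable_of_integral_norm_bounded (2 * I) (fun n => ?_)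
    (Filter.Eventually.of_forall fun n => ?_)
  · have := hint n
    rwa [Set.inter_comm, IntegrableOn, ← Measure.restrict_restrict (hV n)] at this
  · rw [Measure.restrict_restrict (hV n), Set.inter_comm]
    obtain ⟨k1, k2⟩ := key (ε n) (hεpos n)
    calc ∫ y in S ∩ {y : Plane | ε n < y 0}, ‖‖G y‖ ^ 2‖
        = ∫ y in S ∩ {y : Plane | ε n < y 0}, ‖G y‖ ^ 2 := by simp
      _ ≤ ∫ y in S ∩ {y : Plane | ε n < y 0},
            2 * (θ (y 1) ^ 2 * y 0 * (y 0 + ε n)⁻¹ * ‖G y‖ ^ 2) :=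
          setIntegral_mono_on (hint n) ((k1.mono_set (hSV n)).const_mul 2) (hS.inter (hV n)) (hbd n)
      _ ≤ ∫ y in Ω, 2 * (θ (y 1) ^ 2 * y 0 * (y 0 + ε n)⁻¹ * ‖G y‖ ^ 2) := by
          refine setIntegral_mono_set (k1.const_mul 2) ?_ (hSV n).eventuallyLE
          filter_upwards [ae_restrict_mem hm] with y hy
          have := hr y hy
          have := hεpos n
          simp only [Pi.zero_apply]; positivity
      _ ≤ 2 * I := by rw [integral_const_mul]; linarith

/-! ### Plane geometry of triangles -/

/-- The cross product of two plane vectors. -/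
def cross (u v : Plane) : ℝ := u 0 * v 1 - u 1 * v 0

lemma cross_add_right (u v w : Plane) : cross u (v + w) = cross u v + cross u w := by
  simp [cross]; ring

lemma cross_sub_right (u v w : Plane) : cross u (v - w) = cross u v - cross u w := by
  simp [cross]; ring

lemma cross_smul_right (u v : Plane) (c : ℝ) : cross u (c • v) = c * cross u v := by
  simp [cross]; ring

lemma cross_neg_left (u v : Plane) : cross (-u) v = -cross u v := by
  simp [cross]; ring

lemma cross_self (u : Plane) : cross u u = 0 := by
  simp [cross]; ring

@[fun_prop]
lemma continuous_cross (u : Plane) : Continuous (cross u) := by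
  unfold cross; fun_prop

lemma abs_cross_le (u v : Plane) : |cross u v| ≤ ‖u‖ * ‖v‖ := by
  refine abs_le_of_sq_le_sq ?_ (by positivity)
  rw [mul_pow, norm_sq_eq_coords, norm_sq_eq_coords, cross]
  nlinarith [sq_nonneg (u 0 * v 0 + u 1 * v 1)]

/-- Inner products with a normal of `u` are multiples of cross products with `u`. -/
lemma exists_inner_eq_cross {u n : Plane} (hu : u ≠ 0) (h : ⟪u, n⟫ = 0) :
    ∃ μ : ℝ, ∀ v, ⟪v, n⟫ = μ * cross u v := by
  have hu2 : u 0 ^ 2 + u 1 ^ 2 ≠ 0 := by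
    rw [← norm_sq_eq_coords]; exact pow_ne_zero 2 (norm_ne_zero_iff.2 hu)
  refine ⟨cross u n / (u 0 ^ 2 + u 1 ^ 2), fun v => ?_⟩
  rw [inner_eq_coords] at h ⊢
  rw [div_mul_eq_mul_div, eq_div_iff hu2, cross, cross]
  linear_combination (v 0 * u 0 + v 1 * u 1) * h

lemma isCompact_hull (K : Finset Plane) : IsCompact (convexHull ℝ (K : Set Plane)) :=
  K.finite_toSet.isCompact_convexHull ℝ

namespace Triangulation

variable {Ω : Set Plane} (T : Triangulation Ω)

lemma mem_triangles {K : Finset Plane} : K ∈ T.triangles ↔ K ∈ T.faces ∧ K.card = 3 := by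
  simp [triangles]

/-- Parallel edge vectors would make the three affinely independent vertices collinear. -/
lemma exists_vertices {K : Finset Plane} (hK : K ∈ T.triangles) : ∃ N₀ N₁ N₂ : Plane,
    K = {N₀, N₁, N₂} ∧ N₀ ≠ N₁ ∧ N₀ ≠ N₂ ∧ N₁ ≠ N₂ ∧ cross (N₁ - N₀) (N₂ - N₀) ≠ 0 := by
  obtain ⟨hf, hc⟩ := T.mem_triangles.1 hK
  obtain ⟨N₀, N₁, N₂, h01, h02, h12, rfl⟩ := Finset.card_eq_three.1 hc
  refine ⟨N₀, N₁, N₂, rfl, h01, h02, h12, fun h0 => ?_⟩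
  have hi := T.indep hf
  have hcol : Collinear ℝ ({N₀, N₁, N₂} : Set Plane) := by
    rw [collinear_iff_of_mem (p₀ := N₀) (by simp)]
    refine ⟨N₁ - N₀, fun p hp => ?_⟩
    simp only [Set.mem_insert_iff, Set.mem_singleton_iff] at hp
    rcases hp with rfl | rfl | rfl
    · exact ⟨0, by simp⟩
    · exact ⟨1, by simp⟩
    · set u := N₁ - N₀ with hu
      set v := p - N₀ with hv
      have hu2 : u 0 ^ 2 + u 1 ^ 2 ≠ 0 := by
        rw [← norm_sq_eq_coords]
        exact pow_ne_zero 2 (norm_ne_zero_iff.2 (sub_ne_zero.2 h01.symm))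
      refine ⟨(u 0 * v 0 + u 1 * v 1) / (u 0 ^ 2 + u 1 ^ 2), ?_⟩
      have hv' : v = ((u 0 * v 0 + u 1 * v 1) / (u 0 ^ 2 + u 1 ^ 2)) • u := by
        rw [cross] at h0
        ext i
        fin_cases i
        · simp only [Fin.zero_eta, PiLp.smul_apply, smul_eq_mul]
          rw [div_mul_eq_mul_div, eq_div_iff hu2]
          linear_combination (-(u 1)) * h0
        · simp only [Fin.mk_one, PiLp.smul_apply, smul_eq_mul]
          rw [div_mul_eq_mul_div, eq_div_iff hu2]
          linear_combination (u 0) * h0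
      rw [← hv', hv]; simp
  have hncol := (affineIndependent_iff_not_collinear (k := ℝ) (p := ![N₀, N₁, N₂])).1 (by
    let e : Fin 3 ↪ (({N₀, N₁, N₂} : Finset Plane)) :=
      ⟨![⟨N₀, by simp⟩, ⟨N₁, by simp⟩, ⟨N₂, by simp⟩], by
        intro i j hij
        fin_cases i <;> fin_cases j <;> simp_all⟩
    have e2 : ![N₀, N₁, N₂] = (fun x : ({N₀, N₁, N₂} : Finset Plane) => (x : Plane)) ∘ e := by
      funext i; fin_cases i <;> rfl
    rw [e2]
    exact hi.comp_embedding e)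
  apply hncol
  have e3 : Set.range ![N₀, N₁, N₂] = {N₀, N₁, N₂} := by
    ext p; simp [eq_comm]; tauto
  rw [e3]
  exact hcol

/-- The mesh fills only the closure of `Ω`, so a domain with a slit has to be excluded. At a
boundary point of a Lipschitz domain, points just below the graph have a neighbourhood disjoint from
`Ω`, so the boundary point is not interior to the closure. -/
lemma interior_hull_subset (hΩ : IsLipschitzDomain Ω) {K : Finset Plane} (hK : K ∈ T.triangles) :
    interior (convexHull ℝ (K : Set Plane)) ⊆ Ω := by
  have h1 : convexHull ℝ (K : Set Plane) ⊆ closure Ω := by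
    rw [← T.space_eq]
    exact Geometry.SimplicialComplex.convexHull_subset_space (T.mem_triangles.1 hK).1
  intro x hx
  by_contra hxΩ
  have hxc : x ∈ interior (closure Ω) := interior_mono h1 hx
  have hxf : x ∈ frontier Ω := by
    rw [frontier, hΩ.1.interior_eq]
    exact ⟨interior_subset hxc, hxΩ⟩
  obtain ⟨e, U, γ, L, hU, hxU, hγ, hiff⟩ := hΩ.2.2.2 x hxf
  set A := e.toRealAffineIsometryEquiv
  have hAe : ∀ y, A y = e y := fun y => by simp [A]
  have hge : e x 1 ≤ γ (e x 0) := not_lt.1 fun h => hxΩ ((hiff x hxU).2 h)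
  have hec : Continuous fun y => e y := e.continuous
  have hlow : IsOpen {y | e y 1 < γ (e y 0)} :=
    isOpen_lt (by fun_prop) (hγ.continuous.comp (by fun_prop))
  have hdisj : Disjoint (U ∩ {y | e y 1 < γ (e y 0)}) (closure Ω) := by
    refine Disjoint.closure_right ?_ (hU.inter hlow)
    rw [Set.disjoint_left]
    rintro y ⟨hyU, hy⟩ hyΩ
    exact lt_asymm hy ((hiff y hyU).1 hyΩ)
  -- points slightly below the graph
  set p : ℝ → Plane := fun t => e.symm (e x - t • EuclideanSpace.single 1 1)
  have hp : Continuous p := e.symm.continuous.comp (by fun_prop)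
  have hp0 : p 0 = x := by simp [p]
  have hnhd : ∀ᶠ t in nhds (0:ℝ), p t ∈ U ∩ interior (closure Ω) :=
    hp.continuousAt.eventually_mem (by
      rw [hp0]; exact (hU.inter isOpen_interior).mem_nhds ⟨hxU, hxc⟩)
  obtain ⟨t, ht0, ht⟩ := ((hnhd.filter_mono nhdsWithin_le_nhds).and
    (self_mem_nhdsWithin (s := Set.Ioi (0:ℝ)))).exists
  have h2 : e (p t) = e x - t • EuclideanSpace.single 1 1 := by simp [p]
  refine Set.disjoint_left.1 hdisj ⟨ht0.1, ?_⟩ (interior_subset ht0.2)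
  simp only [Set.mem_ofPred_eq, h2]
  have : (0:ℝ) < t := ht
  simp
  linarith

/-- Conformity places the intersection in the hull of the common vertices. Nonempty interior would
need three affinely independent common vertices, which forces the triangles to coincide. -/
lemma disjoint_interior {K K' : Finset Plane} (hK : K ∈ T.triangles) (hK' : K' ∈ T.triangles)
    (hne : K ≠ K') : Disjoint (interior (convexHull ℝ (K : Set Plane)))
      (interior (convexHull ℝ (K' : Set Plane))) := by
  obtain ⟨hf, hc⟩ := T.mem_triangles.1 hK
  obtain ⟨hf', hc'⟩ := T.mem_triangles.1 hK'
  rw [Set.disjoint_iff_inter_eq_empty, ← interior_inter]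
  refine Set.eq_empty_of_subset_empty ((interior_mono (T.inter_subset_convexHull hf hf')).trans ?_)
  by_contra hne'
  have hnon : (interior (convexHull ℝ ((K : Set Plane) ∩ K'))).Nonempty :=
    Set.nonempty_iff_ne_empty.2 fun h => hne' h.subset
  rw [interior_convexHull_nonempty_iff_affineSpan_eq_top] at hnon
  have hi : AffineIndependent ℝ ((↑) : (K ∩ K' : Finset Plane) → Plane) :=
    (T.indep hf).mono (t := (K : Set Plane)) (by simp)
  have hcard : Fintype.card (K ∩ K' : Finset Plane) = Module.finrank ℝ Plane + 1 := by
    rw [← hi.affineSpan_eq_top_iff_card_eq_finrank_add_one]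
    have e : Set.range ((↑) : (K ∩ K' : Finset Plane) → Plane) = (K : Set Plane) ∩ K' := by
      ext; simp
    rw [e]
    exact hnon
  simp only [Fintype.card_coe, finrank_euclideanSpace, Fintype.card_fin] at hcard
  have hKe : K ∩ K' = K := Finset.eq_of_subset_of_card_le Finset.inter_subset_left (by omega)
  have hKe' : K ∩ K' = K' := Finset.eq_of_subset_of_card_le Finset.inter_subset_right (by omega)
  exact hne (hKe.symm.trans hKe')

/-- The part of `Ω` that is missed lies on the boundaries of finitely many convex sets, which are
null sets. -/
lemma ae_eq_iUnion_interior (hΩ : IsLipschitzDomain Ω) :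
    Ω =ᵐ[volume] ⋃ K ∈ T.triangles, interior (convexHull ℝ (K : Set Plane)) := by
  have hsub : ⋃ K ∈ T.triangles, interior (convexHull ℝ (K : Set Plane)) ⊆ Ω :=
    Set.iUnion₂_subset fun K hK => T.interior_hull_subset hΩ hK
  refine Filter.EventuallyLE.antisymm ?_ hsub.eventuallyLE
  have hnull : ∀ᵐ x : Plane, ∀ K ∈ T.triangles, x ∉ frontier (convexHull ℝ (K : Set Plane)) := by
    rw [Filter.eventually_all_finset]
    intro K _
    exact measure_eq_zero_iff_ae_notMem.1 ((convex_convexHull ℝ _).addHaar_frontier volume)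
  filter_upwards [hnull] with x hx hxΩ
  have hxc : x ∈ closure Ω := subset_closure hxΩ
  rw [← T.space_eq, Geometry.SimplicialComplex.mem_space_iff] at hxc
  obtain ⟨s, hs, hxs⟩ := hxc
  obtain ⟨K, hK, hsK, hcard⟩ := T.pure s hs
  have hKt := T.mem_triangles.2 ⟨hK, hcard⟩
  have hxK : x ∈ convexHull ℝ (K : Set Plane) := convexHull_mono (by exact_mod_cast hsK) hxs
  refine Set.mem_iUnion₂.2 ⟨K, hKt, ?_⟩
  by_contra hni
  exact hx K hKt ⟨subset_closure hxK, hni⟩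

lemma sum_indicator_eq {K : Finset Plane} (hK : K ∈ T.triangles) (s : Finset Plane → ℝ) {x : Plane}
    (hx : x ∈ interior (convexHull ℝ (K : Set Plane))) :
    ∑ K ∈ T.triangles, (interior (convexHull ℝ (K : Set Plane))).indicator (fun _ => s K) x
      = s K := by
  rw [Finset.sum_eq_single_of_mem K hK, Set.indicator_of_mem hx]
  intro K' hK' hne
  exact Set.indicator_of_notMem (Set.disjoint_left.1 (T.disjoint_interior hK hK' hne.symm) hx) _

/-- Triangle-wise functions glue to a function on the plane. -/
lemma exists_glue {F : Type*} [Inhabited F] (P : Finset Plane → Plane → F) : ∃ R : Plane → F,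
    ∀ K ∈ T.triangles, Set.EqOn R (P K) (interior (convexHull ℝ (K : Set Plane))) := by
  classical
  refine ⟨fun x => if h : ∃ K ∈ T.triangles, x ∈ interior (convexHull ℝ (K : Set Plane))
    then P h.choose x else default, fun K hK x hx => ?_⟩
  have h : ∃ K ∈ T.triangles, x ∈ interior (convexHull ℝ (K : Set Plane)) := ⟨K, hK, hx⟩
  have hKe : h.choose = K := by
    by_contra hne
    exact Set.disjoint_left.1 (T.disjoint_interior h.choose_spec.1 hK hne) h.choose_spec.2 hx
  simp only [dif_pos h, hKe]

end Triangulation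

/-! ### Edge moments and the local interpolants -/

/-- The weighted flux `∫₀¹ (M - N) × F(N + t(M - N)) (a + b t) dt` across the edge from `N` to
`M`. -/
noncomputable def edgeMoment (a b : ℝ) (F : Plane → Plane) (N M : Plane) : ℝ :=
  ∫ t in (0 : ℝ)..1, cross (M - N) (F (AffineMap.lineMap N M t)) * (a + b * t)

lemma edgeMoment_self (a b : ℝ) (F : Plane → Plane) (N : Plane) : edgeMoment a b F N N = 0 := by
  simp [edgeMoment, cross]

lemma integral_affine_sub_mul {f : ℝ → ℝ} (hf : ContinuousOn f (Set.Icc 0 1)) (p s a b : ℝ) :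
    ∫ t in (0 : ℝ)..1, (p + t * s - f t) * (a + b * t) =
      a * p + (b * p + a * s) / 2 + b * s / 3
        - (a * (∫ t in (0 : ℝ)..1, f t) + b * ∫ t in (0 : ℝ)..1, f t * t) := by
  have hi : IntervalIntegrable f volume 0 1 :=
    ContinuousOn.intervalIntegrable (by rwa [Set.uIcc_of_le zero_le_one])
  have hi' : IntervalIntegrable (fun t => f t * t) volume 0 1 :=
    hi.mul_continuousOn (by fun_prop)
  have h1 : ∀ t : ℝ, (p + t * s - f t) * (a + b * t) =
      (a * p + (b * p + a * s) * t + b * s * t ^ 2) - (a * f t + b * (f t * t)) := fun t => by ring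
  simp_rw [h1]
  rw [intervalIntegral.integral_sub (by apply Continuous.intervalIntegrable; fun_prop)
      ((hi.const_mul a).add (hi'.const_mul b)),
    intervalIntegral.integral_add (f := fun t => a * f t) (hi.const_mul a) (hi'.const_mul b),
    intervalIntegral.integral_const_mul, intervalIntegral.integral_const_mul,
    intervalIntegral.integral_add (by apply Continuous.intervalIntegrable; fun_prop)
      (by apply Continuous.intervalIntegrable; fun_prop),
    intervalIntegral.integral_add (by apply Continuous.intervalIntegrable; fun_prop)
      (by apply Continuous.intervalIntegrable; fun_prop),
    intervalIntegral.integral_const_mul, intervalIntegral.integral_const_mul]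
  simp
  ring

lemma integral_mul_affine {f : ℝ → ℝ} (hf : ContinuousOn f (Set.Icc 0 1)) (a b : ℝ) :
    ∫ t in (0 : ℝ)..1, f t * (a + b * t) =
      a * (∫ t in (0 : ℝ)..1, f t) + b * ∫ t in (0 : ℝ)..1, f t * t := by
  have h := integral_affine_sub_mul hf 0 0 a b
  have h1 : ∀ t : ℝ, (0 + t * 0 - f t) * (a + b * t) = -(f t * (a + b * t)) := fun t => by ring
  simp_rw [h1] at h
  rw [intervalIntegral.integral_neg] at h
  linarith

lemma cross_affine_lineMap (A : Plane →ᵃ[ℝ] Plane) (u N M : Plane) (t : ℝ) :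
    cross u (A (AffineMap.lineMap N M t)) =
      cross u (A N) + t * (cross u (A M) - cross u (A N)) := by
  rw [A.apply_lineMap, AffineMap.lineMap_apply_module', cross_add_right, cross_smul_right,
    cross_sub_right]
  ring

lemma lineMap_mem_hull {K : Finset Plane} {N M : Plane} (hN : N ∈ K) (hM : M ∈ K) {t : ℝ}
    (ht : t ∈ Set.Icc (0 : ℝ) 1) : AffineMap.lineMap N M t ∈ convexHull ℝ (K : Set Plane) :=
  (convex_convexHull ℝ _).lineMap_mem (subset_convexHull ℝ _ (by simpa using hN))
    (subset_convexHull ℝ _ (by simpa using hM)) ht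

lemma continuousOn_edge {K : Finset Plane} {F : Plane → Plane}
    (hF : ContinuousOn F (convexHull ℝ (K : Set Plane))) {N M : Plane} (hN : N ∈ K) (hM : M ∈ K)
    (u : Plane) :
    ContinuousOn (fun t : ℝ => cross u (F (AffineMap.lineMap N M t))) (Set.Icc 0 1) :=
  (continuous_cross u).comp_continuousOn (hF.comp (by fun_prop) fun _ ht =>
    lineMap_mem_hull hN hM ht)

/-- The edge functional tested against a normal, in terms of cross products. -/
lemma edgeIntegral_affine_sub {K : Finset Plane} {F : Plane → Plane}
    (hF : ContinuousOn F (convexHull ℝ (K : Set Plane))) {N M : Plane} (hN : N ∈ K) (hM : M ∈ K)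
    (A : Plane →ᵃ[ℝ] Plane) {n : Plane} {μ : ℝ} (hn : ∀ v, ⟪v, n⟫ = μ * cross (M - N) v)
    (q : Plane → ℝ) (a b : ℝ) (hq : ∀ t : ℝ, q (AffineMap.lineMap N M t) = a + b * t) :
    edgeIntegral N M (fun x => ⟪A x - F x, n⟫ * q x) = dist N M * μ *
      (a * cross (M - N) (A N) + (b * cross (M - N) (A N) +
        a * (cross (M - N) (A M) - cross (M - N) (A N))) / 2 +
        b * (cross (M - N) (A M) - cross (M - N) (A N)) / 3 - edgeMoment a b F N M) := by
  have hf := continuousOn_edge hF hN hM (M - N)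
  rw [edgeMoment, integral_mul_affine hf, ← integral_affine_sub_mul hf, edgeIntegral, mul_assoc,
    ← intervalIntegral.integral_const_mul μ]
  congr 1
  refine intervalIntegral.integral_congr fun t _ => ?_
  simp only [hq, hn, cross_sub_right, cross_affine_lineMap]
  ring

/-- Reversing the edge substitutes `1 - t` for `t` and flips the normal. It yields the normal
component at the second endpoint from the formula at the first one. -/
lemma edgeMoment_swap (a b : ℝ) (F : Plane → Plane) (N M : Plane) :
    edgeMoment a b F M N = -edgeMoment (a + b) (-b) F N M := by
  rw [edgeMoment, edgeMoment, ← intervalIntegral.integral_neg]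
  have h := intervalIntegral.integral_comp_sub_left (a := 0) (b := 1)
    (fun t => cross (N - M) (F (AffineMap.lineMap M N t)) * (a + b * t)) 1
  simp only [sub_zero, sub_self] at h
  rw [← h]
  refine intervalIntegral.integral_congr fun t _ => ?_
  simp only [AffineMap.lineMap_apply_one_sub]
  rw [← neg_sub M N, cross_neg_left]
  ring

lemma cross_swap_affine {A : Plane →ᵃ[ℝ] Plane} {F : Plane → Plane} {a b : ℝ} {N M : Plane}
    (h : cross (N - M) (A M) = edgeMoment a b F M N) :
    cross (M - N) (A M) = edgeMoment (a + b) (-b) F N M := by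
  rw [edgeMoment_swap, ← neg_sub M N, cross_neg_left] at h
  linarith

/-- Affine fields with prescribed values at the vertices of a triangle. -/
lemma exists_affine_of_vertices {N₀ N₁ N₂ : Plane} (hD : cross (N₁ - N₀) (N₂ - N₀) ≠ 0)
    (v₀ v₁ v₂ : Plane) : ∃ A : Plane →ᵃ[ℝ] Plane, A N₀ = v₀ ∧ A N₁ = v₁ ∧ A N₂ = v₂ := by
  set D := cross (N₁ - N₀) (N₂ - N₀)
  let L : Plane →ₗ[ℝ] Plane :=
    { toFun := fun y => (cross y (N₂ - N₀) / D) • (v₁ - v₀) + (cross (N₁ - N₀) y / D) • (v₂ - v₀)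
      map_add' := fun x y => by simp only [cross, PiLp.add_apply]; module
      map_smul' := fun c y => by
        simp only [cross, PiLp.smul_apply, smul_eq_mul, RingHom.id_apply]; module }
  have hL : ∀ y, L y = (cross y (N₂ - N₀) / D) • (v₁ - v₀) + (cross (N₁ - N₀) y / D) • (v₂ - v₀) :=
    fun y => rfl
  refine ⟨L.toAffineMap + AffineMap.const ℝ Plane (v₀ - L N₀), ?_, ?_, ?_⟩ <;>
    simp only [AffineMap.coe_add, Pi.add_apply, LinearMap.coe_toAffineMap, AffineMap.const_apply]
  · abel
  · have : L N₁ = L (N₁ - N₀) + L N₀ := by rw [← map_add, sub_add_cancel]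
    rw [this, hL (N₁ - N₀), cross_self, div_self hD]
    simp
  · have : L N₂ = L (N₂ - N₀) + L N₀ := by rw [← map_add, sub_add_cancel]
    rw [this, hL (N₂ - N₀), cross_self, div_self hD]
    simp

/-- A vector with prescribed cross products. -/
lemma exists_cross_eq {u v : Plane} (h : cross u v ≠ 0) (a b : ℝ) :
    ∃ y, cross u y = a ∧ cross v y = b := by
  refine ⟨(cross u v)⁻¹ • (a • v - b • u), ?_, ?_⟩
  · rw [cross_smul_right, cross_sub_right, cross_smul_right, cross_smul_right, cross_self]
    field_simp
    ring
  · rw [cross_smul_right, cross_sub_right, cross_smul_right, cross_smul_right, cross_self]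
    have : cross v u = -cross u v := by simp [cross]; ring
    rw [this]
    field_simp
    ring

/-- At each vertex the two incident edges are linearly independent, so two prescribed fluxes
determine the vertex value. The value of `g` on reversed edges is free: each edge carries two
degrees of freedom, as for BDM1. -/
lemma exists_affine_of_flux {N₀ N₁ N₂ : Plane} (hD : cross (N₁ - N₀) (N₂ - N₀) ≠ 0)
    (g : Plane → Plane → ℝ) (hg : ∀ N, g N N = 0) : ∃ A : Plane →ᵃ[ℝ] Plane,
      ∀ N ∈ ({N₀, N₁, N₂} : Finset Plane), ∀ M ∈ ({N₀, N₁, N₂} : Finset Plane),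
        cross (M - N) (A N) = g N M := by
  have h1 : cross (N₀ - N₁) (N₂ - N₁) ≠ 0 := by
    have : cross (N₀ - N₁) (N₂ - N₁) = -cross (N₁ - N₀) (N₂ - N₀) := by simp [cross]; ring
    rw [this]; exact neg_ne_zero.2 hD
  have h2 : cross (N₀ - N₂) (N₁ - N₂) ≠ 0 := by
    have : cross (N₀ - N₂) (N₁ - N₂) = cross (N₁ - N₀) (N₂ - N₀) := by simp [cross]; ring
    rwa [this]
  obtain ⟨v₀, ha, hb⟩ := exists_cross_eq hD (g N₀ N₁) (g N₀ N₂)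
  obtain ⟨v₁, hc, hd⟩ := exists_cross_eq h1 (g N₁ N₀) (g N₁ N₂)
  obtain ⟨v₂, he, hf⟩ := exists_cross_eq h2 (g N₂ N₀) (g N₂ N₁)
  obtain ⟨A, h0, h1, h2⟩ := exists_affine_of_vertices hD v₀ v₁ v₂
  refine ⟨A, fun N hN M hM => ?_⟩
  simp only [Finset.mem_insert, Finset.mem_singleton] at hN hM
  have h00 : ∀ v, cross 0 v = 0 := fun v => by simp [cross]
  rcases hN with rfl | rfl | rfl <;> rcases hM with rfl | rfl | rfl <;>
    simp only [sub_self, *]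

/-- Superposition of the classical basis fields: the field that points to the vertex opposite an
edge has constant flux across that edge and none across the other two. Antisymmetry of `g` says that
each edge has a single flux. -/
lemma exists_rt0_of_flux {N₀ N₁ N₂ : Plane} (hD : cross (N₁ - N₀) (N₂ - N₀) ≠ 0)
    (g : Plane → Plane → ℝ) (hg : ∀ N M, g M N = -g N M) : ∃ A : Plane →ᵃ[ℝ] Plane,
      (∃ (a : Plane) (c : ℝ), ∀ x, A x = a + c • x) ∧
      ∀ N ∈ ({N₀, N₁, N₂} : Finset Plane), ∀ M ∈ ({N₀, N₁, N₂} : Finset Plane),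
        cross (M - N) (A N) = g N M := by
  have hg0 : ∀ N, g N N = 0 := fun N => by have := hg N N; linarith
  set D := cross (N₁ - N₀) (N₂ - N₀) with hDdef
  set c : ℝ := -D⁻¹ * (g N₀ N₁ + g N₁ N₂ + g N₂ N₀)
  set a : Plane := D⁻¹ • (g N₀ N₁ • N₂ + g N₁ N₂ • N₀ + g N₂ N₀ • N₁)
  refine ⟨AffineMap.const ℝ Plane a + c • AffineMap.id ℝ Plane, ⟨a, c, fun x => by simp⟩,
    fun N hN M hM => ?_⟩
  simp only [Finset.mem_insert, Finset.mem_singleton] at hN hM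
  have hx : ∀ x u, cross u ((AffineMap.const ℝ Plane a + c • AffineMap.id ℝ Plane) x) =
      D⁻¹ * (g N₀ N₁ * cross u (N₂ - x) + g N₁ N₂ * cross u (N₀ - x) + g N₂ N₀ * cross u (N₁ - x)) := by
    intro x u
    simp [cross, a, c]
    ring
  have e1 := hg N₀ N₁
  have e2 := hg N₁ N₂
  have e3 := hg N₂ N₀
  rw [hx, inv_mul_eq_iff_eq_mul₀ hD]
  rcases hN with rfl | rfl | rfl <;> rcases hM with rfl | rfl | rfl <;>
    simp only [e1, e2, e3, hg0, hDdef, cross, PiLp.sub_apply] <;> ring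

namespace Triangulation

variable {Ω : Set Plane} (T : Triangulation Ω)

/-- `R` is triangle-wise affine, its vertex values having the normal components given by the edge
moments of `F`. -/
def HasEdgeMoments (a b : ℝ) (F R : Plane → Plane) : Prop :=
  ∀ K ∈ T.triangles, ∃ A : Plane →ᵃ[ℝ] Plane,
    Set.EqOn R A (interior (convexHull ℝ (K : Set Plane))) ∧
    ∀ N ∈ K, ∀ M ∈ K, cross (M - N) (A N) = edgeMoment a b F N M

/-- On a shared edge the normal component is affine, and its values at both endpoints depend on `F`
only. Hence it agrees from both sides. -/
lemma exists_hdivPiecewise {Loc : Set (Plane → Plane)} (a b : ℝ) (F : Plane → Plane)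
    (A : Finset Plane → Plane →ᵃ[ℝ] Plane) (hLoc : ∀ K ∈ T.triangles, ⇑(A K) ∈ Loc)
    (hA : ∀ K ∈ T.triangles, ∀ N ∈ K, ∀ M ∈ K, cross (M - N) (A K N) = edgeMoment a b F N M) :
    ∃ R, T.IsHdivPiecewise Loc R (fun K => A K) := by
  obtain ⟨R, hR⟩ := T.exists_glue (fun K => A K)
  refine ⟨R, fun K hK => ⟨hLoc K hK, hR K hK⟩, ?_⟩
  intro K hK K' hK' N M hNM hN hM hN' hM' x hx n hn
  rw [segment_eq_image_lineMap] at hx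
  obtain ⟨t, -, rfl⟩ := hx
  obtain ⟨μ, hμ⟩ := exists_inner_eq_cross (sub_ne_zero.2 hNM.symm) hn
  rw [hμ, hμ, cross_affine_lineMap, cross_affine_lineMap, hA K hK N hN M hM,
    hA K' hK' N hN' M hM', cross_swap_affine (hA K hK M hM N hN),
    cross_swap_affine (hA K' hK' M hM' N hN')]

/-- The interpolant is an `epsilon` choice, so its defining conditions hold only once some
interpolant has been constructed. The normal component of an RT0 field is constant on an edge and
must be the mean of that of `F`, hence the weight `1`. -/
lemma rt0Interp_spec {F : Plane → Plane}
    (hF : ∀ K ∈ T.triangles, ContinuousOn F (convexHull ℝ (K : Set Plane))) :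
    T.IsRT0Interp F (T.rt0Interp F) := by
  refine Classical.epsilon_spec (p := fun R => T.IsRT0Interp F R) ?_
  have hloc : ∀ K, ∃ A : Plane →ᵃ[ℝ] Plane, K ∈ T.triangles →
      (∃ (a : Plane) (c : ℝ), ∀ x, A x = a + c • x) ∧
      ∀ N ∈ K, ∀ M ∈ K, cross (M - N) (A N) = edgeMoment 1 0 F N M := by
    intro K
    by_cases hK : K ∈ T.triangles
    · obtain ⟨N₀, N₁, N₂, rfl, -, -, -, hD⟩ := T.exists_vertices hK
      obtain ⟨A, hA⟩ := exists_rt0_of_flux hD (edgeMoment 1 0 F) fun N M => by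
        rw [edgeMoment_swap]; simp
      exact ⟨A, fun _ => hA⟩
    · exact ⟨0, fun h => absurd h hK⟩
  choose A hA using hloc
  obtain ⟨R, hR⟩ := T.exists_hdivPiecewise (Loc := localRT0) 1 0 F A (fun K hK => (hA K hK).1)
    fun K hK => (hA K hK).2
  refine ⟨R, fun K => A K, hR, fun K hK N hN M hM n hn => ?_⟩
  rcases eq_or_ne N M with rfl | hNM
  · simp [edgeIntegral]
  obtain ⟨μ, hμ⟩ := exists_inner_eq_cross (sub_ne_zero.2 hNM.symm) hn
  have h := edgeIntegral_affine_sub (hF K hK) hN hM (A K) hμ (fun _ => 1) 1 0 (by simp)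
  simp only [mul_one] at h
  rw [h, cross_swap_affine ((hA K hK).2 M hM N hN), (hA K hK).2 N hN M hM]
  simp

/-- Existence for the `epsilon` choice again. The value at `t = 0` of the `L²(0,1)` projection onto
affine functions is the moment with weight `4 - 6t`. -/
lemma bdm1Interp_spec {F : Plane → Plane}
    (hF : ∀ K ∈ T.triangles, ContinuousOn F (convexHull ℝ (K : Set Plane))) :
    T.IsBDM1Interp F (T.bdm1Interp F) := by
  refine Classical.epsilon_spec (p := fun R => T.IsBDM1Interp F R) ?_
  have hloc : ∀ K, ∃ A : Plane →ᵃ[ℝ] Plane, K ∈ T.triangles →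
      ∀ N ∈ K, ∀ M ∈ K, cross (M - N) (A N) = edgeMoment 4 (-6) F N M := by
    intro K
    by_cases hK : K ∈ T.triangles
    · obtain ⟨N₀, N₁, N₂, rfl, -, -, -, hD⟩ := T.exists_vertices hK
      obtain ⟨A, hA⟩ := exists_affine_of_flux hD (edgeMoment 4 (-6) F) fun N =>
        edgeMoment_self _ _ _ _
      exact ⟨A, fun _ => hA⟩
    · exact ⟨0, fun h => absurd h hK⟩
  choose A hA using hloc
  obtain ⟨R, hR⟩ := T.exists_hdivPiecewise (Loc := localBDM1) 4 (-6) F A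
    (fun K hK => ⟨A K, fun _ => rfl⟩) hA
  refine ⟨R, fun K => A K, hR, fun K hK N hN M hM n hn q => ?_⟩
  rcases eq_or_ne N M with rfl | hNM
  · simp [edgeIntegral]
  obtain ⟨μ, hμ⟩ := exists_inner_eq_cross (sub_ne_zero.2 hNM.symm) hn
  have hq : ∀ t : ℝ, q (AffineMap.lineMap N M t) = q N + (q M - q N) * t := fun t => by
    rw [q.apply_lineMap, AffineMap.lineMap_apply_module']; simp; ring
  have hf := continuousOn_edge (hF K hK) hN hM (M - N)
  rw [edgeIntegral_affine_sub (hF K hK) hN hM (A K) hμ q _ _ hq,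
    cross_swap_affine (hA K hK M hM N hN), hA K hK N hN M hM, edgeMoment, edgeMoment, edgeMoment,
    integral_mul_affine hf, integral_mul_affine hf, integral_mul_affine hf]
  ring

/-- The normal `(-u₁, u₀)` of `u`. -/
lemma inner_rotate (u v : Plane) : ⟪v, !₂[-u 1, u 0]⟫ = cross u v := by
  rw [inner_eq_coords]; simp [cross]; ring

lemma IsRT0Interp.hasEdgeMoments {F R : Plane → Plane}
    (hF : ∀ K ∈ T.triangles, ContinuousOn F (convexHull ℝ (K : Set Plane)))
    (h : T.IsRT0Interp F R) : T.HasEdgeMoments 1 0 F R := by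
  obtain ⟨P, ⟨h1, -⟩, h2⟩ := h
  intro K hK
  obtain ⟨⟨a, c, hP⟩, hR⟩ := h1 K hK
  set A := AffineMap.const ℝ Plane a + c • AffineMap.id ℝ Plane
  have hA : P K = A := by ext1 x; simp [hP, A]
  refine ⟨A, hA ▸ hR, fun N hN M hM => ?_⟩
  rcases eq_or_ne N M with rfl | hNM
  · rw [edgeMoment_self]; simp [cross]
  have h3 := h2 K hK N hN M hM !₂[-(M - N) 1, (M - N) 0] (by rw [inner_rotate, cross_self])
  have h := edgeIntegral_affine_sub (hF K hK) hN hM A (μ := 1)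
    (fun v => by rw [inner_rotate, one_mul]) (fun _ => 1) 1 0 (by simp)
  simp only [mul_one] at h
  rw [hA, h] at h3
  have h4 := (mul_eq_zero.1 h3).resolve_left (dist_ne_zero.2 hNM)
  -- The difference of the two vertex values is a multiple of `M - N`, so the normal component of an
  -- RT0 field is constant along the edge.
  have h5 : cross (M - N) (A M) = cross (M - N) (A N) := by
    simp [A, cross]; ring
  rw [h5] at h4
  linarith

lemma IsBDM1Interp.hasEdgeMoments {F R : Plane → Plane}
    (hF : ∀ K ∈ T.triangles, ContinuousOn F (convexHull ℝ (K : Set Plane)))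
    (h : T.IsBDM1Interp F R) : T.HasEdgeMoments 4 (-6) F R := by
  obtain ⟨P, ⟨h1, -⟩, h2⟩ := h
  intro K hK
  obtain ⟨⟨A, hP⟩, hR⟩ := h1 K hK
  have hA : P K = A := funext hP
  refine ⟨A, hA ▸ hR, fun N hN M hM => ?_⟩
  rcases eq_or_ne N M with rfl | hNM
  · rw [edgeMoment_self]; simp [cross]
  have hu : ‖M - N‖ ^ 2 ≠ 0 := pow_ne_zero 2 (norm_ne_zero_iff.2 (sub_ne_zero.2 hNM.symm))
  -- Scaled so that the affine test function `q` below restricts to `4 - 6t` on the edge, which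
  -- extracts the value at `N` from an affine function.
  set L : Plane →ₗ[ℝ] ℝ := (-6 / ‖M - N‖ ^ 2) • (innerₗ Plane (M - N))
  have hL : L (M - N) = -6 := by
    simp only [L, LinearMap.smul_apply, innerₗ_apply_apply, real_inner_self_eq_norm_sq, smul_eq_mul]
    exact div_mul_cancel₀ _ hu
  set q : Plane →ᵃ[ℝ] ℝ := AffineMap.const ℝ Plane (4 - L N) + L.toAffineMap
  have hq : ∀ t : ℝ, q (AffineMap.lineMap N M t) = 4 + (-6) * t := fun t => by
    simp only [q, AffineMap.coe_add, Pi.add_apply, AffineMap.const_apply, LinearMap.coe_toAffineMap,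
      AffineMap.lineMap_apply_module', map_add, map_smul, hL, smul_eq_mul]
    ring
  have h3 := h2 K hK N hN M hM !₂[-(M - N) 1, (M - N) 0] (by rw [inner_rotate, cross_self]) q
  rw [hA, edgeIntegral_affine_sub (hF K hK) hN hM A (μ := 1)
    (fun v => by rw [inner_rotate, one_mul]) q _ _ hq] at h3
  have h4 := (mul_eq_zero.1 h3).resolve_left (by simpa using hNM)
  linarith

end Triangulation

/-- Stability of the interpolants: constants are reproduced. -/
lemma norm_affine_sub_le {K : Finset Plane} {N₀ N₁ N₂ : Plane} (hK : K = {N₀, N₁, N₂})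
    (hD : cross (N₁ - N₀) (N₂ - N₀) ≠ 0) {h δ : ℝ} (hd : ∀ N ∈ K, ∀ M ∈ K, ‖M - N‖ ≤ h)
    (hδ : 0 ≤ δ) {A : Plane →ᵃ[ℝ] Plane} {v : Plane}
    (hA : ∀ N ∈ K, ∀ M ∈ K, |cross (M - N) (A N - v)| ≤ 4 * ‖M - N‖ * δ) {x : Plane}
    (hx : x ∈ convexHull ℝ (K : Set Plane)) :
    ‖A x - v‖ ≤ 8 * h ^ 2 / |cross (N₁ - N₀) (N₂ - N₀)| * δ := by
  set D := cross (N₁ - N₀) (N₂ - N₀)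
  have key : ∀ N ∈ K, ∀ M ∈ K, ∀ M' ∈ K, |cross (M - N) (M' - N)| = |D| →
      ‖A N - v‖ ≤ 8 * h ^ 2 / |D| * δ := by
    intro N hN M hM M' hM' hc
    have hDpos : 0 < |D| := abs_pos.2 hD
    -- Cramer's rule: a vector is recovered from its cross products with the two edges at `N`.
    have e : cross (M - N) (M' - N) • (A N - v) =
        cross (M - N) (A N - v) • (M' - N) - cross (M' - N) (A N - v) • (M - N) := by
      ext i
      fin_cases i <;> simp [cross] <;> ring
    have e2 : |D| * ‖A N - v‖ ≤ 8 * h ^ 2 * δ := by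
      rw [← hc, ← Real.norm_eq_abs, ← norm_smul, e]
      refine (norm_sub_le _ _).trans ?_
      rw [norm_smul, norm_smul, Real.norm_eq_abs, Real.norm_eq_abs]
      have h1 := hd N hN M hM
      have h2 := hd N hN M' hM'
      have h3 := hA N hN M hM
      have h4 := hA N hN M' hM'
      have h0 : 0 ≤ h := (norm_nonneg _).trans h1
      calc _ ≤ (4 * h * δ) * h + (4 * h * δ) * h := by
            gcongr
            · exact h3.trans (by gcongr)
            · exact h4.trans (by gcongr)
        _ = _ := by ring
    rw [div_mul_eq_mul_div, le_div_iff₀ hDpos]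
    linarith
  -- The preimage of a ball under an affine map is convex, so the bound at the vertices extends to
  -- the triangle.
  have hsub : (K : Set Plane) ⊆ A ⁻¹' Metric.closedBall v (8 * h ^ 2 / |D| * δ) := by
    intro N hN
    simp only [Set.mem_preimage, mem_closedBall_iff_norm]
    have hN' : N = N₀ ∨ N = N₁ ∨ N = N₂ := by simpa [hK] using hN
    have m0 : N₀ ∈ K := by simp [hK]
    have m1 : N₁ ∈ K := by simp [hK]
    have m2 : N₂ ∈ K := by simp [hK]
    rcases hN' with rfl | rfl | rfl
    · exact key _ m0 _ m1 _ m2 rfl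
    · refine key _ m1 _ m2 _ m0 (congrArg abs ?_)
      simp [cross, D]; ring
    · refine key _ m2 _ m0 _ m1 (congrArg abs ?_)
      simp [cross, D]; ring
  have := convexHull_min hsub ((convex_closedBall v _).affine_preimage A) hx
  simpa only [Set.mem_preimage, mem_closedBall_iff_norm] using this

/-- Since the weight has mean one, the moment of the constant `v` is its normal component. The
difference is therefore a moment of `F - v`, and the weight is bounded by `4`. -/
lemma abs_cross_sub_le_of_edgeMoment {K : Finset Plane} {F : Plane → Plane}
    (hF : ContinuousOn F (convexHull ℝ (K : Set Plane))) {N M : Plane} (hN : N ∈ K) (hM : M ∈ K)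
    {a b : ℝ} (h1 : a + b / 2 = 1) (h2 : ∀ t ∈ Set.Icc (0 : ℝ) 1, |a + b * t| ≤ 4)
    {v y : Plane} {δ : ℝ} (hδ : ∀ x ∈ convexHull ℝ (K : Set Plane), ‖F x - v‖ ≤ δ)
    (hy : cross (M - N) y = edgeMoment a b F N M) :
    |cross (M - N) (y - v)| ≤ 4 * ‖M - N‖ * δ := by
  have hf := continuousOn_edge hF hN hM (M - N)
  have e : cross (M - N) (y - v) =
      ∫ t in (0 : ℝ)..1, cross (M - N) (F (AffineMap.lineMap N M t) - v) * (a + b * t) := by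
    simp_rw [cross_sub_right (M - N) _ v]
    rw [integral_mul_affine (f := fun t => cross (M - N) (F (AffineMap.lineMap N M t)) -
      cross (M - N) v) (hf.sub continuousOn_const), hy, edgeMoment, integral_mul_affine hf]
    have hi : IntervalIntegrable (fun t : ℝ => cross (M - N) (F (AffineMap.lineMap N M t)))
      volume 0 1 := ContinuousOn.intervalIntegrable (by rwa [Set.uIcc_of_le zero_le_one])
    have hi' : IntervalIntegrable (fun t : ℝ => cross (M - N) (F (AffineMap.lineMap N M t)) * t)
      volume 0 1 := hi.mul_continuousOn (by fun_prop)
    simp_rw [sub_mul]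
    rw [intervalIntegral.integral_sub hi (by simp), intervalIntegral.integral_sub hi'
      (by apply Continuous.intervalIntegrable; fun_prop), intervalIntegral.integral_const_mul]
    simp
    linear_combination cross (M - N) v * h1
  have hb := intervalIntegral.norm_integral_le_of_norm_le_const (a := 0) (b := 1)
    (f := fun t => cross (M - N) (F (AffineMap.lineMap N M t) - v) * (a + b * t))
    (C := 4 * ‖M - N‖ * δ) fun t ht => by
      rw [Set.uIoc_of_le zero_le_one] at ht
      have ht' : t ∈ Set.Icc (0 : ℝ) 1 := Set.Ioc_subset_Icc_self ht
      rw [norm_mul, Real.norm_eq_abs, Real.norm_eq_abs]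
      have h3 := hδ _ (lineMap_mem_hull hN hM ht')
      calc _ ≤ (‖M - N‖ * δ) * 4 := by
            gcongr
            · exact mul_nonneg (norm_nonneg _) ((norm_nonneg _).trans h3)
            · exact (abs_cross_le _ _).trans (by gcongr)
            · exact h2 t ht'
        _ = _ := by ring
  rw [e]
  simpa using hb

/-! ### Quadratic polynomials on triangles -/

/-- The quadratic polynomial with the given coefficients. -/
def quad (c : Fin 6 → ℝ) (x : Plane) : ℝ :=
  c 0 + c 1 * x 0 + c 2 * x 1 + c 3 * x 0 ^ 2 + c 4 * (x 0 * x 1) + c 5 * x 1 ^ 2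

/-- Affine functions on the plane. -/
def IsAff (p : Plane → ℝ) : Prop := ∃ a b c : ℝ, ∀ x, p x = a + b * x 0 + c * x 1

/-- Quadratic functions on the plane. -/
def IsQuad (p : Plane → ℝ) : Prop := ∃ c, ∀ x, p x = quad c x

lemma IsAff.mul {p q : Plane → ℝ} (hp : IsAff p) (hq : IsAff q) : IsQuad fun x => p x * q x := by
  obtain ⟨a, b, c, h⟩ := hp
  obtain ⟨a', b', c', h'⟩ := hq
  refine ⟨![a * a', a * b' + b * a', a * c' + c * a', b * b', b * c' + c * b', c * c'],
    fun x => ?_⟩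
  simp only [h, h']
  simp [quad]
  ring

lemma IsAff.isQuad {p : Plane → ℝ} (hp : IsAff p) : IsQuad p := by
  simpa using hp.mul (q := fun _ => 1) ⟨1, 0, 0, fun x => by simp⟩

lemma IsQuad.add {p q : Plane → ℝ} (hp : IsQuad p) (hq : IsQuad q) : IsQuad fun x => p x + q x := by
  obtain ⟨c, h⟩ := hp
  obtain ⟨c', h'⟩ := hq
  refine ⟨c + c', fun x => ?_⟩
  simp only [h, h']
  simp [quad]
  ring

lemma IsQuad.mul_const {p : Plane → ℝ} (hp : IsQuad p) (a : ℝ) : IsQuad fun x => p x * a := by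
  obtain ⟨c, h⟩ := hp
  refine ⟨fun i => c i * a, fun x => ?_⟩
  simp only [h]
  simp [quad]
  ring

lemma IsQuad.sum {ι : Type*} (s : Finset ι) {p : ι → Plane → ℝ} (hp : ∀ i ∈ s, IsQuad (p i)) :
    IsQuad fun x => ∑ i ∈ s, p i x := by
  classical
  induction s using Finset.induction_on with
  | empty => exact ⟨0, fun x => by simp [quad]⟩
  | insert i s hi ih =>
    simp only [Finset.sum_insert hi]
    exact (hp i (by simp)).add (ih fun j hj => hp j (by simp [hj]))

lemma isAff_affineMap (A : Plane →ᵃ[ℝ] Plane) (i : Fin 2) : IsAff fun x => A x i := by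
  refine ⟨A 0 i, A.linear (EuclideanSpace.single 0 1) i, A.linear (EuclideanSpace.single 1 1) i,
    fun x => ?_⟩
  have h : x = x 0 • EuclideanSpace.single 0 1 + x 1 • EuclideanSpace.single 1 1 := by
    ext i; fin_cases i <;> simp
  have h2 : A x = A.linear x + A 0 := congrFun A.decomp x
  beta_reduce
  rw [h2]
  conv_lhs => rw [h]
  simp
  ring

/-- Invariance under affine maps reduces the inverse estimate to one reference triangle. -/
lemma IsQuad.comp_affineMap {p : Plane → ℝ} (hp : IsQuad p) (A : Plane →ᵃ[ℝ] Plane) :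
    IsQuad fun x => p (A x) := by
  obtain ⟨c, h⟩ := hp
  have h0 := isAff_affineMap A 0
  have h1 := isAff_affineMap A 1
  have e : (fun x => p (A x)) = fun x => 1 * c 0 + A x 0 * c 1 + A x 1 * c 2 + (A x 0 * A x 0) * c 3
      + (A x 0 * A x 1) * c 4 + (A x 1 * A x 1) * c 5 := by
    ext x; rw [h, quad]; ring
  rw [e]
  have h2 : IsAff fun _ : Plane => 1 := ⟨1, 0, 0, fun x => by simp⟩
  exact (((((h2.isQuad.mul_const _).add (h0.isQuad.mul_const _)).add (h1.isQuad.mul_const _)).add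
    ((h0.mul h0).mul_const _)).add ((h0.mul h1).mul_const _)).add ((h1.mul h1).mul_const _)

lemma continuous_quad (c : Fin 6 → ℝ) : Continuous (quad c) := by
  unfold quad; fun_prop

lemma abs_quad_le (c : Fin 6 → ℝ) {x : Plane} (h0 : |x 0| ≤ 1) (h1 : |x 1| ≤ 1) :
    |quad c x| ≤ 6 * ‖c‖ := by
  have hc : ∀ i, |c i| ≤ ‖c‖ := fun i => norm_le_pi_norm c i
  have key : ∀ i (y : ℝ), |y| ≤ 1 → |c i * y| ≤ ‖c‖ := fun i y hy => by
    rw [abs_mul]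
    calc _ ≤ ‖c‖ * 1 := by gcongr; exact hc i
      _ = _ := mul_one _
  have e0 := hc 0
  have e1 := key 1 _ h0
  have e2 := key 2 _ h1
  have e3 := key 3 (x 0 ^ 2) (by rw [abs_pow]; exact pow_le_one₀ (abs_nonneg _) h0)
  have e4 := key 4 (x 0 * x 1) (by rw [abs_mul]; exact mul_le_one₀ h0 (abs_nonneg _) h1)
  have e5 := key 5 (x 1 ^ 2) (by rw [abs_pow]; exact pow_le_one₀ (abs_nonneg _) h1)
  rw [abs_le] at *
  unfold quad
  constructor <;> linarith

/-- A disc inside the reference triangle. -/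
def refDisc : Set Plane := Metric.closedBall !₂[1 / 4, 1 / 4] (1 / 4)

lemma refDisc_bounds {x : Plane} (hx : x ∈ refDisc) : 0 ≤ x 0 ∧ 0 ≤ x 1 ∧ x 0 + x 1 ≤ 1 := by
  rw [refDisc, mem_closedBall_iff_norm] at hx
  have h0 := (PiLp.norm_apply_le (x - !₂[1 / 4, 1 / 4]) 0).trans hx
  have h1 := (PiLp.norm_apply_le (x - !₂[1 / 4, 1 / 4]) 1).trans hx
  simp [abs_le] at h0 h1
  refine ⟨?_, ?_, ?_⟩ <;> linarith

/-- A quadratic that vanishes on a disc vanishes at six points that are unisolvent for quadratics: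
the centre, its four neighbours along the axes, and one diagonal neighbour. -/
lemma eq_zero_of_quad_refDisc {c : Fin 6 → ℝ} (h : ∫ x in refDisc, quad c x ^ 2 = 0) : c = 0 := by
  have hK : IsCompact refDisc := isCompact_closedBall _ _
  have hq := continuous_quad c
  rw [setIntegral_eq_zero_iff_of_nonneg_ae (Filter.Eventually.of_forall fun x => sq_nonneg _)
    ((hq.pow 2).continuousOn.integrableOn_compact hK)] at h
  set B := Metric.ball (!₂[1 / 4, 1 / 4] : Plane) (1 / 4)
  have hB : B ⊆ refDisc := Metric.ball_subset_closedBall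
  have h2 : (fun x => quad c x ^ 2) =ᵐ[volume.restrict B] fun _ => 0 :=
    ae_restrict_of_ae_restrict_of_subset hB h
  have h3 := Measure.eqOn_open_of_ae_eq h2 Metric.isOpen_ball (hq.pow 2).continuousOn
    continuousOn_const
  have h4 : ∀ a b : ℝ, |a| ≤ 1 / 9 → |b| ≤ 1 / 9 → quad c !₂[1 / 4 + a, 1 / 4 + b] = 0 := by
    intro a b ha hb
    refine pow_eq_zero_iff (two_ne_zero) |>.1 (h3 ?_)
    rw [mem_ball_iff_norm]
    refine (norm_le_abs_add_abs _).trans_lt ?_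
    simp
    norm_num at ha hb
    linarith
  have a0 := h4 0 0 (by norm_num) (by norm_num)
  have a1 := h4 (1 / 9) 0 (by norm_num [abs_of_pos]) (by norm_num)
  have a2 := h4 (-1 / 9) 0 (by norm_num [abs_le]) (by norm_num)
  have a3 := h4 0 (1 / 9) (by norm_num) (by norm_num [abs_of_pos])
  have a4 := h4 0 (-1 / 9) (by norm_num) (by norm_num [abs_le])
  have a5 := h4 (1 / 9) (1 / 9) (by norm_num [abs_of_pos]) (by norm_num [abs_of_pos])
  simp [quad] at a0 a1 a2 a3 a4 a5
  ext i
  fin_cases i <;> simp <;> linarith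

/-- Equivalence of norms in finite dimension: the integral is continuous and positive on the compact
unit sphere of coefficients, and both sides are homogeneous of degree two. -/
lemma exists_norm_sq_le_integral_refDisc :
    ∃ κ : ℝ, 0 ≤ κ ∧ ∀ c, ‖c‖ ^ 2 ≤ κ * ∫ x in refDisc, quad c x ^ 2 := by
  have hK : IsCompact refDisc := isCompact_closedBall _ _
  have hcont : Continuous fun c => ∫ x in refDisc, quad c x ^ 2 :=
    continuous_parametric_integral_of_continuous
      (f := fun (c : Fin 6 → ℝ) x => quad c x ^ 2)
      (by simp only [Function.uncurry_def, quad]; fun_prop) hK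
  obtain ⟨c₀, hc₀, hmin⟩ := (isCompact_sphere (0 : Fin 6 → ℝ) 1).exists_isMinOn
    ⟨fun _ => 1, by simp⟩ hcont.continuousOn
  set m := ∫ x in refDisc, quad c₀ x ^ 2
  have hm0 : 0 ≤ m := integral_nonneg fun x => sq_nonneg _
  have hm : 0 < m := hm0.lt_of_ne' fun h => by
    rw [eq_zero_of_quad_refDisc h] at hc₀
    simp at hc₀
  refine ⟨m⁻¹, by positivity, fun c => ?_⟩
  rcases eq_or_ne c 0 with rfl | hc
  · simpa using mul_nonneg (inv_nonneg.2 hm0)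
      (integral_nonneg (μ := volume.restrict refDisc) fun x => sq_nonneg (quad 0 x))
  have hn : ‖c‖ ≠ 0 := norm_ne_zero_iff.2 hc
  have h1 : m ≤ ∫ x in refDisc, quad (‖c‖⁻¹ • c) x ^ 2 := hmin (by simp [norm_smul, hn])
  have h2 : ∀ x, quad (‖c‖⁻¹ • c) x ^ 2 = (‖c‖ ^ 2)⁻¹ * quad c x ^ 2 := fun x => by
    simp [quad]; ring
  simp_rw [h2] at h1
  rw [integral_const_mul] at h1
  rw [le_inv_mul_iff₀ (by positivity)] at h1
  rw [le_inv_mul_iff₀ hm]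
  linarith

/-- The affine parametrization of a triangle over the reference triangle. -/
noncomputable def refMap (N₀ N₁ N₂ : Plane) : Plane →ᵃ[ℝ] Plane :=
  ((EuclideanSpace.proj (𝕜 := ℝ) (0 : Fin 2)).smulRight (N₁ - N₀) +
    (EuclideanSpace.proj (𝕜 := ℝ) (1 : Fin 2)).smulRight (N₂ - N₀) :
      Plane →L[ℝ] Plane).toLinearMap.toAffineMap + AffineMap.const ℝ Plane N₀

lemma refMap_apply (N₀ N₁ N₂ ξ : Plane) :
    refMap N₀ N₁ N₂ ξ = ξ 0 • (N₁ - N₀) + ξ 1 • (N₂ - N₀) + N₀ := by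
  simp [refMap]

lemma hasFDerivAt_refMap (N₀ N₁ N₂ ξ : Plane) :
    HasFDerivAt (refMap N₀ N₁ N₂) ((EuclideanSpace.proj (𝕜 := ℝ) (0 : Fin 2)).smulRight (N₁ - N₀) +
      (EuclideanSpace.proj (𝕜 := ℝ) (1 : Fin 2)).smulRight (N₂ - N₀) : Plane →L[ℝ] Plane) ξ :=
  (ContinuousLinearMap.hasFDerivAt _).add_const N₀

lemma det_refMap (N₀ N₁ N₂ : Plane) :
    ((EuclideanSpace.proj (𝕜 := ℝ) (0 : Fin 2)).smulRight (N₁ - N₀) +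
      (EuclideanSpace.proj (𝕜 := ℝ) (1 : Fin 2)).smulRight (N₂ - N₀) : Plane →L[ℝ] Plane).det
      = cross (N₁ - N₀) (N₂ - N₀) := by
  rw [ContinuousLinearMap.det, ← LinearMap.det_toMatrix (EuclideanSpace.basisFun (Fin 2) ℝ).toBasis,
    Matrix.det_fin_two]
  simp [LinearMap.toMatrix_apply, cross]
  ring

lemma cross_refMap (N₀ N₁ N₂ ξ : Plane) :
    cross (refMap N₀ N₁ N₂ ξ - N₀) (N₂ - N₀) = ξ 0 * cross (N₁ - N₀) (N₂ - N₀) ∧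
    cross (N₁ - N₀) (refMap N₀ N₁ N₂ ξ - N₀) = ξ 1 * cross (N₁ - N₀) (N₂ - N₀) := by
  rw [refMap_apply]
  constructor <;> simp [cross] <;> ring

lemma injective_refMap {N₀ N₁ N₂ : Plane} (hD : cross (N₁ - N₀) (N₂ - N₀) ≠ 0) :
    Function.Injective (refMap N₀ N₁ N₂) := by
  intro ξ η h
  have h1 := cross_refMap N₀ N₁ N₂ ξ
  have h2 := cross_refMap N₀ N₁ N₂ η
  rw [h, h2.1, h2.2] at h1
  ext i
  fin_cases i
  · exact (mul_right_cancel₀ hD h1.1).symm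
  · exact (mul_right_cancel₀ hD h1.2).symm

lemma convexHull_eq_image_refMap (N₀ N₁ N₂ : Plane) :
    convexHull ℝ ({N₀, N₁, N₂} : Set Plane) =
      refMap N₀ N₁ N₂ '' {ξ | 0 ≤ ξ 0 ∧ 0 ≤ ξ 1 ∧ ξ 0 + ξ 1 ≤ 1} := by
  refine (convexHull_min ?_ ?_).antisymm ?_
  · rintro x (rfl | rfl | rfl)
    · exact ⟨0, by simp, by simp [refMap_apply]⟩
    · exact ⟨!₂[1, 0], by simp, by simp [refMap_apply]⟩
    · exact ⟨!₂[0, 1], by simp, by simp [refMap_apply]⟩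
  · refine Convex.affine_image _ fun x hx y hy a b ha hb hab => ?_
    simp only [Set.mem_ofPred_eq, PiLp.add_apply, PiLp.smul_apply, smul_eq_mul] at *
    refine ⟨by nlinarith, by nlinarith, by nlinarith⟩
  · rintro _ ⟨ξ, ⟨h0, h1, h2⟩, rfl⟩
    have hm : ∀ x ∈ ({N₀, N₁, N₂} : Set Plane), x ∈ convexHull ℝ ({N₀, N₁, N₂} : Set Plane) :=
      fun x hx => subset_convexHull ℝ _ hx
    have := (convex_convexHull ℝ ({N₀, N₁, N₂} : Set Plane)).sum_mem (t := Finset.univ)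
      (w := ![1 - ξ 0 - ξ 1, ξ 0, ξ 1]) (z := ![N₀, N₁, N₂])
      (by intro i _; fin_cases i <;> simp <;> linarith) (by simp [Fin.sum_univ_three]; ring)
      (by intro i _; fin_cases i <;> exact hm _ (by simp))
    rw [Fin.sum_univ_three] at this
    convert this using 1
    rw [refMap_apply]
    simp
    module

lemma interior_hull_ae_eq (K : Finset Plane) : interior (convexHull ℝ (K : Set Plane)) =ᵐ[volume]
    convexHull ℝ (K : Set Plane) :=
  interior_ae_eq_of_null_frontier ((convex_convexHull ℝ _).addHaar_frontier volume)

/-- The inverse estimate for quadratic polynomials. -/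
lemma exists_inverse_estimate : ∃ κ : ℝ, 0 ≤ κ ∧ ∀ N₀ N₁ N₂ : Plane,
    cross (N₁ - N₀) (N₂ - N₀) ≠ 0 → ∀ p, IsQuad p →
      ∀ x ∈ convexHull ℝ ({N₀, N₁, N₂} : Set Plane),
        p x ^ 2 * |cross (N₁ - N₀) (N₂ - N₀)| ≤
          κ * ∫ y in convexHull ℝ ({N₀, N₁, N₂} : Set Plane), p y ^ 2 := by
  obtain ⟨κ, hκ, h⟩ := exists_norm_sq_le_integral_refDisc
  refine ⟨36 * κ, by positivity, fun N₀ N₁ N₂ hD p hp x hx => ?_⟩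
  have hcp : Continuous p := by
    obtain ⟨c, hc⟩ := hp
    rw [show p = quad c from funext hc]; exact continuous_quad c
  obtain ⟨c, hc⟩ := hp.comp_affineMap (refMap N₀ N₁ N₂)
  have hcomp : IsCompact (convexHull ℝ ({N₀, N₁, N₂} : Set Plane)) :=
    (Set.toFinite _).isCompact_convexHull ℝ
  have hsub : refMap N₀ N₁ N₂ '' refDisc ⊆ convexHull ℝ ({N₀, N₁, N₂} : Set Plane) := by
    rw [convexHull_eq_image_refMap]
    exact Set.image_mono fun ξ hξ => refDisc_bounds hξ
  -- It is enough to integrate over the image of the disc, where the change of variables contributes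
  -- the factor `|cross (N₁ - N₀) (N₂ - N₀)|`.
  have h1 : ∫ y in refMap N₀ N₁ N₂ '' refDisc, p y ^ 2 ≤
      ∫ y in convexHull ℝ ({N₀, N₁, N₂} : Set Plane), p y ^ 2 :=
    setIntegral_mono_set ((hcp.pow 2).continuousOn.integrableOn_compact hcomp)
      (Filter.Eventually.of_forall fun y => sq_nonneg _) hsub.eventuallyLE
  rw [integral_image_eq_integral_abs_det_fderiv_smul volume
    (show MeasurableSet refDisc from Metric.isClosed_closedBall.measurableSet)
    (fun ξ _ => (hasFDerivAt_refMap N₀ N₁ N₂ ξ).hasFDerivWithinAt) (injective_refMap hD).injOn,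
    det_refMap] at h1
  simp only [hc, smul_eq_mul] at h1
  rw [integral_const_mul] at h1
  rw [convexHull_eq_image_refMap] at hx
  obtain ⟨ξ, ⟨h2, h3, h4⟩, rfl⟩ := hx
  have h5 := abs_quad_le c (x := ξ) (abs_le.2 ⟨by linarith, by linarith⟩)
    (abs_le.2 ⟨by linarith, by linarith⟩)
  have h6 : quad c ξ ^ 2 ≤ 36 * ‖c‖ ^ 2 := by
    rw [← sq_abs]
    calc _ ≤ (6 * ‖c‖) ^ 2 := by gcongr
      _ = _ := by ring
  rw [show p (refMap N₀ N₁ N₂ ξ) = quad c ξ from hc ξ]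
  calc _ ≤ 36 * ‖c‖ ^ 2 * |cross (N₁ - N₀) (N₂ - N₀)| := by gcongr
    _ ≤ 36 * (κ * ∫ x in refDisc, quad c x ^ 2) * |cross (N₁ - N₀) (N₂ - N₀)| := by
        gcongr; exact h c
    _ = 36 * κ * (|cross (N₁ - N₀) (N₂ - N₀)| * ∫ x in refDisc, quad c x ^ 2) := by ring
    _ ≤ _ := by gcongr

/-- The area of a triangle is controlled by its cross product. -/
lemma volume_hull_le {N₀ N₁ N₂ : Plane} (hD : cross (N₁ - N₀) (N₂ - N₀) ≠ 0) :
    volume.real (convexHull ℝ ({N₀, N₁, N₂} : Set Plane)) ≤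
      4 * Real.pi * |cross (N₁ - N₀) (N₂ - N₀)| := by
  -- The reference triangle is enclosed in a disc of radius `2`; a crude area bound is enough.
  have hsub : convexHull ℝ ({N₀, N₁, N₂} : Set Plane) ⊆
      refMap N₀ N₁ N₂ '' Metric.closedBall 0 2 := by
    rw [convexHull_eq_image_refMap]
    refine Set.image_mono fun ξ hξ => ?_
    rw [mem_closedBall_zero_iff]
    refine (norm_le_abs_add_abs _).trans ?_
    rw [abs_of_nonneg hξ.1, abs_of_nonneg hξ.2.1]
    linarith [hξ.2.2]
  have hcomp : IsCompact (refMap N₀ N₁ N₂ '' Metric.closedBall 0 2) :=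
    (isCompact_closedBall _ _).image_of_continuousOn
      fun ξ _ => (hasFDerivAt_refMap N₀ N₁ N₂ ξ).continuousAt.continuousWithinAt
  refine (measureReal_mono hsub hcomp.measure_lt_top.ne).trans ?_
  have h := integral_image_eq_integral_abs_det_fderiv_smul volume
    (Metric.isClosed_closedBall (x := (0 : Plane)) (ε := 2)).measurableSet
    (fun ξ _ => (hasFDerivAt_refMap N₀ N₁ N₂ ξ).hasFDerivWithinAt) (injective_refMap hD).injOn
    (fun _ => (1 : ℝ))
  rw [det_refMap] at h
  simp only [setIntegral_const, smul_eq_mul, mul_one] at h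
  rw [h, measureReal_def, EuclideanSpace.volume_closedBall_fin_two]
  refine le_of_eq ?_
  have hv : (ENNReal.ofReal 2 ^ 2 * ENNReal.ofReal Real.pi).toReal = 4 * Real.pi := by
    simp [Real.pi_pos.le]
    ring
  rw [hv]

/-- Shape regularity in terms of the cross product. -/
lemma diam_sq_le_of_closedBall_subset {N₀ N₁ N₂ c : Plane} (hD : cross (N₁ - N₀) (N₂ - N₀) ≠ 0)
    {h σ : ℝ} (hσ : 0 < σ) (hh : 0 ≤ h)
    (hc : Metric.closedBall c (h / σ) ⊆ convexHull ℝ ({N₀, N₁, N₂} : Set Plane)) :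
    h ^ 2 ≤ 4 * σ ^ 2 * |cross (N₁ - N₀) (N₂ - N₀)| := by
  -- Compare the area of the inscribed disc with that of the triangle; the factor `π` cancels.
  have h1 := (measureReal_mono hc ((Set.toFinite _).isCompact_convexHull ℝ).measure_lt_top.ne).trans
    (volume_hull_le hD)
  rw [measureReal_def, EuclideanSpace.volume_closedBall_fin_two] at h1
  have h2 : (h / σ) ^ 2 * Real.pi ≤ 4 * Real.pi * |cross (N₁ - N₀) (N₂ - N₀)| := by
    refine le_trans (le_of_eq ?_) h1
    have : 0 ≤ h / σ := by positivity
    simp [Real.pi_pos.le, this]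
  have h3 : (h / σ) ^ 2 ≤ 4 * |cross (N₁ - N₀) (N₂ - N₀)| := by
    have := Real.pi_pos
    refine le_of_mul_le_mul_right ?_ this
    linarith
  rw [div_pow, div_le_iff₀ (by positivity)] at h3
  linarith

/-- Barycentric coordinates on a triangle. -/
lemma exists_barycentric {N₀ N₁ N₂ : Plane} (h01 : N₀ ≠ N₁) (h02 : N₀ ≠ N₂) (h12 : N₁ ≠ N₂)
    (hD : cross (N₁ - N₀) (N₂ - N₀) ≠ 0) : ∃ l : Plane → Plane → ℝ, (∀ N, IsAff (l N)) ∧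
      ∀ x ∈ convexHull ℝ ({N₀, N₁, N₂} : Set Plane), (∀ N, 0 ≤ l N x) ∧
        ∑ N ∈ ({N₀, N₁, N₂} : Finset Plane), l N x = 1 ∧
        ∑ N ∈ ({N₀, N₁, N₂} : Finset Plane), l N x • N = x := by
  classical
  set D := cross (N₁ - N₀) (N₂ - N₀) with hDdef
  set l₁ : Plane → ℝ := fun x => cross (x - N₀) (N₂ - N₀) / D
  set l₂ : Plane → ℝ := fun x => cross (N₁ - N₀) (x - N₀) / D
  have a1 : IsAff l₁ := ⟨-cross N₀ (N₂ - N₀) / D, (N₂ - N₀) 1 / D, -(N₂ - N₀) 0 / D, fun x => by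
    simp [l₁, cross]; ring⟩
  have a2 : IsAff l₂ := ⟨-cross (N₁ - N₀) N₀ / D, -(N₁ - N₀) 1 / D, (N₁ - N₀) 0 / D, fun x => by
    simp [l₂, cross]; ring⟩
  have a0 : IsAff fun x => 1 - l₁ x - l₂ x := by
    obtain ⟨a, b, c, h⟩ := a1
    obtain ⟨a', b', c', h'⟩ := a2
    exact ⟨1 - a - a', -b - b', -c - c', fun x => by simp only [h, h']; ring⟩
  refine ⟨fun N => if N = N₀ then fun x => 1 - l₁ x - l₂ x else if N = N₁ then l₁ else l₂,
    fun N => ?_, fun x hx => ?_⟩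
  · beta_reduce; split_ifs <;> assumption
  · rw [convexHull_eq_image_refMap] at hx
    obtain ⟨ξ, ⟨h0, h1, h2⟩, rfl⟩ := hx
    have e1 : l₁ (refMap N₀ N₁ N₂ ξ) = ξ 0 := by
      simp only [l₁]; rw [(cross_refMap N₀ N₁ N₂ ξ).1, mul_div_cancel_right₀ _ hD]
    have e2 : l₂ (refMap N₀ N₁ N₂ ξ) = ξ 1 := by
      simp only [l₂]; rw [(cross_refMap N₀ N₁ N₂ ξ).2, mul_div_cancel_right₀ _ hD]
    refine ⟨fun N => ?_, ?_, ?_⟩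
    · beta_reduce; split_ifs <;> linarith
    · rw [Finset.sum_insert (by simp [h01, h02]), Finset.sum_pair h12]
      simp [h01.symm, h02.symm, h12.symm, e1, e2]
    · rw [Finset.sum_insert (by simp [h01, h02]), Finset.sum_pair h12]
      simp only [h01.symm, h02.symm, h12.symm, if_true, if_false, e1, e2]
      rw [refMap_apply]
      module

/-! ### Bernardi–Raugel fields on a triangle -/

/-- Where a function is smooth, its weak gradient is the classical one. -/
lemma IsWeakGrad.ae_eq_fderiv {Ω U V : Set Plane} (hΩ : MeasurableSet Ω) (hr : Ω ⊆ offAxis)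
    (hU : IsOpen U) (hUΩ : U ⊆ Ω) (hUV : U ⊆ V) {q : Plane → ℝ} {g : Plane → Plane}
    (h : IsWeakGrad Ω V q g) (hg : MemL2 Ω 1 g) {p : Plane → ℝ} (hp : ContDiff ℝ ∞ p)
    (hqp : Set.EqOn q p U) (j : Fin 2) :
    ∀ᵐ x, x ∈ U → g x j = fderiv ℝ p x (EuclideanSpace.single j 1) := by
  have hgj := (hg.comp hΩ hr j).halfL2 hΩ hr
  have hp' := continuous_fderiv_apply' hp (EuclideanSpace.single j 1)
  have hloc : LocallyIntegrableOn (fun x => Ω.indicator (fun x => g x j) x -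
      fderiv ℝ p x (EuclideanSpace.single j 1)) U := by
    refine LocallyIntegrableOn.sub (locallyIntegrableOn_of_indicator hU fun K hK hKc =>
      (halfL2_indicator hKc (hK.trans (hUΩ.trans hr)) (-1)).integrable_mul hgj) ?_
    exact hp'.locallyIntegrable.locallyIntegrableOn U
  have key := hU.ae_eq_zero_of_integral_contDiff_smul_eq_zero hloc fun φ hφ hc hs => by
    have hφ' := continuous_fderiv_apply' hφ (EuclideanSpace.single j 1)
    have i1 : Integrable fun x => φ x * Ω.indicator (fun x => g x j) x :=
      (halfL2_of_compactSupport hφ.continuous hc (hs.trans (hUΩ.trans hr)) (-1)).integrable_mul hgj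
    have i2 : Integrable fun x => φ x * fderiv ℝ p x (EuclideanSpace.single j 1) :=
      (hφ.continuous.mul hp').integrable_of_hasCompactSupport hc.mul_right
    have i3 : Integrable fun x => p x * fderiv ℝ φ x (EuclideanSpace.single j 1) :=
      (hp.continuous.mul hφ').integrable_of_hasCompactSupport
        (hasCompactSupport_fderiv_apply hc _).mul_left
    have i4 : Integrable fun x => p x * φ x :=
      (hp.continuous.mul hφ.continuous).integrable_of_hasCompactSupport hc.mul_left
    have e1 := h φ hφ hc (hs.trans hUV) j
    have hz : ∀ x, x ∉ U → fderiv ℝ φ x (EuclideanSpace.single j 1) = 0 := fun x hx =>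
      image_eq_zero_of_notMem_tsupport (f := fun x => fderiv ℝ φ x (EuclideanSpace.single j 1))
        fun hx' => hx (hs (tsupport_fderiv_apply_subset' φ _ hx'))
    have e2 : ∫ x in Ω, q x * fderiv ℝ φ x (EuclideanSpace.single j 1) =
        ∫ x, p x * fderiv ℝ φ x (EuclideanSpace.single j 1) := by
      rw [← setIntegral_eq_integral_of_forall_compl_eq_zero (s := Ω)
        (f := fun x => p x * fderiv ℝ φ x (EuclideanSpace.single j 1))
        fun x hx => by rw [hz x fun h => hx (hUΩ h), mul_zero]]
      refine integral_congr_ae (Filter.Eventually.of_forall fun x => ?_)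
      by_cases hx : x ∈ U
      · simp only [hqp hx]
      · simp only [hz x hx, mul_zero]
    have e3 := integral_mul_fderiv_eq_neg_fderiv_mul_of_integrable (μ := volume) (f := p) (g := φ)
      (v := EuclideanSpace.single j 1) (by simpa only [mul_comm] using i2) i3 i4
      (fun x _ => hp.differentiable (by simp) x) (fun x _ => hφ.differentiable (by simp) x)
    have e4 : ∫ x, φ x * Ω.indicator (fun x => g x j) x = ∫ x in Ω, g x j * φ x := by
      rw [← integral_indicator hΩ]
      refine integral_congr_ae (Filter.Eventually.of_forall fun x => ?_)
      by_cases hx : x ∈ Ω <;> simp [hx, mul_comm]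
    simp only [smul_eq_mul, mul_sub]
    rw [integral_sub i1 i2, e4]
    have e5 : ∫ x, φ x * fderiv ℝ p x (EuclideanSpace.single j 1) =
        ∫ x, fderiv ℝ p x (EuclideanSpace.single j 1) * φ x := by simp only [mul_comm]
    rw [e5]
    linarith
  filter_upwards [key] with x hx hxU
  have := hx hxU
  rw [Set.indicator_of_mem (hUΩ hxU)] at this
  linarith

lemma contDiff_quad (c : Fin 6 → ℝ) : ContDiff ℝ ∞ (quad c) := by
  unfold quad; fun_prop

lemma fderiv_quad (c : Fin 6 → ℝ) (x v : Plane) : fderiv ℝ (quad c) x v =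
    v 0 * (c 1 + 2 * c 3 * x 0 + c 4 * x 1) + v 1 * (c 2 + c 4 * x 0 + 2 * c 5 * x 1) := by
  have h0 : HasFDerivAt (fun y : Plane => y 0) (EuclideanSpace.proj (𝕜 := ℝ) 0) x :=
    (EuclideanSpace.proj (𝕜 := ℝ) (0 : Fin 2)).hasFDerivAt
  have h1 : HasFDerivAt (fun y : Plane => y 1) (EuclideanSpace.proj (𝕜 := ℝ) 1) x :=
    (EuclideanSpace.proj (𝕜 := ℝ) (1 : Fin 2)).hasFDerivAt
  have h := (((((h0.const_mul (c 1)).const_add (c 0)).add (h1.const_mul (c 2))).add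
    ((h0.pow 2).const_mul (c 3))).add ((h0.mul h1).const_mul (c 4))).add
    ((h1.pow 2).const_mul (c 5))
  have e : fderiv ℝ (quad c) x = _ := HasFDerivAt.fderiv (f := quad c) h
  rw [e]
  simp
  ring

/-- The coefficients of `∂ⱼ(r q)` for a quadratic polynomial `q`. -/
def fluxCoeff (c : Fin 6 → ℝ) : Fin 2 → Fin 6 → ℝ :=
  ![![c 0, 2 * c 1, c 2, 3 * c 3, 2 * c 4, c 5], ![0, c 2, 0, c 4, 2 * c 5, 0]]

/-- `r q` is cubic, but its first derivatives are again quadratic, so the inverse estimate for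
quadratics applies to them. -/
lemma quad_fluxCoeff (c : Fin 6 → ℝ) (j : Fin 2) (x : Plane) : quad (fluxCoeff c j) x =
    (if j = 0 then quad c x else 0) + x 0 * fderiv ℝ (quad c) x (EuclideanSpace.single j 1) := by
  rw [fderiv_quad]
  fin_cases j <;> simp [quad, fluxCoeff] <;> ring

lemma fderiv_r_mul_quad (c : Fin 6 → ℝ) (x v : Plane) :
    fderiv ℝ (fun y : Plane => y 0 * quad c y) x v =
      v 0 * quad (fluxCoeff c 0) x + v 1 * quad (fluxCoeff c 1) x := by
  have h0 : HasFDerivAt (fun y : Plane => y 0) (EuclideanSpace.proj (𝕜 := ℝ) 0) x :=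
    (EuclideanSpace.proj (𝕜 := ℝ) (0 : Fin 2)).hasFDerivAt
  have h1 := ((contDiff_quad c).differentiable (by simp) x).hasFDerivAt
  have e : fderiv ℝ (fun y : Plane => y 0 * quad c y) x = _ := (h0.mul h1).fderiv
  rw [e]
  simp [quad_fluxCoeff, fderiv_quad]
  ring

/-- Mean value inequality on a convex set, with the gradient bounded by the sum of its two partial
derivatives. -/
lemma abs_r_mul_quad_sub_le {s : Set Plane} (hs : Convex ℝ s) (c : Fin 6 → ℝ) {m : ℝ}
    (hm : ∀ x ∈ s, ∀ j, |quad (fluxCoeff c j) x| ≤ m) {x y : Plane} (hx : x ∈ s) (hy : y ∈ s) :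
    |y 0 * quad c y - x 0 * quad c x| ≤ 2 * m * ‖y - x‖ := by
  have hm0 : 0 ≤ m := (abs_nonneg _).trans (hm x hx 0)
  refine hs.norm_image_sub_le_of_norm_fderiv_le (𝕜 := ℝ) (f := fun y : Plane => y 0 * quad c y)
    (fun z _ => ?_) (fun z hz => ?_) hx hy
  · have := (contDiff_quad c).differentiable (by simp)
    fun_prop
  · refine ContinuousLinearMap.opNorm_le_bound _ (by positivity) fun v => ?_
    rw [fderiv_r_mul_quad, Real.norm_eq_abs]
    have h0 : |v 0| ≤ ‖v‖ := PiLp.norm_apply_le v 0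
    have h1 : |v 1| ≤ ‖v‖ := PiLp.norm_apply_le v 1
    calc _ ≤ |v 0| * |quad (fluxCoeff c 0) z| + |v 1| * |quad (fluxCoeff c 1) z| := by
          rw [← abs_mul, ← abs_mul]; exact abs_add_le _ _
      _ ≤ ‖v‖ * m + ‖v‖ * m := by gcongr <;> exact hm z hz _
      _ = _ := by ring

namespace Triangulation

variable {Ω : Set Plane} (T : Triangulation Ω)

/-- The edge bubbles are products of two barycentric coordinates, which are affine in the point. -/
lemma exists_quad_of_bernardiRaugel {w : Vel Ω} (hw : w ∈ T.bernardiRaugel) {K : Finset Plane}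
    (hK : K ∈ T.triangles) : ∃ c : Fin 2 → Fin 6 → ℝ,
      ∀ x ∈ convexHull ℝ (K : Set Plane), ∀ i, w.val x i = quad (c i) x := by
  obtain ⟨b, -, hb⟩ := hw
  obtain ⟨A, hA⟩ := hb K hK
  obtain ⟨N₀, N₁, N₂, hKe, h01, h02, h12, hD⟩ := T.exists_vertices hK
  obtain ⟨l, hl, hbary⟩ := exists_barycentric h01 h02 h12 hD
  have hprod : ∀ E ∈ K.powersetCard 2, IsQuad fun x => ∏ N ∈ E, l N x := by
    intro E hE
    obtain ⟨N, M, hNM, rfl⟩ := Finset.card_eq_two.1 (Finset.mem_powersetCard.1 hE).2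
    simp only [Finset.prod_pair hNM]
    exact (hl N).mul (hl M)
  have hq : ∀ i, IsQuad fun x => A x i + ∑ E ∈ K.powersetCard 2, (∏ N ∈ E, l N x) * b E i :=
    fun i => (isAff_affineMap A i).isQuad.add (IsQuad.sum _ fun E hE => (hprod E hE).mul_const _)
  choose c hc using hq
  refine ⟨c, fun x hx i => ?_⟩
  rw [← hc i x]
  have hcoe : (K : Set Plane) = {N₀, N₁, N₂} := by simp [hKe]
  obtain ⟨h1, h2, h3⟩ := hbary x (hcoe ▸ hx)
  rw [← hKe] at h2 h3
  have h4 := hA (fun N => l N x) (fun N _ => h1 N) h2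
  rw [h3] at h4
  rw [h4]
  simp

lemma continuousOn_flux {w : Vel Ω} (hw : w ∈ T.bernardiRaugel) {K : Finset Plane}
    (hK : K ∈ T.triangles) :
    ContinuousOn (fun x => x 0 • w.val x) (convexHull ℝ (K : Set Plane)) := by
  obtain ⟨c, hc⟩ := T.exists_quad_of_bernardiRaugel hw hK
  have h : ContinuousOn (fun x : Plane => x 0 • (!₂[quad (c 0) x, quad (c 1) x] : Plane))
      (convexHull ℝ (K : Set Plane)) := by
    have h0 := continuous_quad (c 0)
    have h1 := continuous_quad (c 1)
    have h2 : Continuous fun x => (!₂[quad (c 0) x, quad (c 1) x] : Plane) := by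
      refine (PiLp.continuous_toLp 2 _).comp (continuous_pi fun i => ?_)
      fin_cases i <;> assumption
    fun_prop
  refine h.congr fun x hx => ?_
  congr 1
  ext i
  fin_cases i
  · exact hc x hx 0
  · exact hc x hx 1

end Triangulation

/-! ### Energy bounds -/

/-- The squared Frobenius norm of the gradient of `r w`. -/
noncomputable def fluxDensity {Ω : Set Plane} (w : Vel Ω) (x : Plane) : ℝ :=
  ∑ i, ∑ j, ((if j = 0 then w.val x i else 0) + x 0 * w.grad i x j) ^ 2

lemma dir_zero_eq_single : dir 0 = EuclideanSpace.single 0 1 := by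
  ext i; fin_cases i <;> simp [dir]

/-- Hardy's inequality: the velocities are bounded in `L²` by their radial derivatives in `L²_1`. -/
lemma Vel.integral_sq_le {Ω : Set Plane} (hΩ : MeasurableSet Ω) (hr : Ω ⊆ offAxis) {R : ℝ}
    (hR0 : 0 ≤ R) (hR : ∀ x ∈ Ω, x 0 ≤ R) (w : Vel Ω) (i : Fin 2) :
    IntegrableOn (fun x => w.val x i ^ 2) Ω ∧
      ∫ x in Ω, w.val x i ^ 2 ≤ R * ∫ x in Ω, x 0 * w.grad i x 0 ^ 2 := by
  have hq := w.val_mem.comp hΩ hr i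
  have hg := (w.grad_mem i).comp hΩ hr 0
  -- The zero trace on `Γ` makes the extension by zero weakly differentiable in the half plane. That
  -- set is stable under the radial translation, so no cutoff is needed.
  have htg := TransGrad.of_isWeakGrad (m := 0) (τ := R) (κ := fun _ => 1) hΩ hr subset_rfl
    (w.weak i) hq (w.grad_mem i) contDiffOn_const
    (fun t y ht _ hy => by
      have h1 : 0 < (y - t • dir 0) 0 := hy
      simp [dir] at h1
      exact lt_of_le_of_lt ht h1) 0
  simp only [one_mul, fderiv_fun_const, Pi.zero_apply, _root_.zero_apply, zero_mul,
    add_zero] at htg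
  rw [← dir_zero_eq_single] at htg
  have hle := htg.lintegral_sq_le isOpen_offAxis subset_rfl hR0 (hq.halfL2 hΩ hr)
    (hg.halfL2 hΩ hr) fun y hy => hR y (Set.mem_of_indicator_ne_zero hy)
  have e1 : ∫ y, y 0 * Ω.indicator (fun y => w.grad i y 0) y ^ 2 =
      ∫ x in Ω, x 0 * w.grad i x 0 ^ 2 := by
    rw [← integral_indicator hΩ]
    refine integral_congr_ae (Filter.Eventually.of_forall fun x => ?_)
    by_cases hx : x ∈ Ω <;> simp [hx]
  rw [e1, ← ENNReal.ofReal_mul hR0] at hle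
  have e2 : ∫⁻ x in Ω, ‖w.val x i ^ 2‖ₑ ≤ ENNReal.ofReal (R * ∫ x in Ω, x 0 * w.grad i x 0 ^ 2) := by
    refine le_trans (le_trans (le_of_eq ?_) (lintegral_mono_set hr)) hle
    refine setLIntegral_congr_fun hΩ fun x hx => ?_
    simp only [Set.indicator_of_mem hx, enorm_pow]
  have hint : IntegrableOn (fun x => w.val x i ^ 2) Ω :=
    ⟨hq.1.pow 2, e2.trans_lt ENNReal.ofReal_lt_top⟩
  refine ⟨hint, ?_⟩
  have hnn : 0 ≤ R * ∫ x in Ω, x 0 * w.grad i x 0 ^ 2 :=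
    mul_nonneg hR0 (setIntegral_nonneg hΩ fun x hx => mul_nonneg (le_of_lt (hr hx)) (sq_nonneg _))
  rw [← ENNReal.ofReal_le_ofReal_iff hnn,
    ofReal_integral_eq_lintegral_ofReal hint (Filter.Eventually.of_forall fun x => sq_nonneg _)]
  refine le_trans (le_of_eq ?_) e2
  refine lintegral_congr fun x => ?_
  rw [Real.enorm_of_nonneg (sq_nonneg _)]

lemma Vel.integral_radial_sq_nonneg {Ω : Set Plane} (hΩ : MeasurableSet Ω) (hr : Ω ⊆ offAxis) (w : Vel Ω) :
    0 ≤ ∫ x in Ω, (x 0)⁻¹ * (w.val x 0 * w.val x 0) :=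
  setIntegral_nonneg hΩ fun _ hx => mul_nonneg (inv_nonneg.2 (le_of_lt (hr hx))) (mul_self_nonneg _)

/-- The derivative of `r w` is `w ⊗ e_r + r Dw`. The second part satisfies `r² ≤ R r`, the first is
handled by Hardy's inequality; each contributes `2 * R` to the constant, and the nonnegative radial
term of the energy is dropped. -/
lemma integral_fluxDensity_le {Ω : Set Plane} (hΩ : MeasurableSet Ω) (hr : Ω ⊆ offAxis) {R : ℝ}
    (hR0 : 0 ≤ R) (hR : ∀ x ∈ Ω, x 0 ≤ R) (w : Vel Ω) :
    IntegrableOn (fluxDensity w) Ω ∧ ∫ x in Ω, fluxDensity w x ≤ 4 * R * formA w w := by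
  obtain ⟨i0, h0⟩ := w.integral_sq_le hΩ hr hR0 hR 0
  obtain ⟨i1, h1⟩ := w.integral_sq_le hΩ hr hR0 hR 1
  have hgi : ∀ i j, IntegrableOn (fun x => x 0 * w.grad i x j ^ 2) Ω := fun i j => by
    simpa using ((w.grad_mem i).comp hΩ hr j).2
  set b : Plane → ℝ := fun x => 2 * (w.val x 0 ^ 2 + w.val x 1 ^ 2) +
    2 * R * ((x 0 * w.grad 0 x 0 ^ 2 + x 0 * w.grad 0 x 1 ^ 2) +
      (x 0 * w.grad 1 x 0 ^ 2 + x 0 * w.grad 1 x 1 ^ 2)) with hb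
  have hg2 : ∀ i, IntegrableOn (fun x => x 0 * w.grad i x 0 ^ 2 + x 0 * w.grad i x 1 ^ 2) Ω :=
    fun i => (hgi i 0).add (hgi i 1)
  have ib1 : IntegrableOn (fun x => 2 * (w.val x 0 ^ 2 + w.val x 1 ^ 2)) Ω := (i0.add i1).const_mul 2
  have ib2 : IntegrableOn (fun x => (x 0 * w.grad 0 x 0 ^ 2 + x 0 * w.grad 0 x 1 ^ 2) +
      (x 0 * w.grad 1 x 0 ^ 2 + x 0 * w.grad 1 x 1 ^ 2)) Ω :=
    (hg2 0).add (hg2 1)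
  have ib : IntegrableOn b Ω := ib1.add (ib2.const_mul (2 * R))
  have hle : ∀ x ∈ Ω, fluxDensity w x ≤ b x := by
    intro x hx
    have hx0 : 0 < x 0 := hr hx
    have key : ∀ v g : ℝ, (v + x 0 * g) ^ 2 ≤ 2 * v ^ 2 + 2 * R * (x 0 * g ^ 2) := fun v g => by
      have e1 : x 0 * (x 0 * g ^ 2) ≤ R * (x 0 * g ^ 2) := by gcongr; exact hR x hx
      nlinarith [sq_nonneg (v - x 0 * g)]
    have k1 := key (w.val x 0) (w.grad 0 x 0)
    have k2 := key 0 (w.grad 0 x 1)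
    have k3 := key (w.val x 1) (w.grad 1 x 0)
    have k4 := key 0 (w.grad 1 x 1)
    simp only [fluxDensity, Fin.sum_univ_two, hb, if_true, Fin.one_eq_zero_iff, OfNat.ofNat_ne_one,
      if_false]
    linarith
  have hnn : ∀ x, 0 ≤ fluxDensity w x := fun x =>
    Finset.sum_nonneg fun i _ => Finset.sum_nonneg fun j _ => sq_nonneg _
  have hmeas : AEStronglyMeasurable (fluxDensity w) (volume.restrict Ω) := by
    have m1 : ∀ i, AEStronglyMeasurable (fun x => w.val x i) (volume.restrict Ω) := fun i =>
      (w.val_mem.comp hΩ hr i).1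
    have m2 : ∀ i j, AEStronglyMeasurable (fun x => w.grad i x j) (volume.restrict Ω) :=
      fun i j => ((w.grad_mem i).comp hΩ hr j).1
    have m3 : AEStronglyMeasurable (fun x : Plane => x 0) (volume.restrict Ω) :=
      (by fun_prop : Measurable fun x : Plane => x 0).aestronglyMeasurable
    refine Finset.aestronglyMeasurable_fun_sum _ fun i _ =>
      Finset.aestronglyMeasurable_fun_sum _ fun j _ => ?_
    refine AEStronglyMeasurable.pow (AEStronglyMeasurable.add ?_ (m3.mul (m2 i j))) 2
    by_cases hj : j = 0
    · simpa [hj] using m1 i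
    · simpa [hj] using aestronglyMeasurable_const
  have hint : IntegrableOn (fluxDensity w) Ω := ib.mono' hmeas <| by
    filter_upwards [ae_restrict_mem hΩ] with x hx
    rw [Real.norm_of_nonneg (hnn x)]
    exact hle x hx
  refine ⟨hint, (setIntegral_mono_on hint ib hΩ hle).trans ?_⟩
  have e : ∫ x in Ω, b x = 2 * ((∫ x in Ω, w.val x 0 ^ 2) + ∫ x in Ω, w.val x 1 ^ 2) +
      2 * R * (((∫ x in Ω, x 0 * w.grad 0 x 0 ^ 2) + ∫ x in Ω, x 0 * w.grad 0 x 1 ^ 2) +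
        ((∫ x in Ω, x 0 * w.grad 1 x 0 ^ 2) + ∫ x in Ω, x 0 * w.grad 1 x 1 ^ 2)) := by
    rw [hb, integral_add ib1 (ib2.const_mul (2 * R)), integral_const_mul, integral_const_mul,
      integral_add i0 i1, integral_add (hg2 0) (hg2 1),
      integral_add (hgi 0 0) (hgi 0 1), integral_add (hgi 1 0) (hgi 1 1)]
  have e2 : ∫ x in Ω, x 0 * ∑ i, ⟪w.grad i x, w.grad i x⟫ =
      ((∫ x in Ω, x 0 * w.grad 0 x 0 ^ 2) + ∫ x in Ω, x 0 * w.grad 0 x 1 ^ 2) +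
        ((∫ x in Ω, x 0 * w.grad 1 x 0 ^ 2) + ∫ x in Ω, x 0 * w.grad 1 x 1 ^ 2) := by
    rw [← integral_add (hgi 0 0) (hgi 0 1), ← integral_add (hgi 1 0) (hgi 1 1),
      ← integral_add (hg2 0) (hg2 1)]
    congr 1
    ext x
    simp only [Fin.sum_univ_two, inner_eq_coords]
    ring
  have h2 := w.integral_radial_sq_nonneg hΩ hr
  have hnn' : ∀ i j, 0 ≤ ∫ x in Ω, x 0 * w.grad i x j ^ 2 := fun i j =>
    setIntegral_nonneg hΩ fun x hx => mul_nonneg (le_of_lt (hr hx)) (sq_nonneg _)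
  have h3 := mul_nonneg hR0 (hnn' 0 1)
  have h4 := mul_nonneg hR0 (hnn' 1 1)
  have h5 := mul_nonneg hR0 h2
  rw [e, formA, e2]
  nlinarith

/-! ### Interpolation error and consistency -/

namespace Triangulation

variable {Ω : Set Plane}

/-- Inside a triangle the weak gradient of `w` is the classical one, so each of these quadratics is
an entry of `D(r w)`, whose squared Frobenius norm is the density. -/
lemma integral_quad_fluxCoeff_sq_le (T : Triangulation Ω) (hΩ : IsLipschitzDomain Ω)
    (hr : Ω ⊆ offAxis) {w : Vel Ω} (hd : IntegrableOn (fluxDensity w) Ω) {K : Finset Plane}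
    (hK : K ∈ T.triangles) {c : Fin 2 → Fin 6 → ℝ}
    (hc : ∀ x ∈ convexHull ℝ (K : Set Plane), ∀ i, w.val x i = quad (c i) x) (i j : Fin 2) :
    ∫ x in convexHull ℝ (K : Set Plane), quad (fluxCoeff (c i) j) x ^ 2 ≤
      ∫ x in interior (convexHull ℝ (K : Set Plane)), fluxDensity w x := by
  have hsub := T.interior_hull_subset hΩ hK
  rw [← setIntegral_congr_set (interior_hull_ae_eq K)]
  have hae : ∀ i j, ∀ᵐ x, x ∈ interior (convexHull ℝ (K : Set Plane)) →
      w.grad i x j = fderiv ℝ (quad (c i)) x (EuclideanSpace.single j 1) := fun i j =>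
    (w.weak i).ae_eq_fderiv hΩ.1.measurableSet hr isOpen_interior hsub (hsub.trans hr)
      (w.grad_mem i) (contDiff_quad (c i)) (fun x hx => hc x (interior_subset hx) i) j
  refine setIntegral_mono_on_ae ?_ (hd.mono_set hsub) isOpen_interior.measurableSet ?_
  · exact (((continuous_quad _).pow 2).continuousOn.integrableOn_compact
      (isCompact_hull K)).mono_set interior_subset
  · filter_upwards [ae_all_iff.2 fun i => ae_all_iff.2 fun j => hae i j] with x hx hxK
    have e : ∀ i j, (if j = 0 then w.val x i else 0) + x 0 * w.grad i x j =
        quad (fluxCoeff (c i) j) x := fun i j => by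
      rw [quad_fluxCoeff, hx i j hxK, hc x (interior_subset hxK) i]
    simp only [fluxDensity, e]
    refine le_trans ?_ (Finset.single_le_sum
      (f := fun i => ∑ j, quad (fluxCoeff (c i) j) x ^ 2)
      (fun i _ => Finset.sum_nonneg fun j _ => sq_nonneg _) (Finset.mem_univ i))
    exact Finset.single_le_sum (f := fun j => quad (fluxCoeff (c i) j) x ^ 2)
      (fun j _ => sq_nonneg _) (Finset.mem_univ j)

/-- The local interpolation error estimate for `r w`, `w` a Bernardi–Raugel field. -/
lemma exists_local_bound {σ : ℝ} (hσ : 0 < σ) : ∃ κ : ℝ, 0 ≤ κ ∧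
    ∀ (Ω : Set Plane) (T : Triangulation Ω), IsLipschitzDomain Ω → Ω ⊆ offAxis →
      T.ShapeRegular σ → ∀ w ∈ T.bernardiRaugel, IntegrableOn (fluxDensity w) Ω →
      ∀ a b : ℝ, a + b / 2 = 1 → (∀ t ∈ Set.Icc (0 : ℝ) 1, |a + b * t| ≤ 4) →
      ∀ R, T.HasEdgeMoments a b (fun x => x 0 • w.val x) R → ∀ K ∈ T.triangles, ∃ s : ℝ,
        s ^ 2 * volume.real (interior (convexHull ℝ (K : Set Plane))) ≤
          κ * ∫ x in interior (convexHull ℝ (K : Set Plane)), fluxDensity w x ∧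
        ∀ x ∈ interior (convexHull ℝ (K : Set Plane)),
          ‖x 0 • w.val x - R x‖ ≤ Metric.diam (convexHull ℝ (K : Set Plane)) * s := by
  obtain ⟨κ, hκ, hinv⟩ := exists_inverse_estimate
  refine ⟨64 * Real.pi * (1 + 32 * σ ^ 2) ^ 2 * κ, by positivity, ?_⟩
  intro Ω T hΩ hr hT w hw hd a b hab hab' R hR K hK
  obtain ⟨c, hc⟩ := T.exists_quad_of_bernardiRaugel hw hK
  have hI := T.integral_quad_fluxCoeff_sq_le hΩ hr hd hK hc
  have hF := T.continuousOn_flux hw hK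
  obtain ⟨ctr, hctr⟩ := hT K hK
  obtain ⟨A, hRA, hA⟩ := hR K hK
  obtain ⟨N₀, N₁, N₂, hKe, -, -, -, hD⟩ := T.exists_vertices hK
  have hcoe : (K : Set Plane) = {N₀, N₁, N₂} := by simp [hKe]
  set H := convexHull ℝ (K : Set Plane) with hH
  set h := Metric.diam H
  have hh : 0 ≤ h := Metric.diam_nonneg
  have hbdd : Bornology.IsBounded H := (isCompact_hull K).isBounded
  have hN : ∀ N ∈ K, N ∈ H := fun N hN => subset_convexHull ℝ _ (by simpa using hN)
  have hN₀ : N₀ ∈ H := hN _ (by simp [hKe])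
  set D := cross (N₁ - N₀) (N₂ - N₀)
  have hDpos : 0 < |D| := abs_pos.2 hD
  set I := ∫ x in interior H, fluxDensity w x
  have hI0 : 0 ≤ I := integral_nonneg fun x =>
    Finset.sum_nonneg fun i _ => Finset.sum_nonneg fun j _ => sq_nonneg _
  -- The bound for all entries of `D(r w)` on the triangle that the inverse estimate yields.
  set m := Real.sqrt (κ * I / |D|)
  have hm0 : 0 ≤ m := Real.sqrt_nonneg _
  have hm2 : m ^ 2 * |D| = κ * I := by
    rw [Real.sq_sqrt (by positivity)]; field_simp
  have hm : ∀ i, ∀ x ∈ H, ∀ j, |quad (fluxCoeff (c i) j) x| ≤ m := by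
    intro i x hx j
    refine Real.le_sqrt_of_sq_le ?_
    rw [sq_abs, le_div_iff₀ hDpos]
    have h1 := hinv N₀ N₁ N₂ hD (quad (fluxCoeff (c i) j)) ⟨_, fun _ => rfl⟩ x
      (by rw [← hcoe]; exact hx)
    rw [← hcoe] at h1
    exact h1.trans (by gcongr; exact hI i j)
  have hosc : ∀ x ∈ H, ‖x 0 • w.val x - N₀ 0 • w.val N₀‖ ≤ 4 * m * h := by
    intro x hx
    have h1 : ∀ i, |(x 0 • w.val x - N₀ 0 • w.val N₀) i| ≤ 2 * m * h := fun i => by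
      simp only [PiLp.sub_apply, PiLp.smul_apply, smul_eq_mul, hc x hx i, hc N₀ hN₀ i]
      refine (abs_r_mul_quad_sub_le (convex_convexHull ℝ _) (c i) (hm i) hN₀ hx).trans ?_
      gcongr
      rw [← dist_eq_norm]
      exact Metric.dist_le_diam_of_mem hbdd hx hN₀
    refine (norm_le_abs_add_abs _).trans ?_
    linarith [h1 0, h1 1]
  -- The interpolant is compared with the same constant `r w (N₀)` as the field. Shape regularity
  -- bounds `8 * h ^ 2 / |D|` by `8 * (4 * σ ^ 2)`.
  have hAb : ∀ x ∈ H, ‖A x - N₀ 0 • w.val N₀‖ ≤ 32 * σ ^ 2 * (4 * m * h) := by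
    intro x hx
    refine (norm_affine_sub_le hKe hD (h := h) (δ := 4 * m * h)
      (fun N hN' M hM' => ?_) (by positivity)
      (fun N hN' M hM' => abs_cross_sub_le_of_edgeMoment hF hN' hM' hab hab' hosc (hA N hN' M hM'))
      hx).trans ?_
    · rw [← dist_eq_norm]
      exact Metric.dist_le_diam_of_mem hbdd (hN M hM') (hN N hN')
    · gcongr
      rw [div_le_iff₀ hDpos]
      have := diam_sq_le_of_closedBall_subset hD hσ hh (by rw [← hcoe]; exact hctr)
      linarith
  -- The oscillation of `r w` plus the deviation of the interpolant, both from the value at `N₀`,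
  -- with the factor `h` split off.
  refine ⟨4 * (1 + 32 * σ ^ 2) * m, ?_, fun x hx => ?_⟩
  · have hv : volume.real (interior H) ≤ 4 * Real.pi * |D| := by
      rw [measureReal_congr (interior_hull_ae_eq K), hcoe]
      exact volume_hull_le hD
    calc _ ≤ (4 * (1 + 32 * σ ^ 2) * m) ^ 2 * (4 * Real.pi * |D|) := by gcongr
      _ = 64 * Real.pi * (1 + 32 * σ ^ 2) ^ 2 * (m ^ 2 * |D|) := by ring
      _ = _ := by rw [hm2]; ring
  · have hxH := interior_subset hx
    rw [hRA hx]
    have e : x 0 • w.val x - A x =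
        (x 0 • w.val x - N₀ 0 • w.val N₀) - (A x - N₀ 0 • w.val N₀) := by abel
    rw [e]
    refine (norm_sub_le _ _).trans ((add_le_add (hosc x hxH) (hAb x hxH)).trans (le_of_eq ?_))
    ring

variable (T : Triangulation Ω)

/-- Square summation of a piecewise constant function. -/
lemma lintegral_piecewise_sq_le (hΩ : IsLipschitzDomain Ω) (s : Finset Plane → ℝ) {κ : ℝ}
    (hκ : 0 ≤ κ) {d : Plane → ℝ} (hd : IntegrableOn d Ω) (hd0 : ∀ x, 0 ≤ d x)
    (hs : ∀ K ∈ T.triangles, s K ^ 2 * volume.real (interior (convexHull ℝ (K : Set Plane))) ≤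
      κ * ∫ x in interior (convexHull ℝ (K : Set Plane)), d x) :
    ∫⁻ x in Ω, ‖∑ K ∈ T.triangles,
      (interior (convexHull ℝ (K : Set Plane))).indicator (fun _ => s K) x‖ₑ ^ 2 ≤
        ENNReal.ofReal (κ * ∫ x in Ω, d x) := by
  have hae := T.ae_eq_iUnion_interior hΩ
  have hdisj : Set.PairwiseDisjoint (T.triangles : Set (Finset Plane))
      fun K => interior (convexHull ℝ (K : Set Plane)) := fun K hK K' hK' hne =>
    T.disjoint_interior hK hK' hne
  have hm : ∀ K ∈ T.triangles, MeasurableSet (interior (convexHull ℝ (K : Set Plane))) :=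
    fun K _ => isOpen_interior.measurableSet
  rw [setLIntegral_congr hae, setIntegral_congr_set hae,
    lintegral_biUnion_finset hdisj hm, integral_biUnion_finset T.triangles hm hdisj
      (fun K hK => hd.mono_set (T.interior_hull_subset hΩ hK)), Finset.mul_sum,
    ENNReal.ofReal_sum_of_nonneg fun K _ => mul_nonneg hκ (integral_nonneg fun x => hd0 x)]
  refine Finset.sum_le_sum fun K hK => le_trans (le_of_eq ?_) (ENNReal.ofReal_le_ofReal (hs K hK))
  have hfin : volume (interior (convexHull ℝ (K : Set Plane))) ≠ (⊤ : ℝ≥0∞) :=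
    ((measure_mono interior_subset).trans_lt (isCompact_hull K).measure_lt_top).ne
  rw [ENNReal.ofReal_mul (sq_nonneg _), ofReal_measureReal hfin,
    setLIntegral_congr_fun (g := fun _ => ENNReal.ofReal (s K ^ 2)) (hm K hK) fun x hx => by
      simp only [T.sum_indicator_eq hK s hx]
      rw [← enorm_pow, Real.enorm_of_nonneg (sq_nonneg _)]]
  simp

lemma measurable_piecewise (s : Finset Plane → ℝ) : Measurable fun x => ∑ K ∈ T.triangles,
    (interior (convexHull ℝ (K : Set Plane))).indicator (fun _ => s K) x :=
  Finset.measurable_fun_sum _ fun _ _ => measurable_const.indicator isOpen_interior.measurableSet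

/-- The consistency error for a single field, given a triangle-wise error bound. -/
lemma integral_inner_le_of_piecewise (hΩ : IsLipschitzDomain Ω) {G E : Plane → Plane}
    (hG : AEStronglyMeasurable G (volume.restrict Ω)) (s : Finset Plane → ℝ)
    (hE : ∀ K ∈ T.triangles, ∀ x ∈ interior (convexHull ℝ (K : Set Plane)),
      ‖E x‖ ≤ Metric.diam (convexHull ℝ (K : Set Plane)) * s K) {B : ℝ≥0∞}
    (hB : ∫⁻ x in Ω, ‖∑ K ∈ T.triangles,
      (interior (convexHull ℝ (K : Set Plane))).indicator (fun _ => s K) x‖ₑ ^ 2 ≤ B ^ 2) :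
    ENNReal.ofReal (∫ x in Ω, ⟪G x, E x⟫) ≤
      B * eLpNorm (fun x => T.meshSize x • G x) 2 (volume.restrict Ω) := by
  set S : Plane → ℝ := fun x => ∑ K ∈ T.triangles,
      (interior (convexHull ℝ (K : Set Plane))).indicator (fun _ => s K) x with hS
  have hSm : Measurable S := T.measurable_piecewise s
  have hmesh : Measurable T.meshSize := T.measurable_piecewise _
  have hSB : eLpNorm S 2 (volume.restrict Ω) ≤ B := by
    have := eLpNorm_nnreal_pow_eq_lintegral (f := S) (μ := volume.restrict Ω) (p := 2) (by simp)
    rw [← ENNReal.rpow_le_rpow_iff (z := 2) (by norm_num)]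
    simp only [ENNReal.rpow_ofNat]
    refine le_trans (le_of_eq ?_) hB
    simpa using this
  -- The mesh size is attached to `G` and the local constants to `S`, so that Cauchy–Schwarz
  -- produces the norm of `h G`.
  have hpt : ∀ᵐ x ∂volume.restrict Ω, ‖⟪G x, E x⟫‖ ≤ ‖S x • (T.meshSize x • G x)‖ := by
    rw [Measure.restrict_congr_set (T.ae_eq_iUnion_interior hΩ)]
    filter_upwards [ae_restrict_mem (Finset.measurableSet_biUnion _ fun K _ =>
      isOpen_interior.measurableSet)] with x hx
    obtain ⟨K, hK, hxK⟩ := Set.mem_iUnion₂.1 hx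
    have h1 : S x = s K := T.sum_indicator_eq hK s hxK
    have h2 : T.meshSize x = Metric.diam (convexHull ℝ (K : Set Plane)) :=
      T.sum_indicator_eq hK (fun K => Metric.diam (convexHull ℝ (K : Set Plane))) hxK
    have h3 := hE K hK x hxK
    rw [norm_smul, norm_smul, h1, h2]
    have h4 := norm_inner_le_norm (𝕜 := ℝ) (G x) (E x)
    calc _ ≤ ‖G x‖ * ‖E x‖ := h4
      _ ≤ ‖G x‖ * ‖Metric.diam (convexHull ℝ (K : Set Plane)) * s K‖ := by
          gcongr; exact h3.trans (Real.le_norm_self _)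
      _ = _ := by rw [norm_mul]; ring
  calc ENNReal.ofReal (∫ x in Ω, ⟪G x, E x⟫) ≤ ‖∫ x in Ω, ⟪G x, E x⟫‖ₑ := Real.ofReal_le_enorm _
    _ ≤ ∫⁻ x in Ω, ‖⟪G x, E x⟫‖ₑ := enorm_integral_le_lintegral_enorm _
    _ = eLpNorm (fun x => ⟪G x, E x⟫) 1 (volume.restrict Ω) := eLpNorm_one_eq_lintegral_enorm.symm
    _ ≤ eLpNorm (S • fun x => T.meshSize x • G x) 1 (volume.restrict Ω) := eLpNorm_mono_ae hpt
    _ ≤ eLpNorm S 2 (volume.restrict Ω) *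
          eLpNorm (fun x => T.meshSize x • G x) 2 (volume.restrict Ω) :=
        eLpNorm_smul_le_mul_eLpNorm (hmesh.aestronglyMeasurable.smul hG) hSm.aestronglyMeasurable
    _ ≤ _ := by gcongr

/-- The consistency error of any interpolation determined by normalized edge moments. -/
lemma exists_consistencyError_le (hΩ : IsLipschitzDomain Ω) (hr : ∀ x ∈ Ω, 0 < x 0) {σ : ℝ}
    (hσ : 0 < σ) : ∃ C : ℝ≥0, ∀ T : Triangulation Ω, T.ShapeRegular σ →
      ∀ a b : ℝ, a + b / 2 = 1 → (∀ t ∈ Set.Icc (0 : ℝ) 1, |a + b * t| ≤ 4) →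
      ∀ interp : (Plane → Plane) → Plane → Plane,
        (∀ F, (∀ K ∈ T.triangles, ContinuousOn F (convexHull ℝ (K : Set Plane))) →
          T.HasEdgeMoments a b F (interp F)) →
        ∀ G, AEStronglyMeasurable G (volume.restrict Ω) → T.consistencyError interp G ≤
          C * eLpNorm (fun x => T.meshSize x • G x) 2 (volume.restrict Ω) := by
  obtain ⟨κ, hκ, hloc⟩ := exists_local_bound hσ
  obtain ⟨R, hR⟩ := hΩ.2.2.1.exists_norm_le
  have hR' : ∀ x ∈ Ω, x 0 ≤ max R 0 := fun x hx =>
    ((le_abs_self _).trans ((PiLp.norm_apply_le x 0).trans (hR x hx))).trans (le_max_left _ _)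
  set ρ := max R 0
  have hρ : 0 ≤ ρ := le_max_right _ _
  -- `κ` depends on `σ` only and `ρ` bounds the distance of points of `Ω` to the axis; `4 * ρ` is
  -- the constant that relates `D(r w)` to the energy.
  refine ⟨(Real.sqrt (κ * (4 * ρ))).toNNReal, fun T hT a b hab hab' interp hint G hG => ?_⟩
  refine iSup₂_le fun w hw => ?_
  obtain ⟨hd, hdle⟩ := integral_fluxDensity_le hΩ.1.measurableSet hr hρ hR' w
  have hF : ∀ K ∈ T.triangles, ContinuousOn (fun x => x 0 • w.val x) (convexHull ℝ (K : Set Plane)) :=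
    fun K hK => T.continuousOn_flux hw.1 hK
  choose! s hs hs' using hloc Ω T hΩ hr hT w hw.1 hd a b hab hab' _ (hint _ hF)
  have hd0 : ∀ x, 0 ≤ fluxDensity w x := fun x =>
    Finset.sum_nonneg fun i _ => Finset.sum_nonneg fun j _ => sq_nonneg _
  have hsq := T.lintegral_piecewise_sq_le hΩ s hκ hd hd0 hs
  have hE : 0 ≤ w.energyNorm := Real.sqrt_nonneg _
  rcases hE.eq_or_lt with h0 | hpos
  -- For zero energy norm the quotient is a division by zero, which has the value `0`.
  · rw [← h0]; simp
  have hA : w.energyNorm ^ 2 = formA w w := Real.sq_sqrt (Real.sqrt_pos.1 hpos).le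
  have hle := T.integral_inner_le_of_piecewise hΩ hG s hs'
    (B := ENNReal.ofReal (Real.sqrt (κ * (4 * ρ)) * w.energyNorm)) (by
      refine hsq.trans ?_
      rw [← ENNReal.ofReal_pow (by positivity), mul_pow, Real.sq_sqrt (by positivity), hA]
      refine ENNReal.ofReal_le_ofReal ?_
      calc _ ≤ κ * (4 * ρ * formA w w) := by gcongr
        _ = _ := by ring)
  rw [ENNReal.ofReal_div_of_pos hpos]
  refine ENNReal.div_le_of_le_mul (hle.trans (le_of_eq ?_))
  rw [ENNReal.ofReal_mul (Real.sqrt_nonneg _)]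
  change ENNReal.ofReal _ * _ * _ = ENNReal.ofReal _ * _ * _
  ring

end Triangulation

/-! ### The theorem -/

lemma MemL2.const_smul {Ω : Set Plane} {s : ℤ} {v : Plane → Plane} (hv : MemL2 Ω s v) (c : ℝ) :
    MemL2 Ω s fun x => c • v x := by
  refine ⟨hv.1.const_smul c, (hv.2.const_mul (‖c‖ ^ 2)).congr
    (Filter.Eventually.of_forall fun x => ?_)⟩
  simp only [norm_smul]
  ring

end AxiStokes

theorem theorem4p2 (Ω : Set Plane) (hΩ : IsLipschitzDomain Ω) (hr : ∀ x ∈ Ω, 0 < x 0)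
    (σ : ℝ) (hσ : 0 < σ) :
    ∃ C : ℝ≥0, ∀ T : Triangulation Ω, T.ShapeRegular σ →
      ∀ (ν : ℝ) (f : Plane → Plane) (u : Vel Ω) (p : Plane → ℝ) (α : H1 Ω),
        0 < ν → MemL2 Ω 1 f → IsStokesSolution ν f u p → IsHelmholtzPotential f α →
        (MemL2 Ω 0 f → MemL2 Ω 0 (projLaplacian ν f α)) ∧
        (MemL2 Ω 0 (projLaplacian ν f α) →
          T.consistencyError T.rt0Interp (projLaplacian ν f α) ≤
            C * eLpNorm (fun x => T.meshSize x • projLaplacian ν f α x) 2 (volume.restrict Ω) ∧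
          T.consistencyError T.bdm1Interp (projLaplacian ν f α) ≤
            C * eLpNorm (fun x => T.meshSize x • projLaplacian ν f α x) 2 (volume.restrict Ω)) := by
  obtain ⟨C, hC⟩ := Triangulation.exists_consistencyError_le hΩ hr hσ
  refine ⟨C, fun T hT ν f u p α _ hf _ hα => ⟨fun hf0 => ?_, fun hG => ⟨?_, ?_⟩⟩⟩
  · exact ((memL2_zero_helmholtzProj hΩ hr hf hf0 hα).const_smul ν⁻¹).neg
  -- RT0 and BDM1 differ only in the weights `1` and `4 - 6t`. Both have mean one and absolute value
  -- at most `4` on `[0, 1]`, the latter attained by BDM1 at `t = 0`.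
  · exact hC T hT 1 0 (by norm_num) (fun t _ => by norm_num) _
      (fun F hF => (T.rt0Interp_spec hF).hasEdgeMoments T hF) _ hG.1
  · exact hC T hT 4 (-6) (by norm_num)
      (fun t ht => abs_le.2 ⟨by linarith [ht.2], by linarith [ht.1]⟩) _
      (fun F hF => (T.bdm1Interp_spec hF).hasEdgeMoments T hF) _ hG.1
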